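/- Throughout, all vector spaces and algebras are complex, all Banach spaces are infinite-dimensional, and an operator is a continuous linear map; $\mathscr{B}(X,Y)$ is the Banach space of all operators from $X$ to $Y$, and $\mathscr{B}(X)=\mathscr{B}(X,X)$. An ideal of operators $\mathscr{J}$ assigns to every pair $(X,Y)$ of Banach spaces a subspace $\mathscr{J}(X,Y)$ of $\mathscr{B}(X,Y)$ such that $TSR\in\mathscr{J}(W,Z)$ whenever $R\in\mathscr{B}(W,X)$, $S\in\mathscr{J}(X,Y)$ and $T\in\mathscr{B}(Y,Z)$; it is closed if every $\mathscr{J}(X,Y)$ is closed in the operator norm, and non-zero if $\mathscr{J}(X,Y)\neq\{0\}$ for all $X$ and $Y$. We write $\mathscr{J}(X)=\mathscr{J}(X,X)$. An operator is strictly singular if every subspace of its domain on which it is bounded below is finite-dimensional. For a unital algebra $A$, idempotent matrices $P\in M_m(A)$, $Q\in M_n(A)$ satisfy $P\sim_0 Q$ if $P=RT$ and $Q=TR$ for some $R\in M_{m,n}(A)$, $T\in M_{n,m}(A)$, and $K_0(A)$ is the Grothendieck group of the semigroup of $\sim_0$-classes under $\oplus$; $[P]_0$ is the class of $P$. For a non-unital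 algebra $A$ with unitization $A^\sharp$ and scalar map $s(a+\zeta 1)=\zeta 1$, $K_0(A)=\{[P]_0-[s_n(P)]_0 : n\in\mathbb{N},\ P=P^2\in M_n(A^\sharp)\}\subseteq K_0(A^\sharp)$, where $s_n$ applies $s$ to each entry. For a unital Banach algebra $A$, $K_1(A)$ is the group, under $\oplus$, of invertible matrices over $A$ modulo the relation that $U\in M_m(A)$ and $V\in M_n(A)$ become joined by a continuous path of invertible matrices in $M_k(A)$ after adding identity blocks, for some $k>\max\{m,n\}$; $[U]_1$ is the class of $U$. A unital algebra $A$ is stably finite if, for every $n$ and all idempotents $P,Q\in M_n(A)$ with $P=RT$, $Q=TR$ for some $R,T\in M_n(A)$ and $PQ=P=QP$, one has $P=Q$. **Proposition.** Let $X$ be a Banach space and let $\mathscr{J}$ be a closed, non-zero ideal of operators all of whose members are strictly singular. Let $\iota:\mathscr{J}(X)\to\mathscr{B}(X)$ be the inclusion and $\pi:\mathscr{B}(X)\to\mathscr{B}(X)/\mathscr{J}(X)$ the quotient map. Let $\delta_1:K_1(\mathscr{B}(X)/\mathscr{J}(X))\to K_0(\mathscr{J}(X))$ be the index map: for $u$ an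 invertible $n\times n$ matrix over $\mathscr{B}(X)/\mathscr{J}(X)$, $\delta_1([u]_1)=[w(I^{(n)}\oplus 0)w^{-1}]_0-[I^{(n)}\oplus 0]_0$, where $w$ is any invertible $2n\times 2n$ matrix over $\mathscr{B}(X)$ lifting $u\oplus u^{-1}$. The following assertions are equivalent: (a) the map $K_0(\iota):K_0(\mathscr{J}(X))\to K_0(\mathscr{B}(X))$ is injective; (b) the map $\delta_1:K_1(\mathscr{B}(X)/\mathscr{J}(X))\to K_0(\mathscr{J}(X))$ is zero; (c) the map $K_1(\pi):K_1(\mathscr{B}(X))\to K_1(\mathscr{B}(X)/\mathscr{J}(X))$ is surjective (equivalently, it is an isomorphism); (d) for each positive integer $m$, $X^m$ is not linearly homeomorphic to any of its proper, closed subspaces of finite codimension; (e) for each positive integer $m$, every Fredholm operator on $X^m$ has Fredholm index zero. These assertions all hold when the algebra $\mathscr{B}(X)$ is stably finite. -/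

import Mathlib

universe u v

namespace BanachK

open Matrix Topology

section KZero

/-- Algebraic equivalence `P ∼₀ Q`: there are rectangular matrices `R`, `T` over `A` with `P = R T`
and `Q = T R`. -/
def AlgEquivalent {A : Type u} [NonUnitalRing A] {m n : Type} [Fintype m] [Fintype n]
    (P : Matrix m m A) (Q : Matrix n n A) : Prop :=
  ∃ (R : Matrix m n A) (T : Matrix n m A), P = R * T ∧ Q = T * R

theorem AlgEquivalent.symm {A : Type u} [NonUnitalRing A] {m n : Type} [Fintype m] [Fintype n]
    {P : Matrix m m A} {Q : Matrix n n A} (h : AlgEquivalent P Q) : AlgEquivalent Q P := by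
  obtain ⟨R, T, h1, h2⟩ := h
  exact ⟨T, R, h2, h1⟩

theorem AlgEquivalent.refl {A : Type u} [NonUnitalRing A] {m : Type} [Fintype m]
    {P : Matrix m m A} (h : P * P = P) : AlgEquivalent P P := ⟨P, P, h.symm, h.symm⟩

theorem AlgEquivalent.trans {A : Type u} [NonUnitalRing A] {l m n : Type} [Fintype l] [Fintype m]
    [Fintype n] {P : Matrix l l A} {Q : Matrix m m A} {S : Matrix n n A} (hP : P * P = P)
    (hS : S * S = S) (h : AlgEquivalent P Q) (h' : AlgEquivalent Q S) : AlgEquivalent P S := by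
  obtain ⟨R, T, h1, h2⟩ := h
  obtain ⟨R', T', h3, h4⟩ := h'
  refine ⟨R * R', T' * T, ?_, ?_⟩
  · calc P = (R * T) * (R * T) := by rw [← h1, hP]
      _ = R * (T * R) * T := by simp only [Matrix.mul_assoc]
      _ = R * (R' * T') * T := by rw [← h2, h3]
      _ = _ := by simp only [Matrix.mul_assoc]
  · calc S = (T' * R') * (T' * R') := by rw [← h4, hS]
      _ = T' * (R' * T') * R' := by simp only [Matrix.mul_assoc]
      _ = T' * (T * R) * R' := by rw [← h3, h2]
      _ = _ := by simp only [Matrix.mul_assoc]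

theorem AlgEquivalent.map {A : Type u} {B : Type v} [Ring A] [Ring B] (f : A →+* B) {m n : Type}
    [Fintype m] [Fintype n] {P : Matrix m m A} {Q : Matrix n n A} (h : AlgEquivalent P Q) :
    AlgEquivalent (P.map f) (Q.map f) := by
  obtain ⟨R, T, rfl, rfl⟩ := h
  exact ⟨R.map f, T.map f, by simp [Matrix.map_mul], by simp [Matrix.map_mul]⟩

theorem AlgEquivalent.blocks {A : Type u} [Ring A] {m n m' n' : Type}
    [Fintype m] [Fintype n] [Fintype m'] [Fintype n'] {P : Matrix m m A} {Q : Matrix n n A}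
    {P' : Matrix m' m' A} {Q' : Matrix n' n' A} (h : AlgEquivalent P Q)
    (h' : AlgEquivalent P' Q') :
    AlgEquivalent (fromBlocks P 0 0 P') (fromBlocks Q 0 0 Q') := by
  obtain ⟨R, T, rfl, rfl⟩ := h
  obtain ⟨R', T', rfl, rfl⟩ := h'
  exact ⟨fromBlocks R 0 0 R', fromBlocks T 0 0 T', by simp [fromBlocks_multiply],
    by simp [fromBlocks_multiply]⟩

theorem AlgEquivalent.reindex {A : Type u} [Ring A] {m n : Type}
    [Fintype m] [Fintype n] {P : Matrix m m A} (h : P * P = P) (e : n ≃ m) :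
    AlgEquivalent P (P.submatrix e e) := by
  refine ⟨P.submatrix id e, P.submatrix e id, ?_, ?_⟩
  · rw [Matrix.submatrix_mul_equiv, h]; rfl
  · rw [← Matrix.submatrix_mul _ _ e id e Function.bijective_id, h]

theorem AlgEquivalent.zero {A : Type u} [NonUnitalRing A] (m n : Type) [Fintype m] [Fintype n] :
    AlgEquivalent (0 : Matrix m m A) (0 : Matrix n n A) := ⟨0, 0, by simp, by simp⟩

/-- `IP_∞(A)`: an idempotent matrix of some size `n` over `A`. (The empty matrix `n = 0` is allowed;
it is equivalent to the zero idempotents of every other size.) -/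
structure Idem (A : Type u) [Ring A] where
  n : ℕ
  mat : Matrix (Fin n) (Fin n) A
  idem : mat * mat = mat

/-- The equivalence relation `∼₀` on `IP_∞(A)`. -/
instance Idem.setoid (A : Type u) [Ring A] : Setoid (Idem A) where
  r P Q := AlgEquivalent P.mat Q.mat
  iseqv := ⟨fun P => .refl P.idem, fun h => h.symm, fun {P _ S} h h' => h.trans P.idem S.idem h'⟩

/-- `V(A) = IP_∞(A) / ∼₀`. -/
def V (A : Type u) [Ring A] : Type u := Quotient (Idem.setoid A)

/-- An idempotent matrix indexed by any finite type, viewed in `IP_∞(A)` by enumerating the index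
type. -/
noncomputable def Idem.of {A : Type u} [Ring A] {m : Type} [Fintype m] (P : Matrix m m A)
    (h : P * P = P) : Idem A where
  n := Fintype.card m
  mat := P.submatrix (Fintype.equivFin m).symm (Fintype.equivFin m).symm
  idem := by rw [Matrix.submatrix_mul_equiv, h]

/-- The class `[P]_V` of an idempotent matrix. -/
noncomputable def V.mk {A : Type u} [Ring A] {m : Type} [Fintype m] (P : Matrix m m A)
    (h : P * P = P) : V A := Quotient.mk _ (Idem.of P h)

theorem V.mk_eq_iff {A : Type u} [Ring A] {m n : Type} [Fintype m] [Fintype n]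
    {P : Matrix m m A} {hP : P * P = P} {Q : Matrix n n A} {hQ : Q * Q = Q} :
    V.mk P hP = V.mk Q hQ ↔ AlgEquivalent P Q := by
  have h1 := AlgEquivalent.reindex hP (Fintype.equivFin m).symm
  have h2 := AlgEquivalent.reindex hQ (Fintype.equivFin n).symm
  have i1 : _ * _ = _ := (Idem.of P hP).idem
  have i2 : _ * _ = _ := (Idem.of Q hQ).idem
  refine Quotient.eq.trans ⟨fun h => ?_, fun h => ?_⟩
  · exact (h1.trans hP i2 h).trans hP hQ h2.symm
  · exact (h1.symm.trans i1 hQ h).trans i1 i2 h2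

theorem V.mk_eq {A : Type u} [Ring A] (P : Idem A) :
    (Quotient.mk _ P : V A) = V.mk P.mat P.idem :=
  Quotient.sound (AlgEquivalent.reindex P.idem _)

theorem V.ind {A : Type u} [Ring A] {p : V A → Prop}
    (h : ∀ (n : ℕ) (P : Matrix (Fin n) (Fin n) A) (hP : P * P = P), p (V.mk P hP)) (x : V A) :
    p x := by
  induction x using Quotient.inductionOn with
  | h P => rw [V.mk_eq]; exact h _ _ _

theorem idem_blocks {A : Type u} [Ring A] {m n : Type} [Fintype m] [Fintype n]
    {P : Matrix m m A} {Q : Matrix n n A} (hP : P * P = P) (hQ : Q * Q = Q) :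
    fromBlocks P 0 0 Q * fromBlocks P 0 0 Q = fromBlocks P 0 0 Q := by
  simp [fromBlocks_multiply, hP, hQ]

/-- Addition on `V(A)`: `[P]_V + [Q]_V = [P ⊕ Q]_V`. -/
noncomputable instance V.instAdd (A : Type u) [Ring A] : Add (V A) where
  add := Quotient.map₂
    (fun P Q => Idem.of (fromBlocks P.mat 0 0 Q.mat) (idem_blocks P.idem Q.idem))
    (fun _ _ h _ _ h' => Quotient.exact (V.mk_eq_iff.2 (h.blocks h')))

theorem V.mk_add_mk {A : Type u} [Ring A] {m n : Type} [Fintype m] [Fintype n]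
    {P : Matrix m m A} {hP : P * P = P} {Q : Matrix n n A} {hQ : Q * Q = Q} :
    V.mk P hP + V.mk Q hQ = V.mk (fromBlocks P 0 0 Q) (idem_blocks hP hQ) :=
  V.mk_eq_iff.2 ((AlgEquivalent.reindex hP _).symm.blocks (AlgEquivalent.reindex hQ _).symm)

noncomputable instance V.instZero (A : Type u) [Ring A] : Zero (V A) where
  zero := V.mk (0 : Matrix (Fin 0) (Fin 0) A) (by simp)

theorem V.mk_zero {A : Type u} [Ring A] (m : Type) [Fintype m] :
    V.mk (0 : Matrix m m A) (by simp) = 0 := V.mk_eq_iff.2 (AlgEquivalent.zero _ _)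

/-- `V(A)` is a commutative monoid under `⊕`; its zero is the class of the empty matrix, that is,
of any zero matrix. -/
noncomputable instance V.instAddCommMonoid (A : Type u) [Ring A] : AddCommMonoid (V A) where
  zero_add x := by
    induction x using V.ind with
    | h n P hP =>
      refine V.mk_add_mk.trans (V.mk_eq_iff.2 ?_)
      have := AlgEquivalent.reindex (idem_blocks (P := (0 : Matrix (Fin 0) (Fin 0) A)) (by simp) hP)
        (Equiv.emptySum (Fin 0) (Fin n)).symm
      exact this
  add_zero x := by
    induction x using V.ind with
    | h n P hP =>
      refine V.mk_add_mk.trans (V.mk_eq_iff.2 ?_)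
      have := AlgEquivalent.reindex (idem_blocks (Q := (0 : Matrix (Fin 0) (Fin 0) A)) hP (by simp))
        (Equiv.sumEmpty (Fin n) (Fin 0)).symm
      exact this
  add_comm x y := by
    induction x using V.ind with
    | h m P hP =>
    induction y using V.ind with
    | h n Q hQ =>
      rw [V.mk_add_mk, V.mk_add_mk, V.mk_eq_iff]
      have := AlgEquivalent.reindex (idem_blocks hP hQ) (Equiv.sumComm (Fin n) (Fin m))
      convert this using 1
      ext (i | i) (j | j) <;> rfl
  add_assoc x y z := by
    induction x using V.ind with
    | h l P hP =>
    induction y using V.ind with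
    | h m Q hQ =>
    induction z using V.ind with
    | h n S hS =>
      simp only [V.mk_add_mk, V.mk_eq_iff]
      have := AlgEquivalent.reindex (idem_blocks (idem_blocks hP hQ) hS)
        (Equiv.sumAssoc (Fin l) (Fin m) (Fin n)).symm
      convert this using 1
      ext (i | i | i) (j | j | j) <;> rfl
  nsmul := nsmulRec

/-- `K₀(A)` of a unital algebra: the Grothendieck group of `V(A)`. -/
abbrev KZero (A : Type u) [Ring A] : Type u := Algebra.GrothendieckAddGroup (V A)

/-- The class `[P]₀ ∈ K₀(A)` of an idempotent matrix. -/
noncomputable def KZero.mk {A : Type u} [Ring A] {m : Type} [Fintype m] (P : Matrix m m A)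
    (h : P * P = P) : KZero A := Algebra.GrothendieckAddGroup.of (V.mk P h)

theorem KZero.mk_add_mk {A : Type u} [Ring A] {m n : Type} [Fintype m] [Fintype n]
    {P : Matrix m m A} {hP : P * P = P} {Q : Matrix n n A} {hQ : Q * Q = Q} :
    KZero.mk P hP + KZero.mk Q hQ = KZero.mk (fromBlocks P 0 0 Q) (idem_blocks hP hQ) := by
  rw [KZero.mk, KZero.mk, KZero.mk, ← V.mk_add_mk, map_add]

theorem KZero.mk_eq_of {A : Type u} [Ring A] {m n : Type} [Fintype m] [Fintype n]
    {P : Matrix m m A} {hP : P * P = P} {Q : Matrix n n A} {hQ : Q * Q = Q}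
    (h : AlgEquivalent P Q) : KZero.mk P hP = KZero.mk Q hQ :=
  congrArg _ (V.mk_eq_iff.2 h)

theorem idem_map {A : Type u} {B : Type v} [Ring A] [Ring B] (f : A →+* B) {m : Type} [Fintype m]
    {P : Matrix m m A} (h : P * P = P) : P.map f * P.map f = P.map f := by
  rw [← Matrix.map_mul, h]

/-- The map `V(A) → V(B)`, `[P]_V ↦ [f(P)]_V`, induced by a homomorphism. -/
noncomputable def V.mapFun {A : Type u} {B : Type v} [Ring A] [Ring B] (f : A →+* B) : V A → V B :=
  Quotient.map (fun P => ⟨P.n, P.mat.map f, idem_map f P.idem⟩)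
    (fun _ _ h => AlgEquivalent.map f h)

theorem V.mapFun_mk {A : Type u} {B : Type v} [Ring A] [Ring B] (f : A →+* B) {m : Type}
    [Fintype m] (P : Matrix m m A) (h : P * P = P) :
    V.mapFun f (V.mk P h) = V.mk (P.map f) (idem_map f h) :=
  rfl

/-- The additive map `V(A) → V(B)`, `[P]_V ↦ [f(P)]_V`, induced by a homomorphism. -/
noncomputable def V.map {A : Type u} {B : Type v} [Ring A] [Ring B] (f : A →+* B) :
    V A →+ V B where
  toFun := V.mapFun f
  map_zero' := by
    rw [← V.mk_zero (Fin 0), V.mapFun_mk, ← V.mk_zero (Fin 0), V.mk_eq_iff]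
    convert AlgEquivalent.zero (A := B) (Fin 0) (Fin 0) using 1
    ext i; exact i.elim0
  map_add' x y := by
    induction x using V.ind with
    | h m P hP =>
    induction y using V.ind with
    | h n Q hQ =>
      simp only [V.mk_add_mk, V.mapFun_mk, fromBlocks_map]
      congr 2 <;> (ext; simp)

theorem V.map_mk {A : Type u} {B : Type v} [Ring A] [Ring B] (f : A →+* B) {m : Type} [Fintype m]
    (P : Matrix m m A) (h : P * P = P) : V.map f (V.mk P h) = V.mk (P.map f) (idem_map f h) :=
  rfl

/-- `K₀(f) : K₀(A) → K₀(B)` for a unital homomorphism `f` of unital algebras. -/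
noncomputable def KZero.map {A : Type u} {B : Type v} [Ring A] [Ring B] (f : A →+* B) :
    KZero A →+ KZero B :=
  Algebra.GrothendieckAddGroup.lift (Algebra.GrothendieckAddGroup.of.comp (V.map f))

theorem KZero.map_mk {A : Type u} {B : Type v} [Ring A] [Ring B] (f : A →+* B) {m : Type}
    [Fintype m] (P : Matrix m m A) (h : P * P = P) :
    KZero.map f (KZero.mk P h) = KZero.mk (P.map f) (idem_map f h) :=
  DFunLike.congr_fun (Algebra.GrothendieckAddGroup.lift.symm_apply_apply
    (Algebra.GrothendieckAddGroup.of.comp (V.map f))) (V.mk P h)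

theorem KZero.mk_add_compl {A : Type u} [Ring A] {m : Type} [Fintype m] [DecidableEq m]
    {P : Matrix m m A} (h : P * P = P) :
    KZero.mk P h + KZero.mk (1 - P) (by simp [mul_sub, sub_mul, h]) =
      KZero.mk (1 : Matrix m m A) (by simp) := by
  rw [KZero.mk_add_mk]
  refine (KZero.mk_eq_of ?_).symm
  refine ⟨fromCols P (1 - P), fromRows P (1 - P), ?_, ?_⟩
  · rw [fromCols_mul_fromRows]; simp [mul_sub, sub_mul, h]
  · rw [fromRows_mul_fromCols]; simp [mul_sub, sub_mul, h]

/-- The scalar map `s : A^♯ → A^♯`, `s(a + ζ 1) = ζ 1`, on the unitization of `A`. -/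
noncomputable def scalarMap (A : Type u) [NonUnitalRing A] [Module ℂ A] [SMulCommClass ℂ A A]
    [IsScalarTower ℂ A A] : Unitization ℂ A →+* Unitization ℂ A :=
  (Unitization.inlRingHom ℂ A).comp (Unitization.fstHom ℂ A).toRingHom

/-- `K₀(A)` of a non-unital complex algebra `A`:
the subgroup `{[P]₀ - [s_n(P)]₀ | n ∈ ℕ, P ∈ IP_n(A^♯)}` of `K₀(A^♯)`. -/
noncomputable def KZeroNonunital (A : Type u) [NonUnitalRing A] [Module ℂ A] [SMulCommClass ℂ A A]
    [IsScalarTower ℂ A A] : AddSubgroup (KZero (Unitization ℂ A)) where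
  carrier := {x | ∃ (n : ℕ) (P : Matrix (Fin n) (Fin n) (Unitization ℂ A)) (hP : P * P = P),
    x = KZero.mk P hP - KZero.mk (P.map (scalarMap A)) (idem_map _ hP)}
  zero_mem' := ⟨0, 0, Matrix.mul_zero _, by
    rw [eq_comm, sub_eq_zero]
    congr 1⟩
  add_mem' := by
    rintro _ _ ⟨m, P, hP, rfl⟩ ⟨n, Q, hQ, rfl⟩
    refine ⟨m + n, (fromBlocks P 0 0 Q).submatrix finSumFinEquiv.symm finSumFinEquiv.symm,
      by rw [Matrix.submatrix_mul_equiv, idem_blocks hP hQ], ?_⟩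
    rw [sub_add_sub_comm, KZero.mk_add_mk, KZero.mk_add_mk]
    congr 1
    · exact KZero.mk_eq_of (AlgEquivalent.reindex (idem_blocks hP hQ) _)
    · refine KZero.mk_eq_of ?_
      convert AlgEquivalent.reindex (idem_blocks (idem_map (scalarMap A) hP)
        (idem_map (scalarMap A) hQ)) finSumFinEquiv.symm using 1
      rw [← Matrix.submatrix_map, fromBlocks_map]
      simp
  neg_mem' := by
    rintro _ ⟨n, P, hP, rfl⟩
    have e : (1 - P).map (scalarMap A) = 1 - P.map (scalarMap A) := by
      rw [Matrix.map_sub _ (map_sub _), Matrix.map_one _ (map_zero _) (map_one _)]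
    refine ⟨n, 1 - P, by simp [mul_sub, sub_mul, hP], ?_⟩
    have h1 := KZero.mk_add_compl hP
    have h2 := KZero.mk_add_compl (idem_map (scalarMap A) hP)
    simp only [e]
    rw [← eq_sub_iff_add_eq'] at h1 h2
    rw [h1, h2]; abel

/-- `K₀(φ) : K₀(A) → K₀(B)` for a homomorphism `φ` from a non-unital algebra `A` to a unital algebra
`B`: the restriction of `K₀(φ^♯) : K₀(A^♯) → K₀(B)`, where `φ^♯(a + ζ 1) = φ(a) + ζ 1`. -/
noncomputable def KZeroNonunital.map {A : Type u} [NonUnitalRing A] [Module ℂ A]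
    [SMulCommClass ℂ A A] [IsScalarTower ℂ A A] {B : Type v} [Ring B] [Algebra ℂ B]
    (φ : A →ₙₐ[ℂ] B) : KZeroNonunital A →+ KZero B :=
  (KZero.map (Unitization.lift φ).toRingHom).comp (KZeroNonunital A).subtype

end KZero

section KOne

set_option linter.unusedSectionVars false

/-- `GL_m(A) = Inv(M_m(A))` for a finite index type `m`. It carries the topology of the group of
units of the matrix ring `M_m(A)`, whose topology is entrywise; when `A` is a Banach algebra this
is the norm topology of `M_m(A)` restricted to the set of invertible matrices. -/
abbrev GLn (m : Type) [Fintype m] [DecidableEq m] (A : Type u) [Ring A] : Type u :=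
  (Matrix m m A)ˣ

/-- The block sum `U ⊕ V` of invertible matrices. -/
def GLn.block {m n : Type} [Fintype m] [DecidableEq m] [Fintype n] [DecidableEq n] {A : Type u}
    [Ring A] (U : GLn m A) (V : GLn n A) : GLn (m ⊕ n) A where
  val := fromBlocks U.val 0 0 V.val
  inv := fromBlocks U.inv 0 0 V.inv
  val_inv := by simp [fromBlocks_multiply]
  inv_val := by simp [fromBlocks_multiply]

/-- Renaming the indices of an invertible matrix along a bijection. -/
def GLn.reindex {m n : Type} [Fintype m] [DecidableEq m] [Fintype n] [DecidableEq n] {A : Type u}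
    [Ring A] (e : m ≃ n) : GLn m A →* GLn n A :=
  Units.map (reindexRingEquiv A e : Matrix m m A →* Matrix n n A)

/-- The map `GL_m(A) → GL_m(B)` induced by a homomorphism. -/
def GLn.map {m : Type} [Fintype m] [DecidableEq m] {A : Type u} {B : Type v} [Ring A] [Ring B]
    (f : A →+* B) : GLn m A →* GLn m B :=
  Units.map (f.mapMatrix : Matrix m m A →+* Matrix m m B).toMonoidHom

theorem GLn.reindex_val {m n : Type} [Fintype m] [DecidableEq m] [Fintype n] [DecidableEq n]
    {A : Type u} [Ring A] (e : m ≃ n) (U : GLn m A) :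
    (GLn.reindex e U).val = U.val.submatrix e.symm e.symm := rfl

theorem GLn.block_val {m n : Type} [Fintype m] [DecidableEq m] [Fintype n] [DecidableEq n]
    {A : Type u} [Ring A] (U : GLn m A) (V : GLn n A) :
    (GLn.block U V).val = fromBlocks U.val 0 0 V.val := rfl

theorem GLn.map_val {m : Type} [Fintype m] [DecidableEq m] {A : Type u} {B : Type v} [Ring A]
    [Ring B] (f : A →+* B) (U : GLn m A) : (GLn.map f U).val = U.val.map f := rfl

theorem GLn.reindex_reindex {l m n : Type} [Fintype l] [DecidableEq l] [Fintype m] [DecidableEq m]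
    [Fintype n] [DecidableEq n] {A : Type u} [Ring A] (e : l ≃ m) (e' : m ≃ n) (U : GLn l A) :
    GLn.reindex e' (GLn.reindex e U) = GLn.reindex (e.trans e') U := rfl

theorem GLn.block_mul {m n : Type} [Fintype m] [DecidableEq m] [Fintype n] [DecidableEq n]
    {A : Type u} [Ring A] (U U' : GLn m A) (V V' : GLn n A) :
    GLn.block (U * U') (V * V') = GLn.block U V * GLn.block U' V' := by
  ext1; simp [GLn.block_val, fromBlocks_multiply]

theorem GLn.block_one {m n : Type} [Fintype m] [DecidableEq m] [Fintype n] [DecidableEq n]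
    {A : Type u} [Ring A] : GLn.block (1 : GLn m A) (1 : GLn n A) = 1 := by
  ext1; simp [GLn.block_val]

theorem GLn.continuous_reindex {m n : Type} [Fintype m] [DecidableEq m] [Fintype n] [DecidableEq n]
    {A : Type u} [Ring A] [TopologicalSpace A] (e : m ≃ n) :
    Continuous (GLn.reindex e : GLn m A → GLn n A) :=
  Continuous.units_map _ (continuous_id.matrix_submatrix e.symm e.symm)

theorem GLn.continuous_map {m : Type} [Fintype m] [DecidableEq m] {A : Type u} {B : Type v}
    [Ring A] [Ring B] [TopologicalSpace A] [TopologicalSpace B] {f : A →+* B} (hf : Continuous f) :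
    Continuous (GLn.map f : GLn m A → GLn m B) :=
  Continuous.units_map (f.mapMatrix : Matrix m m A →+* Matrix m m B).toMonoidHom
    (continuous_id.matrix_map hf)

theorem GLn.continuous_block {m n : Type} [Fintype m] [DecidableEq m] [Fintype n] [DecidableEq n]
    {A : Type u} [Ring A] [TopologicalSpace A] :
    Continuous (fun p : GLn m A × GLn n A => GLn.block p.1 p.2) := by
  have h1 : Continuous fun p : GLn m A × GLn n A => p.1.val :=
    Units.continuous_val.comp continuous_fst
  have h2 : Continuous fun p : GLn m A × GLn n A => p.2.val :=
    Units.continuous_val.comp continuous_snd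
  have h3 : Continuous fun p : GLn m A × GLn n A => (p.1⁻¹).val :=
    Units.continuous_coe_inv.comp continuous_fst
  have h4 : Continuous fun p : GLn m A × GLn n A => (p.2⁻¹).val :=
    Units.continuous_coe_inv.comp continuous_snd
  rw [Units.continuous_iff]
  exact ⟨h1.matrix_fromBlocks continuous_const continuous_const h2,
    h3.matrix_fromBlocks continuous_const continuous_const h4⟩

theorem GLn.joined_block {m n : Type} [Fintype m] [DecidableEq m] [Fintype n] [DecidableEq n]
    {A : Type u} [Ring A] [TopologicalSpace A] {U U' : GLn m A} {V V' : GLn n A}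
    (h : Joined U U') (h' : Joined V V') : Joined (GLn.block U V) (GLn.block U' V') :=
  (h.prod h').map GLn.continuous_block

/-- `U ⊕ I^{(k - n)} ∈ GL_k(A)` for `U ∈ GL_n(A)` and `n ≤ k`. -/
def GLn.pad {n k : ℕ} (h : n ≤ k) {A : Type u} [Ring A] (U : GLn (Fin n) A) : GLn (Fin k) A :=
  GLn.reindex (finSumFinEquiv.trans (finCongr (Nat.add_sub_of_le h)))
    (GLn.block U (1 : GLn (Fin (k - n)) A))

/-- The relation `U ∼₁ V`: for some `k > max(m, n)` there is a continuous path in `GL_k(A)` from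
`U ⊕ I^{(k - m)}` to `V ⊕ I^{(k - n)}`. -/
def PathEquivalent {A : Type u} [Ring A] [TopologicalSpace A] {m n : ℕ} (U : GLn (Fin m) A)
    (V : GLn (Fin n) A) : Prop :=
  ∃ (k : ℕ) (hm : m < k) (hn : n < k), Joined (GLn.pad hm.le U) (GLn.pad hn.le V)

/-- The group `GL_m(ℂ)` is path connected. -/
theorem GLn.joined_complex {m : Type} [Fintype m] [DecidableEq m] (U : GLn m ℂ) :
    Joined 1 U := by
  classical
  let p : Polynomial ℂ := ((1 : Matrix m m (Polynomial ℂ)) +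
    (Polynomial.X : Polynomial ℂ) • (U.val - 1 : Matrix m m ℂ).map Polynomial.C).det
  have ev : ∀ z : ℂ, p.eval z = (1 + z • (U.val - 1)).det := by
    intro z
    simp only [p]
    rw [← Polynomial.coe_evalRingHom, RingHom.map_det]
    congr 1
    ext i j
    by_cases hij : i = j
    · simp [hij]
    · simp [hij, mul_comm z]
  have hp : p ≠ 0 := by
    intro h
    have := ev 0
    simp [h] at this
  have hU : IsUnit U.val.det := (Matrix.isUnit_iff_isUnit_det _).1 U.isUnit
  have hc := (p.roots.toFinset.countable_toSet).isPathConnected_compl_of_one_lt_rank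
    (E := ℂ) (by rw [Complex.rank_real_complex]; norm_num)
  have mem : ∀ z : ℂ, z ∈ ((p.roots.toFinset : Set ℂ))ᶜ → IsUnit (1 + z • (U.val - 1)).det := by
    intro z hz
    rw [isUnit_iff_ne_zero, ← ev]
    intro h
    exact hz (by simpa [hp] using h)
  have mem' : ∀ z : ℂ, (1 + z • (U.val - 1)).det ≠ 0 → z ∈ ((p.roots.toFinset : Set ℂ))ᶜ := by
    intro z hz h
    rw [← ev] at hz
    have : p ≠ 0 ∧ p.IsRoot z := by simpa using h
    exact hz this.2
  obtain ⟨γ, hγ⟩ := hc.joinedIn 0 (mem' 0 (by simp)) 1 (mem' 1 (by simpa using hU.ne_zero))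
  have hu : ∀ t, IsUnit (1 + γ t • (U.val - 1)).det := fun t => mem _ (hγ t)
  refine ⟨⟨⟨fun t => Matrix.GeneralLinearGroup.mk'' _ (hu t), ?_⟩, ?_, ?_⟩⟩
  · rw [Units.continuous_iff]
    have c1 : Continuous fun t => (1 + γ t • (U.val - 1) : Matrix m m ℂ) := by
      have := γ.continuous
      fun_prop
    refine ⟨c1, ?_⟩
    have : ∀ t, ((Matrix.GeneralLinearGroup.mk'' _ (hu t))⁻¹ : GLn m ℂ).val =
        ((1 + γ t • (U.val - 1)).det)⁻¹ • (1 + γ t • (U.val - 1)).adjugate := by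
      intro t
      rw [Matrix.coe_units_inv, Matrix.inv_def, Ring.inverse_eq_inv']
      rfl
    simp only [this]
    exact (c1.matrix_det.inv₀ fun t => (hu t).ne_zero).smul c1.matrix_adjugate
  · ext1
    change 1 + γ 0 • (U.val - 1) = 1
    rw [γ.source]; simp
  · ext1
    change 1 + γ 1 • (U.val - 1) = U.val
    rw [γ.target]; simp

variable {A : Type u} [Ring A] [Algebra ℂ A] [TopologicalSpace A] [IsTopologicalRing A]
  [ContinuousSMul ℂ A]

theorem GLn.joined_reindex {m n : Type} [Fintype m] [DecidableEq m] [Fintype n] [DecidableEq n]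
    (e e' : m ≃ n) (U : GLn m A) : Joined (GLn.reindex e U) (GLn.reindex e' U) := by
  let σ : n ≃ n := e.symm.trans e'
  let p : GLn n ℂ := ⟨(1 : Matrix n n ℂ).submatrix σ.symm id, (1 : Matrix n n ℂ).submatrix id σ.symm,
    by rw [← Matrix.submatrix_mul _ _ _ id _ Function.bijective_id]; simp,
    by rw [Matrix.submatrix_mul_equiv]; simp⟩
  let P : GLn n A := GLn.map (algebraMap ℂ A) p
  have hP : Joined 1 P := by
    have := (GLn.joined_complex p).map (GLn.continuous_map (continuous_algebraMap ℂ A))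
    simpa using this
  have key : GLn.reindex e' U = P * GLn.reindex e U * P⁻¹ := by
    rw [eq_mul_inv_iff_mul_eq]
    ext i j
    have h1 : P.val = (1 : Matrix n n A).submatrix σ.symm id := by
      ext i j
      simp only [P, GLn.map_val, p, Matrix.map_apply, Matrix.submatrix_apply, Matrix.one_apply]
      split_ifs <;> simp
    simp [h1, GLn.reindex_val, Matrix.mul_apply, Matrix.one_apply, σ]
    rw [Finset.sum_eq_single (e'  (e.symm j))]
    · simp
    · intro b _ hb
      rw [if_neg]
      rintro rfl
      simp at hb
    · simp
  rw [key]
  have := (hP.mul (Joined.refl (GLn.reindex e U))).mul hP.inv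
  simpa using this


/-- `W` is, up to a path of invertible matrices and a renaming of indices, of the form `U ⊕ I`. -/
def IsExtension {m n : Type} [Fintype m] [DecidableEq m] [Fintype n] [DecidableEq n]
    (U : GLn m A) (W : GLn n A) : Prop :=
  ∃ (a : ℕ) (e : m ⊕ Fin a ≃ n), Joined W (GLn.reindex e (GLn.block U 1))

theorem IsExtension.of_type {m n α : Type} [Fintype m] [DecidableEq m] [Fintype n] [DecidableEq n]
    [Fintype α] [DecidableEq α] {U : GLn m A} {W : GLn n A} (e : m ⊕ α ≃ n)
    (h : Joined W (GLn.reindex e (GLn.block U 1))) : IsExtension U W := by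
  refine ⟨Fintype.card α, ((Equiv.refl m).sumCongr (Fintype.equivFin α).symm).trans e, ?_⟩
  convert h using 1
  rw [← GLn.reindex_reindex]
  congr 1
  ext1
  ext (i | i) (j | j) <;> simp [GLn.reindex_val, GLn.block_val, Matrix.one_apply]

theorem IsExtension.of_joined {m : Type} [Fintype m] [DecidableEq m] {U W : GLn m A}
    (h : Joined W U) : IsExtension U W := by
  refine .of_type (α := Fin 0) (Equiv.sumEmpty m (Fin 0)) ?_
  convert h using 1
  ext1
  ext i j
  simp [GLn.reindex_val, GLn.block_val]

theorem IsExtension.joined_trans {m n : Type} [Fintype m] [DecidableEq m] [Fintype n]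
    [DecidableEq n] {U : GLn m A} {W W' : GLn n A} (h : IsExtension U W) (h' : Joined W' W) :
    IsExtension U W' := by
  obtain ⟨a, e, he⟩ := h
  exact ⟨a, e, h'.trans he⟩

theorem IsExtension.reindex {m n : Type} [Fintype m] [DecidableEq m] [Fintype n] [DecidableEq n]
    (e : m ≃ n) (U : GLn m A) : IsExtension U (GLn.reindex e U) := by
  refine .of_type (α := Fin 0) ((Equiv.sumEmpty m (Fin 0)).trans e) ?_
  convert Joined.refl _ using 1
  ext1
  ext i j
  simp [GLn.reindex_val, GLn.block_val]

theorem IsExtension.block_one {m n : Type} [Fintype m] [DecidableEq m] [Fintype n] [DecidableEq n]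
    (U : GLn m A) : IsExtension U (GLn.block U (1 : GLn n A)) :=
  .of_type (Equiv.refl _) (Joined.refl _)

theorem IsExtension.trans {l m n : Type} [Fintype l] [DecidableEq l] [Fintype m] [DecidableEq m]
    [Fintype n] [DecidableEq n] {U : GLn l A} {V : GLn m A} {W : GLn n A}
    (h : IsExtension U V) (h' : IsExtension V W) : IsExtension U W := by
  obtain ⟨a, e, he⟩ := h
  obtain ⟨b, e', he'⟩ := h'
  refine .of_type (α := Fin a ⊕ Fin b)
    (((Equiv.sumAssoc l (Fin a) (Fin b)).symm.trans (e.sumCongr (Equiv.refl _))).trans e')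
    (he'.trans ?_)
  rw [← GLn.reindex_reindex]
  refine Joined.map ?_ (GLn.continuous_reindex e')
  convert GLn.joined_block he (Joined.refl (1 : GLn (Fin b) A)) using 1
  ext1
  ext (i | i) (j | j)
  · simp only [GLn.reindex_val, GLn.block_val, submatrix_apply, fromBlocks_apply₁₁]
    simp
    rcases e.symm i with i | i <;> rcases e.symm j with j | j <;> simp [Matrix.one_apply]
  · simp only [GLn.reindex_val, GLn.block_val, submatrix_apply, fromBlocks_apply₁₂]
    simp
    rcases e.symm i with i | i <;> simp
  · simp only [GLn.reindex_val, GLn.block_val, submatrix_apply, fromBlocks_apply₂₁]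
    simp
    rcases e.symm j with j | j <;> simp
  · simp [GLn.reindex_val, GLn.block_val, Matrix.one_apply]

theorem IsExtension.joined {m n : Type} [Fintype m] [DecidableEq m] [Fintype n] [DecidableEq n]
    {U : GLn m A} {W W' : GLn n A} (h : IsExtension U W) (h' : IsExtension U W') :
    Joined W W' := by
  obtain ⟨a, e, he⟩ := h
  obtain ⟨b, e', he'⟩ := h'
  have c1 := Fintype.card_congr e
  have c2 := Fintype.card_congr e'
  simp only [Fintype.card_sum, Fintype.card_fin] at c1 c2
  obtain rfl : a = b := by omega
  exact he.trans ((GLn.joined_reindex e e' _).trans he'.symm)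

theorem IsExtension.pad {n k : ℕ} (h : n ≤ k) (U : GLn (Fin n) A) : IsExtension U (GLn.pad h U) :=
  ⟨_, _, Joined.refl _⟩

theorem IsExtension.exists {m : Type} [Fintype m] [DecidableEq m] (U : GLn m A) {k : ℕ}
    (h : Fintype.card m ≤ k) : ∃ W : GLn (Fin k) A, IsExtension U W :=
  ⟨GLn.pad h (GLn.reindex (Fintype.equivFin m) U), (IsExtension.reindex _ U).trans (.pad h _)⟩

theorem IsExtension.block {m n m' n' : Type} [Fintype m] [DecidableEq m] [Fintype n]
    [DecidableEq n] [Fintype m'] [DecidableEq m'] [Fintype n'] [DecidableEq n']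
    {U : GLn m A} {W : GLn n A} {U' : GLn m' A} {W' : GLn n' A}
    (h : IsExtension U W) (h' : IsExtension U' W') :
    IsExtension (GLn.block U U') (GLn.block W W') := by
  obtain ⟨a, e, he⟩ := h
  obtain ⟨b, e', he'⟩ := h'
  refine .of_type (α := Fin a ⊕ Fin b)
    ((Equiv.sumSumSumComm m m' (Fin a) (Fin b)).trans (e.sumCongr e')) ?_
  convert GLn.joined_block he he' using 1
  ext1
  ext (i | i) (j | j)
  · simp only [GLn.reindex_val, GLn.block_val, submatrix_apply, fromBlocks_apply₁₁]
    simp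
    rcases e.symm i with i | i <;> rcases e.symm j with j | j <;> simp [Matrix.one_apply]
  · simp only [GLn.reindex_val, GLn.block_val, submatrix_apply, fromBlocks_apply₁₂]
    simp
    rcases e.symm i with i | i <;> rcases e'.symm j with j | j <;> simp
  · simp only [GLn.reindex_val, GLn.block_val, submatrix_apply, fromBlocks_apply₂₁]
    simp
    rcases e'.symm i with i | i <;> rcases e.symm j with j | j <;> simp
  · simp only [GLn.reindex_val, GLn.block_val, submatrix_apply, fromBlocks_apply₂₂]
    simp
    rcases e'.symm i with i | i <;> rcases e'.symm j with j | j <;> simp [Matrix.one_apply]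

/-- `U` and `V` have a common extension. -/
def StablyJoined {m n : Type} [Fintype m] [DecidableEq m] [Fintype n] [DecidableEq n]
    (U : GLn m A) (V : GLn n A) : Prop :=
  ∃ (k : ℕ) (W : GLn (Fin k) A), IsExtension U W ∧ IsExtension V W

theorem StablyJoined.symm {m n : Type} [Fintype m] [DecidableEq m] [Fintype n] [DecidableEq n]
    {U : GLn m A} {V : GLn n A} (h : StablyJoined U V) : StablyJoined V U := by
  obtain ⟨k, W, h1, h2⟩ := h
  exact ⟨k, W, h2, h1⟩

theorem StablyJoined.of_isExtension {m n : Type} [Fintype m] [DecidableEq m] [Fintype n]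
    [DecidableEq n] {U : GLn m A} {V : GLn n A} (h : IsExtension U V) : StablyJoined U V :=
  ⟨_, _, h.trans (.reindex (Fintype.equivFin n) V), .reindex _ _⟩

theorem StablyJoined.of_common {l m n : Type} [Fintype l] [DecidableEq l] [Fintype m]
    [DecidableEq m] [Fintype n] [DecidableEq n] {U : GLn l A} {V : GLn m A} {W : GLn n A}
    (h : IsExtension U W) (h' : IsExtension V W) : StablyJoined U V :=
  ⟨_, _, h.trans (.reindex (Fintype.equivFin n) W), h'.trans (.reindex (Fintype.equivFin n) W)⟩

theorem StablyJoined.trans {l m n : Type} [Fintype l] [DecidableEq l] [Fintype m] [DecidableEq m]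
    [Fintype n] [DecidableEq n] {U : GLn l A} {V : GLn m A} {W : GLn n A}
    (h : StablyJoined U V) (h' : StablyJoined V W) : StablyJoined U W := by
  obtain ⟨k, X, h1, h2⟩ := h
  obtain ⟨k', X', h3, h4⟩ := h'
  obtain ⟨Y, hY⟩ := IsExtension.exists X (k := max k k') (by simp)
  obtain ⟨Y', hY'⟩ := IsExtension.exists X' (k := max k k') (by simp)
  exact ⟨_, Y, h1.trans hY,
    (h4.trans hY').joined_trans ((h2.trans hY).joined (h3.trans hY'))⟩

theorem pathEquivalent_iff {m n : ℕ} {U : GLn (Fin m) A} {V : GLn (Fin n) A} :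
    PathEquivalent U V ↔ StablyJoined U V := by
  constructor
  · rintro ⟨k, hm, hn, h⟩
    exact ⟨k, _, .pad hm.le U, (IsExtension.pad hn.le V).joined_trans h⟩
  · rintro ⟨k, W, h1, h2⟩
    obtain ⟨Y, hY⟩ := IsExtension.exists W (k := max k (max m n + 1)) (by simp)
    refine ⟨max k (max m n + 1), by omega, by omega, ?_⟩
    exact ((IsExtension.pad _ U).joined (h1.trans hY)).trans
      ((h2.trans hY).joined (IsExtension.pad _ V))

variable (A) in
/-- The equivalence relation `∼₁` on `Inv_∞(A) = ⋃ₙ GL_n(A)`. (The empty matrix, `n = 0`, is allowed;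
it is equivalent to the identity matrices of every other size.) -/
def KOne.setoid : Setoid (Σ n : ℕ, GLn (Fin n) A) where
  r U V := PathEquivalent U.2 V.2
  iseqv := ⟨fun _ => pathEquivalent_iff.2 (.of_isExtension (.of_joined (Joined.refl _))),
    fun h => pathEquivalent_iff.2 (pathEquivalent_iff.1 h).symm,
    fun h h' => pathEquivalent_iff.2 ((pathEquivalent_iff.1 h).trans (pathEquivalent_iff.1 h'))⟩

variable (A) in
/-- `K₁(A) = Inv_∞(A) / ∼₁` for a unital Banach algebra `A` (only the topological algebra structure
of `A` is used). -/
def KOne : Type u := Quotient (KOne.setoid A)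

/-- The class `[U]₁ ∈ K₁(A)` of an invertible matrix (indexed by any finite type, which is
enumerated in order to view `U` in `Inv_∞(A)`). -/
noncomputable def KOne.mk {m : Type} [Fintype m] [DecidableEq m] (U : GLn m A) : KOne A :=
  Quotient.mk (KOne.setoid A) ⟨Fintype.card m, GLn.reindex (Fintype.equivFin m) U⟩

theorem KOne.mk_eq_iff {m n : Type} [Fintype m] [DecidableEq m] [Fintype n] [DecidableEq n]
    {U : GLn m A} {V : GLn n A} : KOne.mk U = KOne.mk V ↔ StablyJoined U V := by
  have h1 := StablyJoined.of_isExtension (IsExtension.reindex (Fintype.equivFin m) U)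
  have h2 := StablyJoined.of_isExtension (IsExtension.reindex (Fintype.equivFin n) V)
  refine Quotient.eq.trans (pathEquivalent_iff.trans ⟨fun h => ?_, fun h => ?_⟩)
  · exact (h1.trans h).trans h2.symm
  · exact (h1.symm.trans h).trans h2

theorem KOne.mk_eq {n : ℕ} (U : GLn (Fin n) A) :
    (Quotient.mk (KOne.setoid A) ⟨n, U⟩ : KOne A) = KOne.mk U :=
  Quotient.sound (s := KOne.setoid A)
    (pathEquivalent_iff.2 (.of_isExtension (IsExtension.reindex _ U)))

theorem KOne.ind {p : KOne A → Prop} (h : ∀ (n : ℕ) (U : GLn (Fin n) A), p (KOne.mk U))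
    (x : KOne A) : p x := by
  induction x using Quotient.inductionOn with
  | h U => obtain ⟨n, U⟩ := U; rw [KOne.mk_eq]; exact h _ _

theorem StablyJoined.block {m n m' n' : Type} [Fintype m] [DecidableEq m] [Fintype n]
    [DecidableEq n] [Fintype m'] [DecidableEq m'] [Fintype n'] [DecidableEq n']
    {U : GLn m A} {V : GLn n A} {U' : GLn m' A} {V' : GLn n' A}
    (h : StablyJoined U V) (h' : StablyJoined U' V') :
    StablyJoined (GLn.block U U') (GLn.block V V') := by
  obtain ⟨k, W, h1, h2⟩ := h
  obtain ⟨k', W', h3, h4⟩ := h'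
  exact .of_common (h1.block h3) (h2.block h4)

/-- Addition on `K₁(A)`: `[U]₁ + [V]₁ = [U ⊕ V]₁`. -/
noncomputable instance KOne.instAdd : Add (KOne A) where
  add := Quotient.map₂ (fun U V => ⟨_, GLn.reindex (Fintype.equivFin _) (GLn.block U.2 V.2)⟩)
    (fun _ _ h _ _ h' => Quotient.exact (s := KOne.setoid A)
      (KOne.mk_eq_iff.2 ((pathEquivalent_iff.1 h).block (pathEquivalent_iff.1 h'))))

theorem KOne.mk_add_mk {m n : Type} [Fintype m] [DecidableEq m] [Fintype n] [DecidableEq n]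
    (U : GLn m A) (V : GLn n A) : KOne.mk U + KOne.mk V = KOne.mk (GLn.block U V) :=
  KOne.mk_eq_iff.2 (.symm (.of_isExtension (.block (.reindex _ U) (.reindex _ V))))

noncomputable instance KOne.instZero : Zero (KOne A) where
  zero := KOne.mk (1 : GLn (Fin 0) A)

theorem KOne.mk_one (m : Type) [Fintype m] [DecidableEq m] : KOne.mk (1 : GLn m A) = 0 := by
  refine KOne.mk_eq_iff.2 (.symm (.of_isExtension (.of_type (Equiv.emptySum (Fin 0) m) ?_)))
  rw [GLn.block_one, map_one]

theorem StablyJoined.of_reindex {m n : Type} [Fintype m] [DecidableEq m] [Fintype n]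
    [DecidableEq n] {U : GLn m A} {V : GLn n A} (e : m ≃ n)
    (h : U.val = V.val.submatrix e e) : StablyJoined U V := by
  have : V = GLn.reindex e U := by
    ext1; rw [GLn.reindex_val, h]; simp
  rw [this]
  exact .of_isExtension (.reindex e U)

theorem StablyJoined.inv {m n : Type} [Fintype m] [DecidableEq m] [Fintype n]
    [DecidableEq n] {U : GLn m A} {V : GLn n A} (h : StablyJoined U V) :
    StablyJoined U⁻¹ V⁻¹ := by
  have key : ∀ {m n : Type} [Fintype m] [DecidableEq m] [Fintype n] [DecidableEq n]
      {U : GLn m A} {V : GLn n A}, IsExtension U V → IsExtension U⁻¹ V⁻¹ := by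
    rintro m n _ _ _ _ U V ⟨a, e, h⟩
    refine ⟨a, e, ?_⟩
    convert h.inv using 1
    rw [← map_inv]
    congr 1
  obtain ⟨k, W, h1, h2⟩ := h
  exact .of_common (key h1) (key h2)

theorem StablyJoined.block_inv {m : Type} [Fintype m] [DecidableEq m] (U : GLn m A) :
    StablyJoined (GLn.block U⁻¹ U) (1 : GLn (Fin 0) A) := by
  have h1 : GLn.reindex (Equiv.sumComm m m) (GLn.block U 1) = GLn.block 1 U := by
    ext1; ext (i | i) (j | j) <;> simp [GLn.reindex_val, GLn.block_val]
  have h2 : GLn.reindex (Equiv.refl (m ⊕ m)) (GLn.block U 1) = GLn.block U 1 := by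
    ext1; ext (i | i) (j | j) <;> simp [GLn.reindex_val, GLn.block_val]
  have h3 := GLn.joined_reindex (Equiv.sumComm m m) (Equiv.refl (m ⊕ m)) (GLn.block U 1)
  rw [h1, h2] at h3
  have h4 := (Joined.refl (GLn.block U⁻¹ (1 : GLn m A))).mul h3
  rw [← GLn.block_mul, ← GLn.block_mul] at h4
  simp only [one_mul, mul_one, inv_mul_cancel, GLn.block_one] at h4
  refine .trans (.of_isExtension (.of_joined h4.symm)) (KOne.mk_eq_iff.1 (KOne.mk_one _))

/-- Negation on `K₁(A)`: `-[U]₁ = [U⁻¹]₁`. -/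
noncomputable instance KOne.instNeg : Neg (KOne A) where
  neg := Quotient.map (fun U => ⟨U.1, U.2⁻¹⟩)
    (fun _ _ h => pathEquivalent_iff.2 (pathEquivalent_iff.1 h).inv)

theorem KOne.neg_mk {m : Type} [Fintype m] [DecidableEq m] (U : GLn m A) :
    -KOne.mk U = KOne.mk U⁻¹ := rfl

/-- `K₁(A)` is a commutative group under `⊕`, with `-[U]₁ = [U⁻¹]₁`. -/
noncomputable instance KOne.instAddCommGroup : AddCommGroup (KOne A) where
  zero_add x := by
    induction x using KOne.ind with
    | h n U =>
      refine (KOne.mk_add_mk _ _).trans (KOne.mk_eq_iff.2 ?_)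
      exact .of_reindex (Equiv.emptySum (Fin 0) (Fin n)) (by
        ext (i | i) (j | j)
        · exact i.elim0
        · exact i.elim0
        · exact j.elim0
        · rfl)
  add_zero x := by
    induction x using KOne.ind with
    | h n U =>
      refine (KOne.mk_add_mk _ _).trans (KOne.mk_eq_iff.2 ?_)
      exact .of_reindex (Equiv.sumEmpty (Fin n) (Fin 0)) (by
        ext (i | i) (j | j)
        · rfl
        · exact j.elim0
        · exact i.elim0
        · exact i.elim0)
  add_comm x y := by
    induction x using KOne.ind with
    | h m U =>
    induction y using KOne.ind with
    | h n V =>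
      rw [KOne.mk_add_mk, KOne.mk_add_mk, KOne.mk_eq_iff]
      exact .of_reindex (Equiv.sumComm (Fin m) (Fin n)) (by ext (i | i) (j | j) <;> rfl)
  add_assoc x y z := by
    induction x using KOne.ind with
    | h l U =>
    induction y using KOne.ind with
    | h m V =>
    induction z using KOne.ind with
    | h n W =>
      rw [KOne.mk_add_mk, KOne.mk_add_mk, KOne.mk_add_mk, KOne.mk_add_mk, KOne.mk_eq_iff]
      exact .of_reindex (Equiv.sumAssoc (Fin l) (Fin m) (Fin n))
        (by ext ((i | i) | i) ((j | j) | j) <;> rfl)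
  neg_add_cancel x := by
    induction x using KOne.ind with
    | h n U =>
      rw [KOne.neg_mk, KOne.mk_add_mk]
      exact KOne.mk_eq_iff.2 (.block_inv U)
  nsmul := nsmulRec
  zsmul := zsmulRec

theorem IsExtension.map {B : Type v} [Ring B] [Algebra ℂ B] [TopologicalSpace B]
    [IsTopologicalRing B] [ContinuousSMul ℂ B] {f : A →+* B} (hf : Continuous f)
    {m n : Type} [Fintype m] [DecidableEq m] [Fintype n] [DecidableEq n] {U : GLn m A}
    {W : GLn n A} (h : IsExtension U W) : IsExtension (GLn.map f U) (GLn.map f W) := by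
  obtain ⟨a, e, h⟩ := h
  refine ⟨a, e, ?_⟩
  convert h.map (GLn.continuous_map hf) using 1
  ext1
  rw [GLn.reindex_val, GLn.map_val, GLn.reindex_val, GLn.block_val, GLn.block_val,
    ← Matrix.submatrix_map, fromBlocks_map]
  congr 2
  · ext; simp
  · ext; simp
  · simp

theorem StablyJoined.map {B : Type v} [Ring B] [Algebra ℂ B] [TopologicalSpace B]
    [IsTopologicalRing B] [ContinuousSMul ℂ B] {f : A →+* B} (hf : Continuous f)
    {m n : Type} [Fintype m] [DecidableEq m] [Fintype n] [DecidableEq n] {U : GLn m A}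
    {W : GLn n A} (h : StablyJoined U W) : StablyJoined (GLn.map f U) (GLn.map f W) := by
  obtain ⟨k, X, h1, h2⟩ := h
  exact ⟨k, _, h1.map hf, h2.map hf⟩

/-- The map `K₁(A) → K₁(B)`, `[U]₁ ↦ [f(U)]₁`. -/
noncomputable def KOne.mapFun {B : Type v} [Ring B] [Algebra ℂ B] [TopologicalSpace B]
    [IsTopologicalRing B] [ContinuousSMul ℂ B] (f : A →+* B) (hf : Continuous f) :
    KOne A → KOne B :=
  Quotient.map (fun U => ⟨U.1, GLn.map f U.2⟩)
    (fun _ _ h => pathEquivalent_iff.2 ((pathEquivalent_iff.1 h).map hf))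

theorem KOne.mapFun_mk {B : Type v} [Ring B] [Algebra ℂ B] [TopologicalSpace B]
    [IsTopologicalRing B] [ContinuousSMul ℂ B] (f : A →+* B) (hf : Continuous f) {m : Type}
    [Fintype m] [DecidableEq m] (U : GLn m A) :
    KOne.mapFun f hf (KOne.mk U) = KOne.mk (GLn.map f U) := rfl

/-- `K₁(f) : K₁(A) → K₁(B)`, `[U]₁ ↦ [f(U)]₁`, for a continuous unital homomorphism `f`. -/
noncomputable def KOne.map {B : Type v} [Ring B] [Algebra ℂ B] [TopologicalSpace B]
    [IsTopologicalRing B] [ContinuousSMul ℂ B] (f : A →+* B) (hf : Continuous f) :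
    KOne A →+ KOne B :=
  AddMonoidHom.mk' (KOne.mapFun f hf) (fun x y => by
    induction x using KOne.ind with
    | h m U =>
    induction y using KOne.ind with
    | h n V =>
      rw [KOne.mapFun_mk, KOne.mapFun_mk, KOne.mk_add_mk, KOne.mk_add_mk, KOne.mapFun_mk]
      congr 1
      ext1
      rw [GLn.map_val, GLn.block_val, GLn.block_val, fromBlocks_map]
      congr 1 <;> ext <;> simp)

theorem KOne.map_mk {B : Type v} [Ring B] [Algebra ℂ B] [TopologicalSpace B]
    [IsTopologicalRing B] [ContinuousSMul ℂ B] (f : A →+* B) (hf : Continuous f) {m : Type}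
    [Fintype m] [DecidableEq m] (U : GLn m A) :
    KOne.map f hf (KOne.mk U) = KOne.mk (GLn.map f U) := rfl

end KOne

section Index

/-- A quotient of a topological ring by a two-sided ideal, with the quotient topology, is a
topological ring. -/
instance quotient_isTopologicalRing {A : Type u} [Ring A] [TopologicalSpace A]
    [IsTopologicalRing A] (I : Ideal A) [I.IsTwoSided] : IsTopologicalRing (A ⧸ I) where
  __ := (inferInstance : IsTopologicalAddGroup (A ⧸ I))
  continuous_mul := by
    have h : IsOpenQuotientMap (Ideal.Quotient.mk I) := Submodule.isOpenQuotientMap_mkQ I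
    have h2 := (h.prodMap h).isQuotientMap
    rw [h2.continuous_iff]
    exact h.continuous.comp continuous_mul

instance quotient_continuousSMul {A : Type u} [Ring A] [Algebra ℂ A] [TopologicalSpace A]
    [IsTopologicalRing A] [ContinuousSMul ℂ A] (I : Ideal A) [I.IsTwoSided] :
    ContinuousSMul ℂ (A ⧸ I) := by
  refine continuousSMul_of_algebraMap ℂ (A ⧸ I) ?_
  have h : Continuous (Ideal.Quotient.mk I) := (Submodule.isOpenQuotientMap_mkQ I).continuous
  exact h.comp (continuous_algebraMap ℂ A)

theorem continuous_quotientMk {A : Type u} [Ring A] [TopologicalSpace A] [IsTopologicalRing A]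
    (I : Ideal A) [I.IsTwoSided] : Continuous (Ideal.Quotient.mk I) :=
  (Submodule.isOpenQuotientMap_mkQ I).continuous

/-- A two-sided ideal of a complex unital algebra, regarded as a non-unital algebra. -/
def idealAlg {A : Type u} [Ring A] [Algebra ℂ A] (I : Ideal A) [I.IsTwoSided] :
    NonUnitalSubalgebra ℂ A where
  carrier := I
  add_mem' := I.add_mem
  zero_mem' := I.zero_mem
  mul_mem' _ hb := I.mul_mem_left _ hb
  smul_mem' c x hx := by
    rw [← algebraMap_smul A c x]
    exact I.smul_mem _ hx

/-- The inclusion `ι : I → A` of a two-sided ideal. -/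
def idealIncl {A : Type u} [Ring A] [Algebra ℂ A] (I : Ideal A) [I.IsTwoSided] :
    idealAlg I →ₙₐ[ℂ] A := NonUnitalSubalgebraClass.subtype (idealAlg I)

/-- The unitization `I^♯`. -/
abbrev Sharp {A : Type u} [Ring A] [Algebra ℂ A] (I : Ideal A) [I.IsTwoSided] : Type u :=
  Unitization ℂ (idealAlg I)

/-- The homomorphism `I^♯ → A`, `a + ζ 1 ↦ a + ζ 1`. -/
noncomputable def sharpIncl {A : Type u} [Ring A] [Algebra ℂ A] (I : Ideal A) [I.IsTwoSided] :
    Sharp I →+* A := (Unitization.lift (idealIncl I)).toRingHom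

/-- The homomorphism `I^♯ → ℂ`, `a + ζ 1 ↦ ζ`. -/
def sharpFst {A : Type u} [Ring A] [Algebra ℂ A] (I : Ideal A) [I.IsTwoSided] :
    Sharp I →+* ℂ := (Unitization.fstHom ℂ (idealAlg I)).toRingHom

section Sharp

set_option linter.unusedSectionVars false

variable {A : Type u} [Ring A] [Algebra ℂ A] {I : Ideal A} [I.IsTwoSided]

theorem sharpIncl_apply (x : Sharp I) :
    sharpIncl I x = algebraMap ℂ A x.fst + (x.snd : A) := rfl

theorem sharp_ext {m n : Type} {M N : Matrix m n (Sharp I)}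
    (h : M.map (sharpFst I) = N.map (sharpFst I))
    (h' : M.map (sharpIncl I) = N.map (sharpIncl I)) : M = N := by
  ext i j
  · exact congrFun (congrFun h i) j
  · have h1 : (M i j).fst = (N i j).fst := congrFun (congrFun h i) j
    have h2 : sharpIncl I (M i j) = sharpIncl I (N i j) := congrFun (congrFun h' i) j
    rw [sharpIncl_apply, sharpIncl_apply, h1] at h2
    simpa using h2

/-- The matrix over `I^♯` which is a given matrix `e` over `A` with scalar part `c`, where `e` and
`c` are congruent modulo `I`. -/
noncomputable def sharpMat {m n : Type} (c : Matrix m n ℂ) (e : Matrix m n A)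
    (h : e.map (Ideal.Quotient.mk I) = c.map (algebraMap ℂ (A ⧸ I))) : Matrix m n (Sharp I) :=
  Matrix.of fun i j => Unitization.inl (c i j) +
    Unitization.inr ⟨e i j - algebraMap ℂ A (c i j), by
      have := congrFun (congrFun h i) j
      exact Ideal.Quotient.eq.1 this⟩

theorem sharpMat_fst {m n : Type} {c : Matrix m n ℂ} {e : Matrix m n A}
    {h : e.map (Ideal.Quotient.mk I) = c.map (algebraMap ℂ (A ⧸ I))} :
    (sharpMat c e h).map (sharpFst I) = c := by
  ext i j; simp [sharpMat, sharpFst]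

theorem sharpMat_incl {m n : Type} {c : Matrix m n ℂ} {e : Matrix m n A}
    {h : e.map (Ideal.Quotient.mk I) = c.map (algebraMap ℂ (A ⧸ I))} :
    (sharpMat c e h).map (sharpIncl I) = e := by
  ext i j; simp [sharpMat, sharpIncl_apply]

theorem map_fst_mul {l m n : Type} [Fintype m] (M : Matrix l m (Sharp I))
    (N : Matrix m n (Sharp I)) :
    (M * N).map (sharpFst I) = M.map (sharpFst I) * N.map (sharpFst I) :=
  Matrix.map_mul

theorem sharpMat_mul {l m n : Type} [Fintype m] {c : Matrix l m ℂ} {e : Matrix l m A}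
    {h : e.map (Ideal.Quotient.mk I) = c.map (algebraMap ℂ (A ⧸ I))}
    {c' : Matrix m n ℂ} {e' : Matrix m n A}
    {h' : e'.map (Ideal.Quotient.mk I) = c'.map (algebraMap ℂ (A ⧸ I))}
    {c'' : Matrix l n ℂ} {e'' : Matrix l n A}
    {h'' : e''.map (Ideal.Quotient.mk I) = c''.map (algebraMap ℂ (A ⧸ I))}
    (hc : c * c' = c'') (he : e * e' = e'') :
    sharpMat c e h * sharpMat c' e' h' = sharpMat c'' e'' h'' := by
  refine sharp_ext ?_ ?_
  · rw [map_fst_mul, sharpMat_fst, sharpMat_fst, sharpMat_fst, hc]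
  · rw [Matrix.map_mul, sharpMat_incl, sharpMat_incl, sharpMat_incl, he]

/-- The idempotent `I^{(n)} ⊕ 0` of `M_{2n}`. -/
def corner (m : Type) [DecidableEq m] (R : Type u) [Zero R] [One R] : Matrix (m ⊕ m) (m ⊕ m) R :=
  fromBlocks 1 0 0 0

theorem corner_idem {m : Type} [Fintype m] [DecidableEq m] {R : Type u} [Ring R] :
    corner m R * corner m R = corner m R := by
  simp [corner, fromBlocks_multiply]

theorem corner_map {m : Type} [Fintype m] [DecidableEq m] {R : Type u} {S : Type v} [Ring R]
    [Ring S] (f : R →+* S) : (corner m R).map f = corner m S := by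
  rw [corner, fromBlocks_map, corner]
  congr 1 <;> simp

/-- `w` is a lift to `GL_{2n}(A)` of `u ⊕ u⁻¹`, for `u ∈ GL_n(A/I)`. -/
def IsIndexLift {m : Type} [Fintype m] [DecidableEq m] (U : GLn m (A ⧸ I)) (w : GLn (m ⊕ m) A) :
    Prop := GLn.map (Ideal.Quotient.mk I) w = GLn.block U U⁻¹

theorem IsIndexLift.val_map {m : Type} [Fintype m] [DecidableEq m] {U : GLn m (A ⧸ I)}
    {w : GLn (m ⊕ m) A} (h : IsIndexLift U w) :
    w.val.map (Ideal.Quotient.mk I) = fromBlocks U.val 0 0 (U⁻¹).val :=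
  congrArg Units.val h

theorem IsIndexLift.inv_map {m : Type} [Fintype m] [DecidableEq m] {U : GLn m (A ⧸ I)}
    {w : GLn (m ⊕ m) A} (h : IsIndexLift U w) :
    (w⁻¹).val.map (Ideal.Quotient.mk I) = fromBlocks (U⁻¹).val 0 0 U.val :=
  congrArg (fun x => (x⁻¹).val) h

theorem IsIndexLift.conj_map {m : Type} [Fintype m] [DecidableEq m] {U : GLn m (A ⧸ I)}
    {w : GLn (m ⊕ m) A} (h : IsIndexLift U w) :
    (w.val * corner m A * (w⁻¹).val).map (Ideal.Quotient.mk I) =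
      (corner m ℂ).map (algebraMap ℂ (A ⧸ I)) := by
  rw [Matrix.map_mul, Matrix.map_mul, h.val_map, h.inv_map, corner_map, corner_map, corner]
  simp [fromBlocks_multiply]

theorem exists_isIndexLift {m : Type} [Fintype m] [DecidableEq m] (U : GLn m (A ⧸ I)) :
    ∃ w : GLn (m ⊕ m) A, IsIndexLift U w := by
  have hs : Function.Surjective (Ideal.Quotient.mk I) := Ideal.Quotient.mk_surjective
  have lift : ∀ M : Matrix m m (A ⧸ I), ∃ N : Matrix m m A, N.map (Ideal.Quotient.mk I) = M := by
    intro M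
    choose f hf using fun i j => hs (M i j)
    exact ⟨Matrix.of f, by ext i j; exact hf i j⟩
  obtain ⟨a, ha⟩ := lift U.val
  obtain ⟨b, hb⟩ := lift (U⁻¹).val
  let up : GLn (m ⊕ m) A := ⟨fromBlocks 1 a 0 1, fromBlocks 1 (-a) 0 1,
    by simp [fromBlocks_multiply], by simp [fromBlocks_multiply]⟩
  let lo : GLn (m ⊕ m) A := ⟨fromBlocks 1 0 (-b) 1, fromBlocks 1 0 b 1,
    by simp [fromBlocks_multiply], by simp [fromBlocks_multiply]⟩
  let ro : GLn (m ⊕ m) A := ⟨fromBlocks 0 (-1) 1 0, fromBlocks 0 1 (-1) 0,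
    by simp [fromBlocks_multiply], by simp [fromBlocks_multiply]⟩
  refine ⟨up * lo * up * ro, ?_⟩
  have e1 : (GLn.map (Ideal.Quotient.mk I) up).val = fromBlocks 1 U.val 0 1 := by
    rw [GLn.map_val, fromBlocks_map, ha]; congr 1 <;> simp
  have e2 : (GLn.map (Ideal.Quotient.mk I) lo).val = fromBlocks 1 0 (-(U⁻¹).val) 1 := by
    rw [GLn.map_val, fromBlocks_map, ← hb]
    congr 1 <;> simp
  have e3 : (GLn.map (Ideal.Quotient.mk I) ro).val = fromBlocks 0 (-1) 1 0 := by
    rw [GLn.map_val, fromBlocks_map]; congr 1 <;> first | simp | (ext i j; by_cases hij : i = j <;> simp [hij])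
  rw [IsIndexLift]
  ext1
  rw [map_mul, map_mul, map_mul, Units.val_mul, Units.val_mul, Units.val_mul, e1, e2, e3,
    GLn.block_val]
  simp [fromBlocks_multiply]

/-- The idempotent `w (I^{(n)} ⊕ 0) w⁻¹`, which is congruent to `I^{(n)} ⊕ 0` modulo `I`, as a
matrix over `I^♯`. -/
noncomputable def indexIdem {m : Type} [Fintype m] [DecidableEq m] {U : GLn m (A ⧸ I)}
    {w : GLn (m ⊕ m) A} (h : IsIndexLift U w) : Matrix (m ⊕ m) (m ⊕ m) (Sharp I) :=
  sharpMat (corner m ℂ) (w.val * corner m A * (w⁻¹).val) h.conj_map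

theorem conj_corner_idem {m : Type} [Fintype m] [DecidableEq m] (w : GLn (m ⊕ m) A) :
    w.val * corner m A * (w⁻¹).val * (w.val * corner m A * (w⁻¹).val) =
      w.val * corner m A * (w⁻¹).val := by
  calc _ = w.val * corner m A * ((w⁻¹).val * w.val) * corner m A * (w⁻¹).val := by
        simp only [Matrix.mul_assoc]
    _ = w.val * (corner m A * corner m A) * (w⁻¹).val := by
        rw [Units.inv_mul, Matrix.mul_one]; simp only [Matrix.mul_assoc]
    _ = _ := by rw [corner_idem]

theorem indexIdem_idem {m : Type} [Fintype m] [DecidableEq m] {U : GLn m (A ⧸ I)}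
    {w : GLn (m ⊕ m) A} (h : IsIndexLift U w) : indexIdem h * indexIdem h = indexIdem h :=
  sharpMat_mul corner_idem (conj_corner_idem w)

theorem KZeroNonunital.mem_of {J : Type u} [NonUnitalRing J] [Module ℂ J]
    [SMulCommClass ℂ J J] [IsScalarTower ℂ J J] {m : Type} [Fintype m]
    (P : Matrix m m (Unitization ℂ J)) (hP : P * P = P) :
    KZero.mk P hP - KZero.mk (P.map (scalarMap J)) (idem_map _ hP) ∈ KZeroNonunital J := by
  refine ⟨Fintype.card m, (Idem.of P hP).mat, (Idem.of P hP).idem, ?_⟩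
  congr 1
  · exact KZero.mk_eq_of (AlgEquivalent.reindex hP _)
  · exact KZero.mk_eq_of (AlgEquivalent.reindex (idem_map (scalarMap J) hP) _)

/-- The element `[w (I^{(n)} ⊕ 0) w⁻¹]₀ - [I^{(n)} ⊕ 0]₀` of `K₀(I)`. -/
noncomputable def indexClass {m : Type} [Fintype m] [DecidableEq m] {U : GLn m (A ⧸ I)}
    {w : GLn (m ⊕ m) A} (h : IsIndexLift U w) : KZeroNonunital (idealAlg I) :=
  ⟨KZero.mk (indexIdem h) (indexIdem_idem h) - KZero.mk (corner m (Sharp I)) corner_idem, by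
    convert KZeroNonunital.mem_of (indexIdem h) (indexIdem_idem h) using 3
    rw [← corner_map (algebraMap ℂ (Sharp I)), ← sharpMat_fst (h := h.conj_map)]
    rfl⟩

theorem indexClass_eq_of {m : Type} [Fintype m] [DecidableEq m] {U V : GLn m (A ⧸ I)}
    {w w' : GLn (m ⊕ m) A} (h : IsIndexLift U w) (h' : IsIndexLift V w')
    (R T : Matrix (m ⊕ m) (m ⊕ m) A)
    (hR : R.map (Ideal.Quotient.mk I) = corner m (A ⧸ I))
    (hT : T.map (Ideal.Quotient.mk I) = corner m (A ⧸ I))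
    (h1 : R * T = w.val * corner m A * (w⁻¹).val)
    (h2 : T * R = w'.val * corner m A * (w'⁻¹).val) : indexClass h = indexClass h' := by
  apply Subtype.ext
  simp only [indexClass]
  congr 1
  rw [← corner_map (algebraMap ℂ (A ⧸ I))] at hR hT
  exact KZero.mk_eq_of ⟨sharpMat _ R hR, sharpMat _ T hT, (sharpMat_mul corner_idem h1).symm,
    (sharpMat_mul corner_idem h2).symm⟩

theorem indexClass_eq {m : Type} [Fintype m] [DecidableEq m] {U : GLn m (A ⧸ I)}
    {w w' : GLn (m ⊕ m) A} (h : IsIndexLift U w) (h' : IsIndexLift U w') :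
    indexClass h = indexClass h' := by
  refine indexClass_eq_of h h' (w.val * corner m A * (w'⁻¹).val) (w'.val * corner m A * (w⁻¹).val)
    ?_ ?_ ?_ ?_
  · rw [Matrix.map_mul, Matrix.map_mul, h.val_map, h'.inv_map, corner_map, corner]
    simp [fromBlocks_multiply]
  · rw [Matrix.map_mul, Matrix.map_mul, h'.val_map, h.inv_map, corner_map, corner]
    simp [fromBlocks_multiply]
  · calc _ = w.val * corner m A * ((w'⁻¹).val * w'.val) * corner m A * (w⁻¹).val := by
          simp only [Matrix.mul_assoc]
      _ = w.val * (corner m A * corner m A) * (w⁻¹).val := by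
          rw [Units.inv_mul, Matrix.mul_one]; simp only [Matrix.mul_assoc]
      _ = _ := by rw [corner_idem]
  · calc _ = w'.val * corner m A * ((w⁻¹).val * w.val) * corner m A * (w'⁻¹).val := by
          simp only [Matrix.mul_assoc]
      _ = w'.val * (corner m A * corner m A) * (w'⁻¹).val := by
          rw [Units.inv_mul, Matrix.mul_one]; simp only [Matrix.mul_assoc]
      _ = _ := by rw [corner_idem]

theorem indexClass_one {m : Type} [Fintype m] [DecidableEq m]
    (h : IsIndexLift (1 : GLn m (A ⧸ I)) (1 : GLn (m ⊕ m) A)) : indexClass h = 0 := by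
  apply Subtype.ext
  simp only [indexClass]
  rw [ZeroMemClass.coe_zero, sub_eq_zero]
  congr 1
  refine sharp_ext ?_ ?_
  · rw [indexIdem, sharpMat_fst]
    exact (corner_map (sharpFst I)).symm
  · rw [indexIdem, sharpMat_incl, corner_map]; simp

theorem indexClass_reindex {m n : Type} [Fintype m] [DecidableEq m] [Fintype n] [DecidableEq n]
    (e : m ≃ n) {U : GLn m (A ⧸ I)} {w : GLn (m ⊕ m) A} (h : IsIndexLift U w)
    (h' : IsIndexLift (GLn.reindex e U) (GLn.reindex (e.sumCongr e) w)) :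
    indexClass h' = indexClass h := by
  apply Subtype.ext
  simp only [indexClass]
  have hc : ∀ (R : Type u) [Ring R],
      corner n R = (corner m R).submatrix (e.sumCongr e).symm (e.sumCongr e).symm := by
    intro R _
    ext (i | i) (j | j) <;> simp [corner, Matrix.one_apply]
  have hcC : corner n ℂ = (corner m ℂ).submatrix (e.sumCongr e).symm (e.sumCongr e).symm := by
    ext (i | i) (j | j) <;> simp [corner, Matrix.one_apply]
  congr 1
  · refine (KZero.mk_eq_of ?_).symm
    convert AlgEquivalent.reindex (indexIdem_idem h) (e.sumCongr e).symm using 1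
    refine sharp_ext ?_ ?_
    · rw [← Matrix.submatrix_map, indexIdem, indexIdem, sharpMat_fst, sharpMat_fst, hcC]
    · rw [← Matrix.submatrix_map, indexIdem, indexIdem, sharpMat_incl, sharpMat_incl, ← map_inv,
        GLn.reindex_val, GLn.reindex_val, hc, Matrix.submatrix_mul_equiv,
        Matrix.submatrix_mul_equiv]
  · refine (KZero.mk_eq_of ?_).symm
    convert AlgEquivalent.reindex corner_idem (e.sumCongr e).symm using 1
    exact hc _

theorem indexClass_block {m n : Type} [Fintype m] [DecidableEq m] [Fintype n] [DecidableEq n]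
    {U : GLn m (A ⧸ I)} {w : GLn (m ⊕ m) A} (h : IsIndexLift U w)
    {V : GLn n (A ⧸ I)} {z : GLn (n ⊕ n) A} (h' : IsIndexLift V z)
    (h'' : IsIndexLift (GLn.block U V)
      (GLn.reindex (Equiv.sumSumSumComm m m n n) (GLn.block w z))) :
    indexClass h'' = indexClass h + indexClass h' := by
  apply Subtype.ext
  simp only [indexClass, AddSubgroup.coe_add]
  rw [sub_add_sub_comm, KZero.mk_add_mk, KZero.mk_add_mk]
  let σ := (Equiv.sumSumSumComm m m n n).symm
  have hc : ∀ (R : Type u) [Ring R],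
      corner (m ⊕ n) R = (fromBlocks (corner m R) 0 0 (corner n R)).submatrix σ σ := by
    intro R _
    ext ((i | i) | (i | i)) ((j | j) | (j | j)) <;> simp [corner, Matrix.one_apply, σ]
  have hcC : corner (m ⊕ n) ℂ = (fromBlocks (corner m ℂ) 0 0 (corner n ℂ)).submatrix σ σ := by
    ext ((i | i) | (i | i)) ((j | j) | (j | j)) <;> simp [corner, Matrix.one_apply, σ]
  congr 1
  · refine (KZero.mk_eq_of ?_).symm
    convert AlgEquivalent.reindex (idem_blocks (indexIdem_idem h) (indexIdem_idem h')) σ using 1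
    refine sharp_ext ?_ ?_
    · rw [← Matrix.submatrix_map, fromBlocks_map, indexIdem, indexIdem, indexIdem, sharpMat_fst,
        sharpMat_fst, sharpMat_fst, hcC]
      congr 2
    · have i1 : (GLn.block w z)⁻¹.val = fromBlocks (w⁻¹).val 0 0 (z⁻¹).val := rfl
      rw [← Matrix.submatrix_map, fromBlocks_map, indexIdem, indexIdem, indexIdem, sharpMat_incl,
        sharpMat_incl, sharpMat_incl, ← map_inv, GLn.reindex_val, GLn.reindex_val, i1,
        GLn.block_val, hc, Matrix.submatrix_mul_equiv, Matrix.submatrix_mul_equiv]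
      congr 1
      rw [fromBlocks_multiply, fromBlocks_multiply]
      congr 1 <;> (ext; simp)
  · refine (KZero.mk_eq_of ?_).symm
    convert AlgEquivalent.reindex (idem_blocks corner_idem corner_idem) σ using 1
    exact hc _

theorem IsIndexLift.reindex {m n : Type} [Fintype m] [DecidableEq m] [Fintype n] [DecidableEq n]
    (e : m ≃ n) {U : GLn m (A ⧸ I)} {w : GLn (m ⊕ m) A} (h : IsIndexLift U w) :
    IsIndexLift (GLn.reindex e U) (GLn.reindex (e.sumCongr e) w) := by
  rw [IsIndexLift]
  ext1
  have := h.val_map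
  rw [GLn.map_val, GLn.reindex_val, ← Matrix.submatrix_map, this, GLn.block_val, ← map_inv,
    GLn.reindex_val, GLn.reindex_val]
  ext (i | i) (j | j) <;> simp

theorem IsIndexLift.block {m n : Type} [Fintype m] [DecidableEq m] [Fintype n] [DecidableEq n]
    {U : GLn m (A ⧸ I)} {w : GLn (m ⊕ m) A} (h : IsIndexLift U w)
    {V : GLn n (A ⧸ I)} {z : GLn (n ⊕ n) A} (h' : IsIndexLift V z) :
    IsIndexLift (GLn.block U V)
      (GLn.reindex (Equiv.sumSumSumComm m m n n) (GLn.block w z)) := by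
  rw [IsIndexLift]
  ext1
  have i1 : (GLn.block U V)⁻¹.val = fromBlocks (U⁻¹).val 0 0 (V⁻¹).val := rfl
  rw [GLn.map_val, GLn.reindex_val, ← Matrix.submatrix_map, GLn.block_val, fromBlocks_map,
    h.val_map, h'.val_map, GLn.block_val, i1, GLn.block_val]
  ext ((i | i) | (i | i)) ((j | j) | (j | j)) <;> simp

end Sharp

section IndexMap

set_option linter.unusedSectionVars false

variable {A : Type u} [NormedRing A] [NormedAlgebra ℂ A] [CompleteSpace A] {I : Ideal A}
  [I.IsTwoSided]

/-- An invertible matrix over `A/I` in the identity path component lifts to an invertible matrix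
over `A`. -/
theorem exists_lift_of_joined {m : Type} [Fintype m] [DecidableEq m] {U : GLn m (A ⧸ I)}
    (h : Joined 1 U) : ∃ w : GLn m A, GLn.map (Ideal.Quotient.mk I) w = U := by
  let H : Subgroup (GLn m (A ⧸ I)) :=
    (GLn.map (Ideal.Quotient.mk I) : GLn m A →* GLn m (A ⧸ I)).range
  have hopen : IsOpen {M : Matrix m m A | IsUnit M} := by
    let _ : NormedRing (Matrix m m A) := Matrix.linftyOpNormedRing
    have : CompleteSpace (Matrix m m A) := inferInstanceAs (CompleteSpace (m → m → A))
    have : HasSummableGeomSeries (Matrix m m A) := @instHasSummableGeomSeriesOfCompleteSpace _ _ this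
    exact Units.isOpen
  have hq : IsOpenQuotientMap (Ideal.Quotient.mk I) := Submodule.isOpenQuotientMap_mkQ I
  have hmap : IsOpenMap (fun M : Matrix m m A => M.map (Ideal.Quotient.mk I)) := by
    have h1 : IsOpenMap (Pi.map fun _ : m => (Ideal.Quotient.mk I : A → A ⧸ I)) :=
      IsOpenMap.piMap (fun _ => hq.isOpenMap) (by simp)
    exact IsOpenMap.piMap (fun _ : m => h1) (by simp)
  have hH : IsOpen (H : Set (GLn m (A ⧸ I))) := by
    have : (H : Set (GLn m (A ⧸ I))) = Units.val ⁻¹'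
        ((fun M : Matrix m m A => M.map (Ideal.Quotient.mk I)) '' {M | IsUnit M}) := by
      ext V
      constructor
      · rintro ⟨w, rfl⟩
        exact ⟨w.val, w.isUnit, rfl⟩
      · rintro ⟨_, ⟨w, rfl⟩, hw⟩
        exact ⟨w, Units.ext hw⟩
    rw [this]
    exact (hmap _ hopen).preimage Units.continuous_val
  have hclopen : IsClopen (H : Set (GLn m (A ⧸ I))) := ⟨H.isClosed_of_isOpen hH, hH⟩
  obtain ⟨γ⟩ := h
  have hsub := (isPreconnected_range γ.continuous).subset_isClopen hclopen
    ⟨1, ⟨0, γ.source⟩, H.one_mem⟩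
  exact hsub ⟨1, γ.target⟩

theorem indexClass_joined {m : Type} [Fintype m] [DecidableEq m] {U V : GLn m (A ⧸ I)}
    (hj : Joined U V) {w w' : GLn (m ⊕ m) A} (h : IsIndexLift U w) (h' : IsIndexLift V w') :
    indexClass h = indexClass h' := by
  have hj' : Joined 1 (U⁻¹ * V) := by
    have := (Joined.refl U⁻¹).mul hj
    rwa [inv_mul_cancel] at this
  obtain ⟨v, hv⟩ := exists_lift_of_joined hj'
  let D : GLn (m ⊕ m) A := GLn.block 1 v⁻¹
  let t : GLn (m ⊕ m) A := GLn.block v 1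
  have hl : IsIndexLift V (D * w * t) := by
    have hVU : V = U * (U⁻¹ * V) := by simp
    have e1 : GLn.map (Ideal.Quotient.mk I) D = GLn.block 1 (U⁻¹ * V)⁻¹ := by
      rw [← hv, ← map_inv]
      ext1
      rw [GLn.map_val, GLn.block_val, GLn.block_val, fromBlocks_map, GLn.map_val]
      congr 1; simp
    have e2 : GLn.map (Ideal.Quotient.mk I) t = GLn.block (U⁻¹ * V) 1 := by
      rw [← hv]
      ext1
      rw [GLn.map_val, GLn.block_val, GLn.block_val, fromBlocks_map, GLn.map_val]
      congr 1; simp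
    rw [IsIndexLift, map_mul, map_mul, e1, e2, show _ = _ from h, ← GLn.block_mul,
      ← GLn.block_mul]
    congr 1 <;> group
  rw [indexClass_eq h' hl]
  have c1 : D.val * corner m A = corner m A := by simp [D, GLn.block_val, corner, fromBlocks_multiply]
  have hD : D.val.map (Ideal.Quotient.mk I) * corner m (A ⧸ I) = corner m (A ⧸ I) := by
    rw [← corner_map (Ideal.Quotient.mk I), ← Matrix.map_mul, c1]
  have c2 : corner m A * (D⁻¹).val = corner m A := by
    have : (D⁻¹).val = fromBlocks 1 0 0 v.val := rfl
    simp [this, corner, fromBlocks_multiply]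
  have hD' : corner m (A ⧸ I) * (D⁻¹).val.map (Ideal.Quotient.mk I) = corner m (A ⧸ I) := by
    rw [← corner_map (Ideal.Quotient.mk I), ← Matrix.map_mul, c2]
  have c3 : t.val * corner m A * (t⁻¹).val = corner m A := by
    have : (t⁻¹).val = fromBlocks (v⁻¹).val 0 0 1 := rfl
    simp [this, t, GLn.block_val, corner, fromBlocks_multiply]
  have hE := h.conj_map
  rw [corner_map] at hE
  have hI := conj_corner_idem w
  refine indexClass_eq_of h hl (w.val * corner m A * (w⁻¹).val * (D⁻¹).val)
    (D.val * (w.val * corner m A * (w⁻¹).val)) ?_ ?_ ?_ ?_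
  · rw [Matrix.map_mul, hE, hD']
  · rw [Matrix.map_mul, hE, hD]
  · calc _ = w.val * corner m A * (w⁻¹).val * ((D⁻¹).val * D.val) *
          (w.val * corner m A * (w⁻¹).val) := by simp only [Matrix.mul_assoc]
      _ = _ := by rw [Units.inv_mul, Matrix.mul_one, hI]
  · calc _ = D.val * (w.val * corner m A * (w⁻¹).val * (w.val * corner m A * (w⁻¹).val)) *
          (D⁻¹).val := by simp only [Matrix.mul_assoc]
      _ = D.val * (w.val * (t.val * corner m A * (t⁻¹).val) * (w⁻¹).val) * (D⁻¹).val := by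
        rw [hI, c3]
      _ = _ := by simp only [_root_.mul_inv_rev, Units.val_mul, Matrix.mul_assoc]

/-- The element `[w (I^{(n)} ⊕ 0) w⁻¹]₀ - [I^{(n)} ⊕ 0]₀` of `K₀(I)` associated with
`u ∈ GL_n(A/I)`, for some lift `w ∈ GL_{2n}(A)` of `u ⊕ u⁻¹`. -/
noncomputable def indexOf {m : Type} [Fintype m] [DecidableEq m] (U : GLn m (A ⧸ I)) :
    KZeroNonunital (idealAlg I) :=
  indexClass (exists_isIndexLift U).choose_spec

theorem indexOf_eq {m : Type} [Fintype m] [DecidableEq m] {U : GLn m (A ⧸ I)}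
    {w : GLn (m ⊕ m) A} (h : IsIndexLift U w) : indexOf U = indexClass h :=
  indexClass_eq _ _

theorem indexOf_joined {m : Type} [Fintype m] [DecidableEq m] {U V : GLn m (A ⧸ I)}
    (h : Joined U V) : indexOf U = indexOf V :=
  indexClass_joined h _ _

theorem indexOf_reindex {m n : Type} [Fintype m] [DecidableEq m] [Fintype n] [DecidableEq n]
    (e : m ≃ n) (U : GLn m (A ⧸ I)) : indexOf (GLn.reindex e U) = indexOf U := by
  obtain ⟨w, h⟩ := exists_isIndexLift U
  rw [indexOf_eq h, indexOf_eq (h.reindex e), indexClass_reindex]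

theorem indexOf_block {m n : Type} [Fintype m] [DecidableEq m] [Fintype n] [DecidableEq n]
    (U : GLn m (A ⧸ I)) (V : GLn n (A ⧸ I)) :
    indexOf (GLn.block U V) = indexOf U + indexOf V := by
  obtain ⟨w, h⟩ := exists_isIndexLift U
  obtain ⟨z, h'⟩ := exists_isIndexLift V
  rw [indexOf_eq h, indexOf_eq h', indexOf_eq (h.block h'), indexClass_block h h']

theorem indexOf_one {m : Type} [Fintype m] [DecidableEq m] :
    indexOf (1 : GLn m (A ⧸ I)) = 0 := by
  have h : IsIndexLift (1 : GLn m (A ⧸ I)) (1 : GLn (m ⊕ m) A) := by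
    rw [IsIndexLift, map_one, inv_one, GLn.block_one]
  rw [indexOf_eq h, indexClass_one]

theorem indexOf_isExtension {m n : Type} [Fintype m] [DecidableEq m] [Fintype n] [DecidableEq n]
    {U : GLn m (A ⧸ I)} {W : GLn n (A ⧸ I)} (h : IsExtension U W) : indexOf U = indexOf W := by
  obtain ⟨a, e, h⟩ := h
  rw [indexOf_joined h, indexOf_reindex, indexOf_block, indexOf_one, add_zero]

theorem indexOf_stablyJoined {m n : Type} [Fintype m] [DecidableEq m] [Fintype n] [DecidableEq n]
    {U : GLn m (A ⧸ I)} {V : GLn n (A ⧸ I)} (h : StablyJoined U V) : indexOf U = indexOf V := by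
  obtain ⟨k, W, h1, h2⟩ := h
  rw [indexOf_isExtension h1, indexOf_isExtension h2]

variable (I) in
/-- The map `δ₁ : K₁(A/I) → K₀(I)`, `[u]₁ ↦ [w (I^{(n)} ⊕ 0) w⁻¹]₀ - [I^{(n)} ⊕ 0]₀`, where
`u ∈ GL_n(A/I)` and `w ∈ GL_{2n}(A)` is any lift of `u ⊕ u⁻¹`. -/
noncomputable def indexMapFun : KOne (A ⧸ I) → KZeroNonunital (idealAlg I) :=
  Quotient.lift (fun U => indexOf U.2)
    (fun _ _ h => indexOf_stablyJoined (pathEquivalent_iff.1 h))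

theorem indexMapFun_mk {m : Type} [Fintype m] [DecidableEq m] (U : GLn m (A ⧸ I)) :
    indexMapFun I (KOne.mk U) = indexOf U :=
  indexOf_reindex _ U

variable (I) in
/-- The index map `δ₁ : K₁(A/I) → K₀(I)` of the extension `0 → I → A → A/I → 0` of Banach algebras,
as a group homomorphism. It sends the class of `u ∈ GL_n(A/I)` to
`[w (I^{(n)} ⊕ 0) w⁻¹]₀ - [I^{(n)} ⊕ 0]₀`, where `w ∈ GL_{2n}(A)` is any lift of `u ⊕ u⁻¹`. -/
noncomputable def indexMap : KOne (A ⧸ I) →+ KZeroNonunital (idealAlg I) :=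
  AddMonoidHom.mk' (indexMapFun I) (fun x y => by
    induction x using KOne.ind with
    | h m U =>
    induction y using KOne.ind with
    | h n V =>
      rw [KOne.mk_add_mk, indexMapFun_mk, indexMapFun_mk, indexMapFun_mk, indexOf_block])

theorem indexMap_mk {m : Type} [Fintype m] [DecidableEq m] {U : GLn m (A ⧸ I)}
    {w : GLn (m ⊕ m) A} (h : IsIndexLift U w) : indexMap I (KOne.mk U) = indexClass h :=
  (indexMapFun_mk U).trans (indexOf_eq h)

end IndexMap
end Index

section Operators

/-- A complex vector space is infinite-dimensional. -/
class InfiniteDimensional (X : Type u) [AddCommGroup X] [Module ℂ X] : Prop where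
  not_finiteDimensional : ¬ FiniteDimensional ℂ X

/-- An ideal of operators `𝒥`: it assigns to each pair `(X, Y)` of (infinite-dimensional, complex)
Banach spaces a subspace `𝒥(X, Y)` of the space of operators from `X` to `Y`, in such a way that
`T S R ∈ 𝒥(W, Z)` whenever `R : W → X` and `T : Y → Z` are operators and `S ∈ 𝒥(X, Y)`. -/
structure OperatorIdeal where
  ops : ∀ (X Y : Type u)
    [NormedAddCommGroup X] [NormedSpace ℂ X] [CompleteSpace X] [InfiniteDimensional X]
    [NormedAddCommGroup Y] [NormedSpace ℂ Y] [CompleteSpace Y] [InfiniteDimensional Y],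
    Submodule ℂ (X →L[ℂ] Y)
  comp_mem : ∀ {W X Y Z : Type u}
    [NormedAddCommGroup W] [NormedSpace ℂ W] [CompleteSpace W] [InfiniteDimensional W]
    [NormedAddCommGroup X] [NormedSpace ℂ X] [CompleteSpace X] [InfiniteDimensional X]
    [NormedAddCommGroup Y] [NormedSpace ℂ Y] [CompleteSpace Y] [InfiniteDimensional Y]
    [NormedAddCommGroup Z] [NormedSpace ℂ Z] [CompleteSpace Z] [InfiniteDimensional Z]
    (R : W →L[ℂ] X) (S : X →L[ℂ] Y) (T : Y →L[ℂ] Z),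
    S ∈ ops X Y → T ∘L S ∘L R ∈ ops W Z

/-- `𝒥` is closed: each `𝒥(X, Y)` is closed in the operator norm. -/
def OperatorIdeal.IsClosed (J : OperatorIdeal.{u}) : Prop :=
  ∀ (X Y : Type u)
    [NormedAddCommGroup X] [NormedSpace ℂ X] [CompleteSpace X] [InfiniteDimensional X]
    [NormedAddCommGroup Y] [NormedSpace ℂ Y] [CompleteSpace Y] [InfiniteDimensional Y],
    _root_.IsClosed (J.ops X Y : Set (X →L[ℂ] Y))

/-- `𝒥` is non-zero: each `𝒥(X, Y)` is non-zero. -/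
def OperatorIdeal.IsNonzero (J : OperatorIdeal.{u}) : Prop :=
  ∀ (X Y : Type u)
    [NormedAddCommGroup X] [NormedSpace ℂ X] [CompleteSpace X] [InfiniteDimensional X]
    [NormedAddCommGroup Y] [NormedSpace ℂ Y] [CompleteSpace Y] [InfiniteDimensional Y],
    J.ops X Y ≠ ⊥

/-- An operator `S : X → Y` is strictly singular if every subspace of `X` on which `S` is bounded
below is finite-dimensional. -/
def IsStrictlySingular {X Y : Type u} [NormedAddCommGroup X] [NormedSpace ℂ X]
    [NormedAddCommGroup Y] [NormedSpace ℂ Y] (S : X →L[ℂ] Y) : Prop :=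
  ∀ E : Submodule ℂ X, (∃ c : ℝ, 0 < c ∧ ∀ x ∈ E, c * ‖x‖ ≤ ‖S x‖) → FiniteDimensional ℂ E

/-- `𝒥` is contained in the ideal `𝒮` of strictly singular operators. -/
def OperatorIdeal.IsContainedInStrictlySingular (J : OperatorIdeal.{u}) : Prop :=
  ∀ (X Y : Type u)
    [NormedAddCommGroup X] [NormedSpace ℂ X] [CompleteSpace X] [InfiniteDimensional X]
    [NormedAddCommGroup Y] [NormedSpace ℂ Y] [CompleteSpace Y] [InfiniteDimensional Y],
    ∀ S ∈ J.ops X Y, IsStrictlySingular S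

section At

variable (J : OperatorIdeal.{u}) (X : Type u) [NormedAddCommGroup X] [NormedSpace ℂ X]
  [CompleteSpace X] [InfiniteDimensional X]

/-- `𝒥(X) = 𝒥(X, X)`, as an ideal of the algebra of all operators on `X`. -/
def OperatorIdeal.at : Ideal (X →L[ℂ] X) where
  carrier := J.ops X X
  add_mem' := (J.ops X X).add_mem
  zero_mem' := (J.ops X X).zero_mem
  smul_mem' T S hS := by
    have h := J.comp_mem (ContinuousLinearMap.id ℂ X) S T hS
    rwa [ContinuousLinearMap.comp_id] at h

instance OperatorIdeal.at_isTwoSided : (J.at X).IsTwoSided where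
  mul_mem_of_left {S} R hS := by
    have h := J.comp_mem R S (ContinuousLinearMap.id ℂ X) hS
    rwa [ContinuousLinearMap.id_comp] at h

/-- `K₀(ι) : K₀(𝒥(X)) → K₀(ℬ(X))`, where `ι : 𝒥(X) → ℬ(X)` is the inclusion. -/
noncomputable def OperatorIdeal.kZeroIncl :
    KZeroNonunital (idealAlg (J.at X)) →+ KZero (X →L[ℂ] X) :=
  KZeroNonunital.map (idealIncl (J.at X))

/-- `K₁(π) : K₁(ℬ(X)) → K₁(ℬ(X)/𝒥(X))`, where `π : ℬ(X) → ℬ(X)/𝒥(X)` is the quotient map. -/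
noncomputable def OperatorIdeal.kOneProj :
    KOne (X →L[ℂ] X) →+ KOne ((X →L[ℂ] X) ⧸ J.at X) :=
  KOne.map (Ideal.Quotient.mk (J.at X)) (continuous_quotientMk (J.at X))

/-- The index map `δ₁ : K₁(ℬ(X)/𝒥(X)) → K₀(𝒥(X))`. -/
noncomputable def OperatorIdeal.delta :
    KOne ((X →L[ℂ] X) ⧸ J.at X) →+ KZeroNonunital (idealAlg (J.at X)) :=
  indexMap (J.at X)

end At

/-- The Fredholm index `dim ker T - codim im T` of a Fredholm operator `T`. -/
noncomputable def fredholmIndex {E F : Type u} [NormedAddCommGroup E] [NormedSpace ℂ E]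
    [NormedAddCommGroup F] [NormedSpace ℂ F] (T : E →L[ℂ] F) : ℤ :=
  (Module.finrank ℂ T.ker : ℤ) - (Module.finrank ℂ (F ⧸ T.range) : ℤ)

/-- An algebra `A` is finite if idempotents `P ∼₀ Q` with `P ≤ Q`, that is, `P Q = P = Q P`, are
equal. -/
def IsFiniteAlgebra (A : Type u) [Ring A] : Prop :=
  ∀ P Q : A, P * P = P → Q * Q = Q → (∃ R T : A, P = R * T ∧ Q = T * R) →
    P * Q = P → Q * P = P → P = Q

/-- An algebra `A` is stably finite if all the matrix algebras `M_n(A)` are finite. -/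
def IsStablyFinite (A : Type u) [Ring A] : Prop :=
  ∀ n : ℕ, IsFiniteAlgebra (Matrix (Fin n) (Fin n) A)

end Operators

end BanachK

/-!
Write `π` for the quotient map `ℬ(X) → ℬ(X) / 𝒥(X)`, also on matrices, and identify `M_n(ℬ(X))`
with `ℬ(Xⁿ)` (`matOp`). Two facts of operator theory are combined with the six-term exact sequence
in `K`-theory.

*Riesz theory.* An operator is called Weyl if it is a finite-rank perturbation of an invertible
operator; on a Banach space these are the Fredholm operators of index zero. The Weyl operators form
an open set, and a limit of Weyl operators which is bounded below on a closed subspace of finite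
codimension is Weyl (`isWeyl_of_mem_closure`). By Kato's lemma
(`exists_infinite_dimensional_norm_le`), an operator `1 + z S` with `S` strictly singular is bounded
below on such a subspace, since otherwise it would be small, and `S` bounded below, on an
infinite-dimensional subspace. Hence the set of all complex `z` for which `1 + z S` is Weyl is open
and closed and contains `0`, so that all operators `1 + z S` are Weyl
(`IsStrictlySingular.isWeyl_one_add_smul`). Consequently a matrix congruent modulo `𝒥` to an
invertible matrix is Weyl (`isWeyl_matOp_of_map_mk_eq`). In the other direction, `𝒥` contains the
operators of finite rank, because it is non-zero.

*Vanishing of `K₁(𝒥(X))`.* All invertible finite-rank perturbations of a given Weyl operator lie in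
the same path component of the group of invertible operators, and this component is locally
constant on the line `z ↦ 1 + z S` of Weyl operators. So an invertible operator `1 + S` is connected
to `1` (`joined_one_of_forall_isWeyl`), and `K₁(π)` is always injective.

The equivalences are proved in a cycle. The composite of `δ₁` and `K₀(ι)` is zero, whence (a)
implies (b). If `δ₁` vanishes, an invertible matrix over the quotient lifts to an invertible matrix
after adding an identity block (`exists_lift_of_indexMap_eq_zero`), which is (c). Assume (c), and let
`V` be an isomorphism of `X^m` onto a closed subspace of finite codimension. It is left invertible,
and `π(V)` is invertible. By (c) some `V ⊕ 1` is congruent to an invertible matrix, so it is Weyl;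
being injective, it is invertible, and `V` is surjective (`mul_eq_one_of_kOneProj_surjective`). This
is (d). Up to passing to a quasi-inverse, a Fredholm operator is a finite-rank perturbation of such
an isomorphism `V`, and its index is zero exactly when `V` is surjective, so (d) implies (e). Under
(e), a lift of an invertible matrix over the quotient is Fredholm of index zero, hence Weyl, and
becomes invertible upon changing it by a matrix over `𝒥`. Thus all invertible matrices over the
quotient lift, and this gives (a) (`kZeroNonunital_map_injective_of_lift`). Finally, if `ℬ(X)` is
stably finite and `L V = 1`, then `V L` is an idempotent equivalent to `1`, so that `V L = 1` and (d)
holds.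
-/

namespace BanachK

open Matrix Topology

/-! ### Operators of finite rank -/

section FiniteRank

variable {E F G : Type*} [NormedAddCommGroup E] [NormedSpace ℂ E] [NormedAddCommGroup F]
  [NormedSpace ℂ F] [NormedAddCommGroup G] [NormedSpace ℂ G]

/-- An operator has finite rank if its range is finite-dimensional. -/
def IsFiniteRank (T : E →L[ℂ] F) : Prop := (T : E →ₗ[ℂ] F).HasFiniteRange

namespace IsFiniteRank

theorem zero : IsFiniteRank (0 : E →L[ℂ] F) := LinearMap.HasFiniteRange.zero

theorem add {S T : E →L[ℂ] F} (hS : IsFiniteRank S) (hT : IsFiniteRank T) :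
    IsFiniteRank (S + T) := LinearMap.HasFiniteRange.add hS hT

theorem sub {S T : E →L[ℂ] F} (hS : IsFiniteRank S) (hT : IsFiniteRank T) :
    IsFiniteRank (S - T) := LinearMap.HasFiniteRange.sub hS hT

theorem neg {S : E →L[ℂ] F} (hS : IsFiniteRank S) : IsFiniteRank (-S) :=
  LinearMap.HasFiniteRange.neg hS

theorem comp_left {S : E →L[ℂ] F} (hS : IsFiniteRank S) (T : F →L[ℂ] G) :
    IsFiniteRank (T ∘L S) := LinearMap.HasFiniteRange.comp_left hS _

theorem comp_right {S : F →L[ℂ] G} (hS : IsFiniteRank S) (T : E →L[ℂ] F) :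
    IsFiniteRank (S ∘L T) := LinearMap.HasFiniteRange.comp_right hS _

theorem mul_left {S : E →L[ℂ] E} (hS : IsFiniteRank S) (T : E →L[ℂ] E) :
    IsFiniteRank (T * S) := hS.comp_left T

theorem mul_right {S : E →L[ℂ] E} (hS : IsFiniteRank S) (T : E →L[ℂ] E) :
    IsFiniteRank (S * T) := hS.comp_right T

theorem smul {S : E →L[ℂ] F} (hS : IsFiniteRank S) (c : ℂ) : IsFiniteRank (c • S) :=
  LinearMap.HasFiniteRange.smul hS c

theorem of_finiteDimensional_codom [FiniteDimensional ℂ F] (T : E →L[ℂ] F) : IsFiniteRank T :=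
  LinearMap.HasFiniteRange.of_isNoetherian_rng

theorem finiteDimensional_range {T : E →L[ℂ] F} (hT : IsFiniteRank T) :
    FiniteDimensional ℂ T.range := Module.Finite.of_fg hT

theorem sub_trans {S T U : E →L[ℂ] F} (h : IsFiniteRank (S - T)) (h' : IsFiniteRank (T - U)) :
    IsFiniteRank (S - U) := by
  simpa using h.add h'

theorem sub_symm {S T : E →L[ℂ] F} (h : IsFiniteRank (S - T)) : IsFiniteRank (T - S) := by
  simpa using h.neg

end IsFiniteRank

theorem isQuasiInverse_iff {S : F →L[ℂ] E} {T : E →L[ℂ] F} :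
    LinearMap.IsQuasiInverse (S : F →ₗ[ℂ] E) (T : E →ₗ[ℂ] F) ↔
      IsFiniteRank (S ∘L T - .id ℂ E) ∧ IsFiniteRank (T ∘L S - .id ℂ F) := by
  rw [LinearMap.IsQuasiInverse, LinearMap.IsLeftQuasiInverse, LinearMap.IsRightQuasiInverse,
    LinearMap.FiniteRangeSetoid.equiv_iff_hasFiniteRange,
    LinearMap.FiniteRangeSetoid.equiv_iff_hasFiniteRange]
  rfl

end FiniteRank

/-! ### Weyl operators -/

section Weyl

variable {E : Type*} [NormedAddCommGroup E] [NormedSpace ℂ E]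

/-- An operator is Weyl if it is a finite-rank perturbation of an invertible operator. On a Banach
space these are exactly the Fredholm operators of index zero, see `isWeyl_iff_finrank_eq`. -/
def IsWeyl (T : E →L[ℂ] E) : Prop := ∃ G : (E →L[ℂ] E)ˣ, IsFiniteRank ((G : E →L[ℂ] E) - T)

theorem IsWeyl.of_isUnit {T : E →L[ℂ] E} (h : IsUnit T) : IsWeyl T := by
  obtain ⟨G, rfl⟩ := h
  exact ⟨G, by simpa using IsFiniteRank.zero⟩

theorem IsWeyl.congr {S T : E →L[ℂ] E} (hT : IsWeyl T) (h : IsFiniteRank (T - S)) : IsWeyl S := by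
  obtain ⟨G, hG⟩ := hT
  exact ⟨G, hG.sub_trans h⟩

theorem IsWeyl.units_mul {T : E →L[ℂ] E} (hT : IsWeyl T) (G : (E →L[ℂ] E)ˣ) :
    IsWeyl ((G : E →L[ℂ] E) * T) := by
  obtain ⟨H, hH⟩ := hT
  refine ⟨G * H, ?_⟩
  rw [Units.val_mul, ← mul_sub]
  exact hH.mul_left _

variable [CompleteSpace E]

theorem isUnit_of_bijective {T : E →L[ℂ] E} (h : Function.Bijective T) : IsUnit T :=
  ContinuousLinearMap.isUnit_iff_bijective.2 h

/-- On the finite-dimensional range of `K`, the operator `1 + K` restricts to an injective, hence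
surjective, endomorphism; and `x = (1 + K) x - K x`. -/
theorem isUnit_one_add_of_injective {K : E →L[ℂ] E} (hK : IsFiniteRank K)
    (h : Function.Injective (1 + K : E →L[ℂ] E)) : IsUnit (1 + K) := by
  have := hK.finiteDimensional_range
  let R : K.range →ₗ[ℂ] K.range := ((1 + K : E →L[ℂ] E) : E →ₗ[ℂ] E).restrict (by
    rintro x ⟨y, rfl⟩
    exact ⟨y + K y, by simp⟩)
  have hR : Function.Injective R := fun x y hxy => Subtype.ext (h (congrArg Subtype.val hxy))
  have hR' := LinearMap.injective_iff_surjective.1 hR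
  refine isUnit_of_bijective ⟨h, fun x => ?_⟩
  obtain ⟨y, hy⟩ := hR' ⟨K x, x, rfl⟩
  have hy' : (1 + K : E →L[ℂ] E) y = K x := congrArg Subtype.val hy
  exact ⟨x - y, by rw [map_sub, hy']; simp⟩

theorem IsWeyl.isUnit_of_injective {T : E →L[ℂ] E} (hT : IsWeyl T) (h : Function.Injective T) :
    IsUnit T := by
  obtain ⟨G, hG⟩ := hT
  have e : (1 : E →L[ℂ] E) + (-((G⁻¹ : (E →L[ℂ] E)ˣ) * (G - T))) = (G⁻¹ : (E →L[ℂ] E)ˣ) * T := by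
    rw [mul_sub, Units.inv_mul]; abel
  have hu : IsUnit ((1 : E →L[ℂ] E) + (-((G⁻¹ : (E →L[ℂ] E)ˣ) * (G - T)))) := by
    refine isUnit_one_add_of_injective (hG.mul_left _).neg ?_
    rw [e]
    have hi : Function.Injective ((G⁻¹ : (E →L[ℂ] E)ˣ) : E →L[ℂ] E) :=
      (ContinuousLinearMap.isUnit_iff_bijective.1 (G⁻¹).isUnit).1
    exact hi.comp h
  rw [e] at hu
  exact (Units.isUnit_units_mul _ _).1 hu

theorem IsWeyl.isUnit_of_mul_eq_one {T L : E →L[ℂ] E} (hT : IsWeyl T) (h : L * T = 1) :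
    IsUnit T :=
  hT.isUnit_of_injective (Function.LeftInverse.injective (g := L) fun x => DFunLike.congr_fun h x)

theorem IsWeyl.isUnit_of_mul_eq_one' {T R : E →L[ℂ] E} (hT : IsWeyl T) (h : T * R = 1) :
    IsUnit T := by
  -- a right inverse of `T` is again Weyl, and it is injective
  have hR : IsWeyl R := by
    obtain ⟨G, hG⟩ := hT
    refine ⟨G⁻¹, ?_⟩
    have : ((G⁻¹ : (E →L[ℂ] E)ˣ) : E →L[ℂ] E) - R = -((G⁻¹ : (E →L[ℂ] E)ˣ) * ((G - T) * R)) := by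
      rw [sub_mul, h, mul_sub, ← mul_assoc, Units.inv_mul]; simp
    rw [this]
    exact ((hG.mul_right R).mul_left _).neg
  obtain ⟨R', hR'⟩ := hR.isUnit_of_mul_eq_one h
  rw [← hR'] at h
  rw [Units.mul_eq_one_iff_eq_inv] at h
  rw [h]
  exact Units.isUnit _

end Weyl

/-! ### Fredholm operators and one-sided inverses -/

section Package

open ContinuousLinearMap

variable {E F : Type*} [NormedAddCommGroup E] [NormedSpace ℂ E] [NormedAddCommGroup F]
  [NormedSpace ℂ F]

/-- The smaller of two finite-dimensional spaces is a retract of the larger one, and the retraction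
is an isomorphism exactly when the dimensions agree. -/
theorem exists_linearMap_comp_eq_id {V W : Type*} [AddCommGroup V] [Module ℂ V]
    [FiniteDimensional ℂ V] [AddCommGroup W] [Module ℂ W] [FiniteDimensional ℂ W]
    (h : Module.finrank ℂ V ≤ Module.finrank ℂ W) :
    ∃ (φ : V →ₗ[ℂ] W) (ψ : W →ₗ[ℂ] V), ψ ∘ₗ φ = LinearMap.id ∧
      (φ ∘ₗ ψ = LinearMap.id ↔ Module.finrank ℂ V = Module.finrank ℂ W) := by
  obtain ⟨φ, hφ⟩ := finrank_le_iff_exists_linearMap.1 h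
  obtain ⟨ψ, hψ⟩ := φ.exists_leftInverse_of_injective (LinearMap.ker_eq_bot.2 hφ)
  have hψ' : ∀ x, ψ (φ x) = x := fun x => DFunLike.congr_fun hψ x
  refine ⟨φ, ψ, hψ, fun e => ?_, fun e => ?_⟩
  · exact LinearEquiv.finrank_eq (LinearEquiv.ofLinearMap φ ψ e hψ)
  · have hs := (LinearMap.injective_iff_surjective_of_finrank_eq_finrank e).1 hφ
    ext y
    obtain ⟨x, rfl⟩ := hs y
    simp [hψ']

/-- The quasi-inverse attached to a Fredholm package, with the two decompositions exchanged. -/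
noncomputable def packageSymm {u : E →L[ℂ] F} (pkg : FredholmPackage u) :
    FredholmPackage pkg.quasiInverse where
  decDom := pkg.decCodom
  decCodom := pkg.decDom
  equiv := pkg.equiv.symm
  eq_equiv := rfl

theorem finrank_ker_of_package {u : E →L[ℂ] F} (pkg : FredholmPackage u) :
    Module.finrank ℂ u.ker = Module.finrank ℂ pkg.decDom.X₀ := by
  rw [pkg.ker_eq]

theorem finrank_coker_of_package {u : E →L[ℂ] F} (pkg : FredholmPackage u) :
    Module.finrank ℂ (F ⧸ u.range) = Module.finrank ℂ pkg.decCodom.X₀ := by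
  rw [pkg.range_eq]
  exact (Submodule.quotientEquivOfIsCompl _ _ pkg.decCodom.isTopCompl.isCompl).finrank_eq

/-- If the kernel of a Fredholm operator `u` is no larger than its cokernel, embed the former into
the latter: this gives a finite-rank perturbation `V` of `u` with a left inverse `L`, and `V` is
invertible exactly when the two dimensions agree. -/
theorem exists_left_invertible_of_package {u : E →L[ℂ] F} (pkg : FredholmPackage u)
    (h : Module.finrank ℂ pkg.decDom.X₀ ≤ Module.finrank ℂ pkg.decCodom.X₀) :
    ∃ (V : E →L[ℂ] F) (L : F →L[ℂ] E), L ∘L V = .id ℂ E ∧ IsFiniteRank (V - u) ∧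
      IsFiniteRank (V ∘L L - .id ℂ F) ∧
      (V ∘L L = .id ℂ F ↔
        Module.finrank ℂ pkg.decDom.X₀ = Module.finrank ℂ pkg.decCodom.X₀) := by
  have f1 := pkg.decDom.finite_X₀
  have f2 := pkg.decCodom.finite_X₀
  obtain ⟨φ, ψ, h1, h2⟩ := exists_linearMap_comp_eq_id h
  have h1' : ∀ x, ψ (φ x) = x := fun x => DFunLike.congr_fun h1 x
  let c1 := pkg.decDom.isTopCompl
  let c2 := pkg.decCodom.isTopCompl
  let p₀ := pkg.decDom.X₀.projectionOntoL _ c1.symm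
  let q₀ := pkg.decCodom.X₀.projectionOntoL _ c2.symm
  let V : E →L[ℂ] F := u + pkg.decCodom.X₀.subtypeL ∘L (LinearMap.toContinuousLinearMap φ) ∘L p₀
  let L : F →L[ℂ] E := pkg.quasiInverse +
    pkg.decDom.X₀.subtypeL ∘L (LinearMap.toContinuousLinearMap ψ) ∘L q₀
  have hu : ∀ x, u x = pkg.equiv (pkg.decDom.proj x) := fun x => DFunLike.congr_fun pkg.eq_equiv x
  have v1 : ∀ x : pkg.decDom.X₁, V x = pkg.equiv x := by
    intro x
    have e : u x = pkg.equiv x := by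
      rw [hu]; simp
    have e' : p₀ x = 0 := Submodule.projectionOntoL_apply_right c1.symm x
    simp [V, e, e']
  have v0 : ∀ x : pkg.decDom.X₀, V x = φ x := by
    intro x
    have e : u x = 0 := by
      rw [hu]; simp
    have e' : p₀ x = x := Submodule.projectionOntoL_apply_left c1.symm x
    simp [V, e, e']
  have l1 : ∀ y : pkg.decCodom.X₁, L y = pkg.equiv.symm y := by
    intro y
    have e' : q₀ y = 0 := Submodule.projectionOntoL_apply_right c2.symm y
    simp [L, FredholmPackage.quasiInverse, e']
  have l0 : ∀ y : pkg.decCodom.X₀, L y = ψ y := by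
    intro y
    have e' : q₀ y = y := Submodule.projectionOntoL_apply_left c2.symm y
    simp [L, FredholmPackage.quasiInverse, e']
  have decE : ∀ x : E, ∃ (a : pkg.decDom.X₁) (b : pkg.decDom.X₀), (a + b : E) = x := fun x => by
    obtain ⟨a, ha, b, hb, hx⟩ := Submodule.mem_sup.1
      (show x ∈ pkg.decDom.X₁ ⊔ pkg.decDom.X₀ by rw [c1.isCompl.sup_eq_top]; trivial)
    exact ⟨⟨a, ha⟩, ⟨b, hb⟩, hx⟩
  have decF : ∀ x : F, ∃ (a : pkg.decCodom.X₁) (b : pkg.decCodom.X₀), (a + b : F) = x :=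
    fun x => by
    obtain ⟨a, ha, b, hb, hx⟩ := Submodule.mem_sup.1
      (show x ∈ pkg.decCodom.X₁ ⊔ pkg.decCodom.X₀ by rw [c2.isCompl.sup_eq_top]; trivial)
    exact ⟨⟨a, ha⟩, ⟨b, hb⟩, hx⟩
  have VL : ∀ (a : pkg.decCodom.X₁) (b : pkg.decCodom.X₀), V (L (a + b)) = a + φ (ψ b) := by
    intro a b
    rw [map_add, map_add, l1, l0, v1, v0]; simp
  refine ⟨V, L, ?_, ?_, ?_, ?_⟩
  · ext x
    obtain ⟨a, b, rfl⟩ := decE x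
    simp [v1, v0, l1, l0, h1']
  · have : V - u = pkg.decCodom.X₀.subtypeL ∘L (LinearMap.toContinuousLinearMap φ) ∘L p₀ := by
      simp [V]
    rw [this]
    exact ((IsFiniteRank.of_finiteDimensional_codom p₀).comp_left _).comp_left _
  · have : V ∘L L - .id ℂ F = pkg.decCodom.X₀.subtypeL ∘L
        (LinearMap.toContinuousLinearMap (φ ∘ₗ ψ - LinearMap.id)) ∘L q₀ := by
      ext x
      obtain ⟨a, b, rfl⟩ := decF x
      have e1 : q₀ a = 0 := Submodule.projectionOntoL_apply_right c2.symm a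
      have e2 : q₀ b = b := Submodule.projectionOntoL_apply_left c2.symm b
      rw [_root_.sub_apply, ContinuousLinearMap.comp_apply, VL]
      simp only [ContinuousLinearMap.comp_apply, map_add, e1, e2]
      simp
    rw [this]
    exact ((IsFiniteRank.of_finiteDimensional_codom q₀).comp_left _).comp_left _
  · rw [← h2]
    constructor
    · intro e
      ext y
      have := DFunLike.congr_fun e (y : F)
      simpa [l0, v0] using this
    · intro e
      ext x
      obtain ⟨a, b, rfl⟩ := decF x
      have e' : φ (ψ b) = b := DFunLike.congr_fun e b
      simp only [ContinuousLinearMap.comp_apply, VL, e']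
      simp

/-- The Weyl operators are the Fredholm operators of index zero. If `T` is Weyl, then so is the
one-sided invertible perturbation of `T` (or of its quasi-inverse), which is therefore invertible.
-/
theorem isWeyl_iff_finrank_eq [CompleteSpace E] {T : E →L[ℂ] E} (hT : T.IsFredholm) :
    IsWeyl T ↔ Module.finrank ℂ T.ker = Module.finrank ℂ (E ⧸ T.range) := by
  obtain ⟨pkg⟩ := hT.nonempty_fredholmPackage
  rw [finrank_ker_of_package pkg, finrank_coker_of_package pkg]
  constructor
  · intro hW
    rcases le_total (Module.finrank ℂ pkg.decDom.X₀) (Module.finrank ℂ pkg.decCodom.X₀) with h | h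
    · obtain ⟨V, L, h1, h2, -, h4⟩ := exists_left_invertible_of_package pkg h
      obtain ⟨V', rfl⟩ := (hW.congr h2.sub_symm).isUnit_of_mul_eq_one h1
      have hL : L = (V'⁻¹ : (E →L[ℂ] E)ˣ) := (eq_comm.1 (Units.inv_eq_of_mul_eq_one_left h1))
      exact h4.1 (hL ▸ V'.mul_inv)
    · -- the same argument for the quasi-inverse `q`, whose left inverse `L` is congruent to `T`
      obtain ⟨V, L, h1, h2, -, h4⟩ := exists_left_invertible_of_package (packageSymm pkg) h
      have hq := (isQuasiInverse_iff.1 pkg.isQuasiInverse).1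
      have hLT : IsFiniteRank (T - L) := by
        have e : T - L = L * (pkg.quasiInverse * T - 1) + L * (V - pkg.quasiInverse) * T := by
          have : L * V = 1 := h1
          rw [mul_sub L V, this]
          noncomm_ring
        rw [e]
        exact (hq.mul_left L).add ((h2.mul_left L).mul_right T)
      obtain ⟨L', rfl⟩ := (hW.congr hLT).isUnit_of_mul_eq_one' h1
      have hV : V = (L'⁻¹ : (E →L[ℂ] E)ˣ) := (eq_comm.1 (Units.inv_eq_of_mul_eq_one_right h1))
      exact (h4.1 (hV ▸ L'.inv_mul)).symm
  · intro h
    obtain ⟨V, L, h1, h2, -, h4⟩ := exists_left_invertible_of_package pkg h.le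
    exact ⟨⟨V, L, h4.2 h, h1⟩, h2⟩

end Package

/-! ### Kato's lemma -/

section Kato

variable {E F : Type*} [NormedAddCommGroup E] [NormedSpace ℂ E] [NormedAddCommGroup F]
  [NormedSpace ℂ F]

/-- A triangular system `f k (x i) = 0` for `k < i`, `f k (x k) = 1`, `‖f k‖ ≤ 1`, `‖x k‖ ≤ 1`
controls the coefficients of a finite linear combination by its norm. -/
theorem norm_coeff_le {x : ℕ → E} {f : ℕ → E →L[ℂ] ℂ} (hx : ∀ k, ‖x k‖ ≤ 1)
    (hf : ∀ k, ‖f k‖ ≤ 1) (h1 : ∀ k, f k (x k) = 1) (h0 : ∀ k i, k < i → f k (x i) = 0)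
    (n : ℕ) (a : ℕ → ℂ) (k : ℕ) (hk : k < n) :
    ‖a k‖ ≤ 2 ^ k * ‖∑ i ∈ Finset.range n, a i • x i‖ := by
  set y := ∑ i ∈ Finset.range n, a i • x i with hy
  induction k using Nat.strong_induction_on with
  | _ k ih =>
  have e : f k y = a k + ∑ i ∈ Finset.range k, a i * f k (x i) := by
    obtain ⟨l, rfl⟩ := Nat.exists_eq_add_of_le (Nat.succ_le_of_lt hk)
    rw [hy, map_sum, Finset.sum_range_add, Finset.sum_range_succ, Finset.sum_eq_zero
      (s := Finset.range l)]
    · simp [h1, add_comm]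
    · intro i _
      rw [map_smul, h0 k _ (by omega), smul_zero]
  have hfy : ∀ z, ‖f k z‖ ≤ ‖z‖ := fun z => by
    simpa using (f k).le_of_opNorm_le (hf k) z
  have b : ‖∑ i ∈ Finset.range k, a i * f k (x i)‖ ≤ ∑ i ∈ Finset.range k, 2 ^ i * ‖y‖ := by
    refine (norm_sum_le _ _).trans (Finset.sum_le_sum fun i hi => ?_)
    have hi' := Finset.mem_range.1 hi
    rw [norm_mul]
    calc ‖a i‖ * ‖f k (x i)‖ ≤ ‖a i‖ * 1 := by
          gcongr
          exact (hfy _).trans (hx i)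
      _ ≤ _ := by rw [mul_one]; exact ih i hi' (hi'.trans hk)
  have g : ∀ k : ℕ, 1 + ∑ i ∈ Finset.range k, (2 : ℝ) ^ i = 2 ^ k := by
    intro k
    induction k with
    | zero => simp
    | succ k ih => rw [Finset.sum_range_succ, ← add_assoc, ih, pow_succ]; ring
  calc ‖a k‖ = ‖f k y - ∑ i ∈ Finset.range k, a i * f k (x i)‖ := by rw [e]; simp
    _ ≤ ‖y‖ + ∑ i ∈ Finset.range k, 2 ^ i * ‖y‖ := (norm_sub_le _ _).trans (add_le_add (hfy y) b)
    _ = 2 ^ k * ‖y‖ := by rw [← Finset.sum_mul, ← g k]; ring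

/-- Kato's lemma: an operator which is bounded below on no closed subspace of finite codimension is
arbitrarily small on some infinite-dimensional subspace. -/
theorem exists_infinite_dimensional_norm_le {T : E →L[ℂ] F}
    (h : ∀ M : Submodule ℂ E, IsClosed (M : Set E) → FiniteDimensional ℂ (E ⧸ M) →
      ∀ c : ℝ, 0 < c → ∃ x ∈ M, ‖T x‖ < c * ‖x‖) {ε : ℝ} (hε : 0 < ε) :
    ∃ N : Submodule ℂ E, ¬ FiniteDimensional ℂ N ∧ ∀ x ∈ N, ‖T x‖ ≤ ε * ‖x‖ := by
  -- The index `p.1` records how small `T` is at `p.2.1`; it increases along the sequence.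
  obtain ⟨p, hp, hr⟩ := exists_seq_of_forall_finset_exists
    (fun p : ℕ × E × (E →L[ℂ] ℂ) => ‖p.2.1‖ ≤ 1 ∧ ‖p.2.2‖ ≤ 1 ∧ p.2.2 p.2.1 = 1 ∧
      ‖T p.2.1‖ ≤ ε * (1 / 4) ^ (p.1 + 1))
    (fun p q => p.1 < q.1 ∧ p.2.2 q.2.1 = 0) (by
      intro s _
      let Φ : E →L[ℂ] (s → ℂ) := ContinuousLinearMap.pi fun p : s => p.1.2.2
      obtain ⟨x, hx, hTx⟩ := h Φ.ker Φ.isClosed_ker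
        (Module.Finite.equiv (LinearMap.quotKerEquivRange (Φ : E →ₗ[ℂ] (s → ℂ))).symm)
        (ε * (1 / 4) ^ ((s.sup Prod.fst + 1) + 1)) (by positivity)
      have hx0 : x ≠ 0 := by
        rintro rfl
        simp at hTx
      have hn : (0 : ℝ) < ‖x‖ := norm_pos_iff.2 hx0
      obtain ⟨g, hg, hgx⟩ := exists_dual_vector ℂ x hn.ne'
      have hc : ((‖x‖ : ℝ) : ℂ) ≠ 0 := by exact_mod_cast hn.ne'
      refine ⟨(s.sup Prod.fst + 1, ((‖x‖ : ℝ) : ℂ)⁻¹ • x, g), ⟨?_, hg.le, ?_, ?_⟩, ?_⟩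
      · simp [norm_smul, hn.ne']
      · simp only [map_smul, hgx, smul_eq_mul]
        exact inv_mul_cancel₀ hc
      · simp only [map_smul, norm_smul, norm_inv, Complex.norm_real, norm_norm]
        rw [inv_mul_le_iff₀ hn, mul_comm]
        exact hTx.le
      · intro q hq
        refine ⟨Nat.lt_succ_of_le (Finset.le_sup (f := Prod.fst) hq), ?_⟩
        have : Φ x ⟨q, hq⟩ = 0 := by rw [show Φ x = 0 from hx]; rfl
        simp only [map_smul]
        rw [show q.2.2 x = 0 from this, smul_zero])
  have hk : ∀ n, n ≤ (p n).1 := by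
    intro n
    induction n with
    | zero => exact Nat.zero_le _
    | succ n ih => exact Nat.succ_le_of_lt (ih.trans_lt (hr n (n + 1) (Nat.lt_succ_self n)).1)
  let x : ℕ → E := fun n => (p n).2.1
  have coeff := norm_coeff_le (x := x) (f := fun n => (p n).2.2) (fun k => (hp k).1)
    (fun k => (hp k).2.1) (fun k => (hp k).2.2.1) (fun k i hki => (hr k i hki).2)
  have hT : ∀ n, ‖T (x n)‖ ≤ ε * (1 / 4) ^ (n + 1) := fun n => by
    refine (hp n).2.2.2.trans ?_
    gcongr ?_ * ?_
    exact pow_le_pow_of_le_one (by norm_num) (by norm_num) (Nat.add_le_add_right (hk n) 1)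
  have hli : LinearIndependent ℂ x := by
    rw [linearIndependent_iff']
    intro s a hs i hi
    have hsub : s ⊆ Finset.range (s.sup id + 1) := fun j hj =>
      Finset.mem_range.2 (Nat.lt_succ_of_le (Finset.le_sup (f := id) hj))
    have := coeff (s.sup id + 1) (fun j => if j ∈ s then a j else 0) i
      (Finset.mem_range.1 (hsub hi))
    rw [← Finset.sum_subset hsub (by intro j _ hj; simp [hj]),
      Finset.sum_congr rfl (g := fun j => a j • x j) (by intro j hj; simp [hj]), hs] at this
    simpa [hi] using this
  refine ⟨Submodule.span ℂ (Set.range x), fun hfin => ?_, fun y hy => ?_⟩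
  · have := (linearIndependent_span hli).finite
    exact not_finite ℕ
  · obtain ⟨a, rfl⟩ := (Finsupp.mem_span_range_iff_exists_finsupp).1 hy
    obtain ⟨n, hn⟩ : ∃ n, a.support ⊆ Finset.range n := a.support.exists_nat_subset_range
    rw [Finsupp.sum_of_support_subset a hn _ (by simp)]
    set y := ∑ i ∈ Finset.range n, a i • x i
    have g : ∀ n : ℕ, ∑ i ∈ Finset.range n, (2 : ℝ) ^ i * (1 / 4) ^ (i + 1) ≤ 1 := by
      intro n
      have : ∀ n : ℕ, ∑ i ∈ Finset.range n, (2 : ℝ) ^ i * (1 / 4) ^ (i + 1)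
          = 1 / 2 - 1 / 2 * (1 / 2) ^ n := by
        intro n
        induction n with
        | zero => simp
        | succ n ih =>
          rw [Finset.sum_range_succ, ih, pow_succ (1 / 4 : ℝ), ← mul_assoc, ← mul_pow]
          norm_num [pow_succ]; ring
      rw [this]
      have : (0 : ℝ) ≤ (1 / 2) ^ n := by positivity
      linarith
    calc ‖T y‖ = ‖∑ i ∈ Finset.range n, a i • T (x i)‖ := by simp [y]
      _ ≤ ∑ i ∈ Finset.range n, (2 ^ i * ‖y‖) * (ε * (1 / 4) ^ (i + 1)) := by
        refine (norm_sum_le _ _).trans (Finset.sum_le_sum fun i hi => ?_)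
        rw [norm_smul]
        exact mul_le_mul (coeff n a i (Finset.mem_range.1 hi)) (hT i) (norm_nonneg _)
          (by positivity)
      _ = (ε * ‖y‖) * ∑ i ∈ Finset.range n, (2 : ℝ) ^ i * (1 / 4) ^ (i + 1) := by
        rw [Finset.mul_sum]; exact Finset.sum_congr rfl fun i _ => by ring
      _ ≤ (ε * ‖y‖) * 1 := by gcongr; exact g n
      _ = _ := mul_one _

end Kato

/-! ### Limits of Weyl operators -/

section WeylClosure

variable {E : Type*} [NormedAddCommGroup E] [NormedSpace ℂ E] [CompleteSpace E]

theorem isOpen_isWeyl : IsOpen {T : E →L[ℂ] E | IsWeyl T} := by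
  have : {T : E →L[ℂ] E | IsWeyl T} =
      ⋃ K ∈ {K : E →L[ℂ] E | IsFiniteRank K}, (fun T => T + K) ⁻¹' {S | IsUnit S} := by
    ext T
    simp only [Set.mem_ofPred_eq, Set.mem_iUnion, Set.mem_preimage, exists_prop]
    constructor
    · rintro ⟨G, hG⟩
      exact ⟨_, hG, by simp⟩
    · rintro ⟨K, hK, G, hG⟩
      exact ⟨G, by rw [hG]; simpa using hK⟩
  rw [this]
  exact isOpen_biUnion fun K _ => Units.isOpen.preimage (continuous_id.add continuous_const)

/-- If `T` is bounded below by `c`, so are the operators near `T` with constant `c / 2`; the Weyl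
ones among them are invertible, with inverses of norm at most `2 / c`, and `T` is so close to one of
them that it is invertible too. -/
theorem isUnit_of_mem_closure_isWeyl {T : E →L[ℂ] E} (hT : T ∈ closure {S | IsWeyl S}) {c : ℝ}
    (hc : 0 < c) (hb : ∀ x, c * ‖x‖ ≤ ‖T x‖) : IsUnit T := by
  obtain ⟨S, hS, hd⟩ := Metric.mem_closure_iff.1 hT (c / 2) (by positivity)
  rw [dist_eq_norm] at hd
  have hb' : ∀ x, c / 2 * ‖x‖ ≤ ‖S x‖ := by
    intro x
    have h1 : ‖T x - S x‖ ≤ c / 2 * ‖x‖ := (T - S).le_of_opNorm_le hd.le x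
    have h2 := norm_sub_norm_le (T x) (S x)
    linarith [hb x]
  obtain ⟨S, rfl⟩ := hS.isUnit_of_injective (by
    rw [injective_iff_map_eq_zero]
    intro x hx
    have := hb' x
    rw [hx, norm_zero] at this
    exact norm_le_zero_iff.1 (nonpos_of_mul_nonpos_right this (by positivity)))
  rcases subsingleton_or_nontrivial E with h | h
  · exact isUnit_of_subsingleton T
  have hi : ‖((S⁻¹ : (E →L[ℂ] E)ˣ) : E →L[ℂ] E)‖ ≤ (c / 2)⁻¹ := by
    refine ContinuousLinearMap.opNorm_le_bound _ (by positivity) fun y => ?_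
    rw [le_inv_mul_iff₀ (by positivity)]
    refine (hb' _).trans_eq ?_
    congr 1
    exact DFunLike.congr_fun S.mul_inv y
  have hd' : ‖T - S‖ < ‖((S⁻¹ : (E →L[ℂ] E)ˣ) : E →L[ℂ] E)‖⁻¹ := by
    refine hd.trans_le ?_
    rw [le_inv_comm₀ (by positivity) (Units.norm_pos _)]
    exact hi
  exact (S.ofNearby T hd').isUnit

/-- The Weyl operators near a right invertible operator `T` are right invertible, hence invertible,
and so is the right inverse of `T`. -/
theorem isUnit_of_mem_closure_isWeyl_of_mul_eq_one {T R : E →L[ℂ] E}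
    (hT : T ∈ closure {S | IsWeyl S}) (h : T * R = 1) : IsUnit T := by
  have hn : ∀ᶠ S in 𝓝 T, IsUnit (S * R) := by
    have hc : ContinuousAt (fun S : E →L[ℂ] E => S * R) T := by fun_prop
    refine hc.eventually (Units.isOpen.mem_nhds ?_)
    change IsUnit (T * R)
    rw [h]; exact isUnit_one
  obtain ⟨S, hS, hu⟩ := ((mem_closure_iff_frequently.1 hT).and_eventually hn).exists
  obtain ⟨V, hV⟩ := hu
  have hSu : IsUnit S := IsWeyl.isUnit_of_mul_eq_one' hS (R := R * (V⁻¹ : (E →L[ℂ] E)ˣ)) (by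
    rw [← mul_assoc, ← hV, Units.mul_inv])
  obtain ⟨S, rfl⟩ := hSu
  have hR : R = ((S⁻¹ * V : (E →L[ℂ] E)ˣ) : E →L[ℂ] E) := by
    rw [Units.val_mul, hV, Units.inv_mul_cancel_left]
  rw [hR, Units.mul_eq_one_iff_eq_inv] at h
  rw [h]; exact Units.isUnit _

/-- Stability of the index for semi-Fredholm operators: a limit of Weyl operators which is bounded
below on a closed subspace `M` of finite codimension is a Weyl operator. Redefining `T` on a
finite-dimensional complement `K` of `M` makes it bounded below, hence invertible, if `K` embeds into
a complement of `T M`. Otherwise it becomes right invertible but not injective, and there is no such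
limit of Weyl operators. -/
theorem isWeyl_of_mem_closure {T : E →L[ℂ] E} (hT : T ∈ closure {S | IsWeyl S})
    {M : Submodule ℂ E} (hM : IsClosed (M : Set E)) [FiniteDimensional ℂ (E ⧸ M)] {c : ℝ}
    (hc : 0 < c) (hb : ∀ x ∈ M, c * ‖x‖ ≤ ‖T x‖) : IsWeyl T := by
  obtain ⟨K, hK⟩ :=
    (Submodule.ClosedComplemented.of_finiteDimensional_quotient hM).exists_isTopCompl
  have : FiniteDimensional ℂ K := (Submodule.quotientEquivOfIsCompl M K hK.isCompl).finiteDimensional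
  let p := M.projectionOntoL K hK
  let q := K.projectionOntoL M hK.symm
  have pM : ∀ x : M, p x = x := Submodule.projectionOntoL_apply_left hK
  have pK : ∀ x : K, p x = 0 := Submodule.projectionOntoL_apply_right hK
  have qM : ∀ x : M, q x = 0 := Submodule.projectionOntoL_apply_right hK.symm
  have qK : ∀ x : K, q x = x := Submodule.projectionOntoL_apply_left hK.symm
  have hpq : ∀ x : E, (p x + q x : E) = x := fun x =>
    DFunLike.congr_fun (Submodule.projectionL_add_projectionL_eq_id hK) x
  -- `G φ S` is `S` on `M` and `φ` on `K`; it is a finite-rank perturbation of `S`.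
  let G : (K →L[ℂ] E) → (E →L[ℂ] E) → (E →L[ℂ] E) := fun φ S => S ∘L M.subtypeL ∘L p + φ ∘L q
  have Gapp : ∀ φ S x, G φ S x = S (p x) + φ (q x) := fun φ S x => rfl
  have GF : ∀ φ S, IsFiniteRank (G φ S - S) := by
    intro φ S
    have : G φ S - S = (φ - S ∘L K.subtypeL) ∘L q := by
      ext x
      have := congrArg S (hpq x)
      rw [map_add] at this
      rw [_root_.sub_apply, Gapp, ← this]
      simp
    rw [this]
    exact (IsFiniteRank.of_finiteDimensional_codom q).comp_left _
  have Gcl : ∀ φ, G φ T ∈ closure {S | IsWeyl S} := by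
    intro φ
    have hcont : Continuous (G φ) := by fun_prop
    exact map_mem_closure hcont hT fun S hS => hS.congr (GF φ S).sub_symm
  -- the image `N = T M` is closed
  let TM : M →L[ℂ] E := T ∘L M.subtypeL
  have hTM : AntilipschitzWith (Real.toNNReal c⁻¹) TM := by
    refine TM.antilipschitz_of_bound fun x => ?_
    rw [Real.coe_toNNReal _ (by positivity), le_inv_mul_iff₀ hc]
    exact hb x x.2
  have : CompleteSpace M := hM.completeSpace_coe
  have hN : IsClosed (TM.range : Set E) := hTM.isClosed_range TM.uniformContinuous
  obtain ⟨C, hC⟩ := Submodule.exists_isCompl TM.range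
  by_cases hd : (Module.finrank ℂ K : Cardinal) ≤ Module.rank ℂ C
  · -- embed `K` into `C`: the operator so obtained is bounded below
    obtain ⟨f, hf⟩ := Module.le_rank_iff_exists_linearMap.1 hd
    let e : K ≃ₗ[ℂ] (Fin (Module.finrank ℂ K) → ℂ) := (Module.finBasis ℂ K).equivFun
    let φ : K →L[ℂ] E := LinearMap.toContinuousLinearMap (C.subtype ∘ₗ f ∘ₗ e.toLinearMap)
    have φC : ∀ x, φ x ∈ C := fun x => (f (e x)).2
    have φi : Function.Injective φ :=
      Subtype.val_injective.comp (hf.comp e.injective)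
    have Gi : Function.Injective (G φ T) := by
      rw [injective_iff_map_eq_zero]
      intro x hx
      rw [Gapp] at hx
      have h1 : T (p x) = 0 ∧ φ (q x) = 0 := by
        have hmem : T (p x) ∈ C := by
          rw [eq_neg_of_add_eq_zero_left hx]; exact C.neg_mem (φC _)
        have h0 : T (p x) = 0 := Submodule.disjoint_def.1 hC.disjoint _ ⟨p x, rfl⟩ hmem
        exact ⟨h0, by rwa [h0, zero_add] at hx⟩
      have h2 : p x = 0 := hTM.injective (h1.1.trans (map_zero TM).symm)
      have h3 : q x = 0 := φi (h1.2.trans (map_zero φ).symm)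
      rw [← hpq x, h2, h3]; simp
    have Gr : (G φ T).range = TM.range ⊔ φ.range := by
      apply le_antisymm
      · rintro _ ⟨x, rfl⟩
        exact Submodule.add_mem_sup ⟨p x, rfl⟩ ⟨q x, rfl⟩
      · refine sup_le ?_ ?_
        · rintro _ ⟨x, rfl⟩
          refine ⟨x, ?_⟩
          change G φ T x = T x
          rw [Gapp, pM, qM, map_zero, add_zero]
        · rintro _ ⟨x, rfl⟩
          refine ⟨x, ?_⟩
          change G φ T x = φ x
          rw [Gapp, pK, qK]; simp
    have Gc : IsClosed (Set.range (G φ T)) := by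
      have : IsClosed ((G φ T).range : Set E) := by
        rw [Gr]
        exact Submodule.isClosed_sup_finiteDimensional _ _ hN
      exact this
    obtain ⟨k, hk⟩ := (G φ T).antilipschitz_of_injective_of_isClosed_range Gi Gc
    obtain ⟨c', hc', hb'⟩ : ∃ c' : ℝ, 0 < c' ∧ ∀ x, c' * ‖x‖ ≤ ‖G φ T x‖ := by
      refine ⟨(k + 1 : ℝ)⁻¹, by positivity, fun x => ?_⟩
      rw [inv_mul_le_iff₀ (by positivity)]
      have := (G φ T).bound_of_antilipschitz hk x
      nlinarith [norm_nonneg (G φ T x)]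
    exact (IsWeyl.of_isUnit (isUnit_of_mem_closure_isWeyl (Gcl φ) hc' hb')).congr (GF φ T)
  · -- map `K` onto `C` with a kernel: the operator so obtained is right invertible, not injective
    exfalso
    rw [not_le] at hd
    have : FiniteDimensional ℂ C := by
      rw [FiniteDimensional, ← Module.rank_lt_aleph0_iff]
      exact hd.trans (Cardinal.natCast_lt_aleph0)
    rw [← Module.finrank_eq_rank, Nat.cast_lt] at hd
    obtain ⟨σ, φ, hφσ, hiff⟩ := exists_linearMap_comp_eq_id hd.le
    have hφσ' : ∀ x, φ (σ x) = x := fun x => DFunLike.congr_fun hφσ x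
    let φ' : K →L[ℂ] E := LinearMap.toContinuousLinearMap (C.subtype ∘ₗ φ)
    let Φ : (M × C) →L[ℂ] E := TM.coprod C.subtypeL
    have Φb : Function.Bijective Φ := by
      constructor
      · rw [injective_iff_map_eq_zero]
        rintro ⟨m, y⟩ hmy
        have hmy' : TM m + y = 0 := by simpa [Φ] using hmy
        have hmem : TM m ∈ C := by
          rw [eq_neg_of_add_eq_zero_left hmy']; exact C.neg_mem y.2
        have h0 : TM m = 0 := Submodule.disjoint_def.1 hC.disjoint _ ⟨m, rfl⟩ hmem
        have h1 : m = 0 := hTM.injective (h0.trans (map_zero TM).symm)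
        rw [h0, zero_add] at hmy'
        rw [h1, Submodule.coe_eq_zero.1 hmy']; rfl
      · intro y
        obtain ⟨a, ⟨m, rfl⟩, b, hb, hy⟩ := Submodule.mem_sup.1
          (show y ∈ TM.range ⊔ C by rw [hC.sup_eq_top]; trivial)
        exact ⟨(m, ⟨b, hb⟩), by simpa [Φ] using hy⟩
    let Φe : (M × C) ≃L[ℂ] E := ContinuousLinearEquiv.ofBijective Φ
      (LinearMap.ker_eq_bot.2 Φb.1) (LinearMap.range_eq_top.2 Φb.2)
    let R : E →L[ℂ] E := (M.subtypeL.coprod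
      (K.subtypeL ∘L LinearMap.toContinuousLinearMap σ)) ∘L (Φe.symm : E →L[ℂ] (M × C))
    have GR : G φ' T * R = 1 := by
      ext y
      obtain ⟨⟨m, z⟩, rfl⟩ := Φe.surjective y
      change G φ' T (R (Φe (m, z))) = Φ (m, z)
      have hR : R (Φe (m, z)) = m + σ z := by simp [R]
      rw [hR, Gapp, map_add, map_add, pM, pK, qM, qK]
      simp [Φ, TM, φ', hφσ']
    have hu := isUnit_of_mem_closure_isWeyl_of_mul_eq_one (Gcl φ') GR
    have hinj := (ContinuousLinearMap.isUnit_iff_bijective.1 hu).1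
    refine hd.ne (hiff.1 ?_)
    ext x
    have h1 : ∀ x : K, G φ' T x = φ x := fun x => by
      rw [Gapp, pK, qK]; simp [φ']
    refine hinj ?_
    rw [h1, h1]
    simp [hφσ']

end WeylClosure

/-! ### Strictly singular perturbations and paths of invertible operators -/

section Homotopy

variable {E : Type u} [NormedAddCommGroup E] [NormedSpace ℂ E] [CompleteSpace E]

/-- Riesz theory for strictly singular operators, by continuity of the index along the line
`z ↦ 1 + z S`. -/
theorem IsStrictlySingular.isWeyl_one_add_smul {S : E →L[ℂ] E} (hS : IsStrictlySingular S)
    (z : ℂ) : IsWeyl (1 + z • S) := by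
  let f : ℂ → E →L[ℂ] E := fun z => 1 + z • S
  have hf : Continuous f := by fun_prop
  have key : IsClopen {z | IsWeyl (f z)} := by
    refine ⟨isClosed_of_closure_subset fun z hz => ?_, isOpen_isWeyl.preimage hf⟩
    have hcl : f z ∈ closure {T | IsWeyl T} := map_mem_closure hf hz fun _ h => h
    by_contra hW
    obtain ⟨N, hN, hb⟩ := exists_infinite_dimensional_norm_le (T := f z)
      (by
        intro M hM hM' c hc
        by_contra! hcon
        exact hW (isWeyl_of_mem_closure hcl hM hc hcon)) (ε := 1 / 2) (by norm_num)
    refine hN (hS N ⟨(2 * (‖z‖ + 1))⁻¹, by positivity, fun x hx => ?_⟩)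
    rw [inv_mul_le_iff₀ (by positivity)]
    have h1 : ‖x + z • S x‖ ≤ 1 / 2 * ‖x‖ := hb x hx
    have h2 := norm_sub_norm_le x (-(z • S x))
    rw [sub_neg_eq_add, norm_neg, norm_smul] at h2
    nlinarith [norm_nonneg (S x), norm_nonneg z]
  have h0 : (0 : ℂ) ∈ {z | IsWeyl (f z)} := by
    change IsWeyl (1 + (0 : ℂ) • S)
    rw [zero_smul, add_zero]
    exact .of_isUnit isUnit_one
  have hz : z ∈ {z | IsWeyl (f z)} := by rw [key.eq_univ ⟨0, h0⟩]; trivial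
  exact hz

theorem IsStrictlySingular.isWeyl_one_add {S : E →L[ℂ] E} (hS : IsStrictlySingular S) :
    IsWeyl (1 + S) := by
  simpa using hS.isWeyl_one_add_smul 1

theorem joined_units_of_joinedIn {R : Type*} [NormedRing R] [HasSummableGeomSeries R] {U V : Rˣ}
    (h : JoinedIn {x : R | IsUnit x} U V) : Joined U V := by
  obtain ⟨γ, hγ⟩ := h
  refine ⟨⟨⟨fun t => (hγ t).unit, ?_⟩, ?_, ?_⟩⟩
  · rw [Units.isOpenEmbedding_val.isEmbedding.continuous_iff]
    exact γ.continuous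
  · ext1; exact γ.source
  · ext1; exact γ.target

theorem isOpen_val_image_pathComponent {R : Type*} [NormedRing R] [NormedAlgebra ℂ R]
    [CompleteSpace R] (U : Rˣ) : IsOpen (Units.val '' pathComponent U) := by
  have : LocallyPathConnectedSpace Rˣ := Units.isOpenEmbedding_val.locallyPathConnectedSpace
  exact Units.isOpenEmbedding_val.isOpenMap _ (IsOpen.pathComponent U)

/-- The operators `1 + z K` with `K` of finite rank are invertible for all but finitely many `z`,
because the exceptional `z` are given by eigenvalues of `K` on its range. -/
theorem joined_one_of_isFiniteRank {V : (E →L[ℂ] E)ˣ} (hV : IsFiniteRank ((V : E →L[ℂ] E) - 1)) :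
    Joined 1 V := by
  set K : E →L[ℂ] E := (V : E →L[ℂ] E) - 1 with hK
  have := hV.finiteDimensional_range
  let k : Module.End ℂ K.range := (K : E →ₗ[ℂ] E).restrict (by
    rintro x -
    exact ⟨x, rfl⟩)
  have hfin : {z : ℂ | ¬ IsUnit (1 + z • K)}.Finite := by
    refine ((Module.End.finite_hasEigenvalue k).image fun μ => -μ⁻¹).subset ?_
    intro z hz
    have hz0 : z ≠ 0 := by
      rintro rfl
      exact hz (by simp)
    have hinj : ¬ Function.Injective (1 + z • K : E →L[ℂ] E) := fun h =>
      hz (isUnit_one_add_of_injective (hV.smul z) h)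
    rw [injective_iff_map_eq_zero] at hinj
    push Not at hinj
    obtain ⟨x, hx, hx0⟩ := hinj
    have hx' : x + z • K x = 0 := hx
    have hKx : K x = (-z⁻¹) • x := by
      have h := congrArg (fun y => z⁻¹ • y) (eq_neg_of_add_eq_zero_right hx')
      simpa [smul_smul, hz0] using h
    have hmem : x ∈ K.range := ⟨-(z • x), by
      change K (-(z • x)) = x
      rw [map_neg, map_smul]
      exact (eq_neg_of_add_eq_zero_left hx').symm⟩
    refine ⟨-z⁻¹, Module.End.hasEigenvalue_of_hasEigenvector (x := ⟨x, hmem⟩)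
      ⟨Module.End.mem_eigenspace_iff.2 (Subtype.ext hKx), fun h => hx0 (congrArg Subtype.val h)⟩, ?_⟩
    simp
  have hc := hfin.countable.isPathConnected_compl_of_one_lt_rank (E := ℂ)
    (by rw [Complex.rank_real_complex]; norm_num)
  have hmem : ∀ z : ℂ, IsUnit (1 + z • K) → z ∈ {z : ℂ | ¬ IsUnit (1 + z • K)}ᶜ :=
    fun z hz h => h hz
  obtain ⟨γ, hγ⟩ := hc.joinedIn 0 (hmem 0 (by simp)) 1 (hmem 1 (by simp [hK]))
  refine joined_units_of_joinedIn ⟨⟨⟨fun t => 1 + γ t • K, by fun_prop⟩, ?_, ?_⟩, fun t => ?_⟩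
  · simp
  · simp [hK]
  · exact not_not.1 (hγ t)

/-- Two invertible operators which differ by an operator of finite rank are connected. -/
theorem joined_of_isFiniteRank_sub {G H : (E →L[ℂ] E)ˣ}
    (h : IsFiniteRank ((G : E →L[ℂ] E) - (H : E →L[ℂ] E))) : Joined G H := by
  have h1 : Joined 1 (H⁻¹ * G) := by
    refine joined_one_of_isFiniteRank ?_
    have : ((H⁻¹ * G : (E →L[ℂ] E)ˣ) : E →L[ℂ] E) - 1 =
        (H⁻¹ : (E →L[ℂ] E)ˣ) * ((G : E →L[ℂ] E) - (H : E →L[ℂ] E)) := by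
      rw [mul_sub, Units.inv_mul, Units.val_mul]
    rw [this]
    exact h.mul_left _
  have h2 := (Joined.refl H).mul h1
  rw [mul_one, mul_inv_cancel_left] at h2
  exact h2.symm

/-- All invertible finite-rank perturbations of a Weyl operator lie in one path component of the
invertible group, and this component does not change along a line of Weyl operators. -/
theorem joined_one_of_forall_isWeyl {U : (E →L[ℂ] E)ˣ}
    (hU : ∀ z : ℂ, IsWeyl (1 + z • ((U : E →L[ℂ] E) - 1))) : Joined 1 U := by
  let f : ℂ → E →L[ℂ] E := fun z => 1 + z • ((U : E →L[ℂ] E) - 1)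
  have hf : Continuous f := by fun_prop
  have loc : ∀ z, ∃ G : (E →L[ℂ] E)ˣ, IsFiniteRank ((G : E →L[ℂ] E) - f z) ∧
      ∀ᶠ w in 𝓝 z, ∃ H : (E →L[ℂ] E)ˣ, IsFiniteRank ((H : E →L[ℂ] E) - f w) ∧ Joined G H := by
    intro z
    obtain ⟨G, hG⟩ := hU z
    refine ⟨G, hG, ?_⟩
    have hn : Units.val '' (pathComponent G) ∈ 𝓝 (G : E →L[ℂ] E) :=
      (isOpen_val_image_pathComponent G).mem_nhds ⟨G, mem_pathComponent_self G, rfl⟩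
    have hcont : ContinuousAt (fun w => f w + (G - f z)) z := by fun_prop
    have hn' : Units.val '' (pathComponent G) ∈ 𝓝 (f z + (G - f z)) := by
      rwa [add_sub_cancel]
    filter_upwards [hcont hn'] with w hw
    obtain ⟨H, hH, hHw⟩ := hw
    refine ⟨H, ?_, hH⟩
    rw [hHw, add_sub_cancel_left]
    exact hG
  -- the parameters `z` for which `1` lies in the component attached to `f z`
  let A : Set ℂ := {z | ∃ G : (E →L[ℂ] E)ˣ, IsFiniteRank ((G : E →L[ℂ] E) - f z) ∧ Joined 1 G}
  have hA : IsClopen A := by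
    constructor
    · refine isClosed_of_closure_subset fun z hz => ?_
      obtain ⟨G, hG, hev⟩ := loc z
      obtain ⟨w, ⟨H', hH', hj'⟩, H, hH, hj⟩ :=
        ((mem_closure_iff_frequently.1 hz).and_eventually hev).exists
      exact ⟨G, hG, hj'.trans ((joined_of_isFiniteRank_sub (hH'.sub_trans hH.sub_symm)).trans
        hj.symm)⟩
    · rw [isOpen_iff_mem_nhds]
      rintro z ⟨G', hG', hj'⟩
      obtain ⟨G, hG, hev⟩ := loc z
      filter_upwards [hev] with w hw
      obtain ⟨H, hH, hj⟩ := hw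
      exact ⟨H, hH, hj'.trans ((joined_of_isFiniteRank_sub (hG'.sub_trans hG.sub_symm)).trans hj)⟩
  have h0 : (0 : ℂ) ∈ A := ⟨1, by simpa [f] using IsFiniteRank.zero, Joined.refl _⟩
  have h1 : (1 : ℂ) ∈ A := by rw [hA.eq_univ ⟨0, h0⟩]; trivial
  obtain ⟨G, hG, hj⟩ := h1
  refine hj.trans (joined_of_isFiniteRank_sub ?_)
  simpa [f] using hG

end Homotopy

/-! ### Equality in `K₀` -/

section KZeroLemmas

variable {A : Type u} [Ring A]

theorem algEquivalent_one_blocks_compl {m : Type} [Fintype m] [DecidableEq m] {P : Matrix m m A}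
    (h : P * P = P) : AlgEquivalent (1 : Matrix m m A) (fromBlocks P 0 0 (1 - P)) := by
  refine ⟨fromCols P (1 - P), fromRows P (1 - P), ?_, ?_⟩
  · rw [fromCols_mul_fromRows]; simp [mul_sub, sub_mul, h]
  · rw [fromRows_mul_fromCols]; simp [mul_sub, sub_mul, h]

theorem map_fromBlocks_one {B : Type u} {C : Type v} [Ring B] [Ring C] (f : B →+* C) {m n : Type}
    [DecidableEq n] (Q : Matrix m m B) :
    (fromBlocks Q 0 0 (1 : Matrix n n B)).map f = fromBlocks (Q.map f) 0 0 1 := by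
  rw [fromBlocks_map, Matrix.map_one _ (map_zero _) (map_one _)]
  congr 1 <;> (ext; simp)

/-- Two idempotents have the same class in `K₀` exactly when they become equivalent after adding an
identity block. -/
theorem KZero.mk_eq_iff {m n : Type} [Fintype m] [Fintype n] {P : Matrix m m A} {hP : P * P = P}
    {Q : Matrix n n A} {hQ : Q * Q = Q} : KZero.mk P hP = KZero.mk Q hQ ↔
      ∃ k : ℕ, AlgEquivalent (fromBlocks P 0 0 (1 : Matrix (Fin k) (Fin k) A))
        (fromBlocks Q 0 0 (1 : Matrix (Fin k) (Fin k) A)) := by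
  constructor
  · intro h
    simp only [KZero.mk, Algebra.GrothendieckAddGroup.of] at h
    change AddLocalization.addMonoidOf ⊤ _ = AddLocalization.addMonoidOf ⊤ _ at h
    rw [AddSubmonoid.LocalizationMap.eq_iff_exists] at h
    obtain ⟨⟨c, _⟩, hc'⟩ := h
    change c + V.mk P hP = c + V.mk Q hQ at hc'
    induction c using V.ind with
    | h k C hC =>
    have hC' : (1 - C) * (1 - C) = 1 - C := by simp [mul_sub, sub_mul, hC]
    have h1 : V.mk C hC + V.mk (1 - C) hC' = V.mk (1 : Matrix (Fin k) (Fin k) A) (by simp) := by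
      rw [V.mk_add_mk]
      exact (V.mk_eq_iff.2 (algEquivalent_one_blocks_compl hC)).symm
    refine ⟨k, ?_⟩
    rw [← V.mk_eq_iff (hP := idem_blocks hP (by simp)) (hQ := idem_blocks hQ (by simp)),
      ← V.mk_add_mk (hP := hP) (hQ := by simp), ← V.mk_add_mk (hP := hQ) (hQ := by simp), ← h1,
      ← add_assoc, ← add_assoc, add_comm (V.mk P hP), add_comm (V.mk Q hQ), hc']
  · rintro ⟨k, h⟩
    have h1 := KZero.mk_eq_of (hP := idem_blocks hP (by simp)) (hQ := idem_blocks hQ (by simp)) h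
    rwa [← KZero.mk_add_mk (hP := hP) (hQ := by simp),
      ← KZero.mk_add_mk (hP := hQ) (hQ := by simp), add_left_inj] at h1

/-- The rank factorization of an idempotent complex matrix. -/
theorem exists_algEquivalent_one {m : Type} [Fintype m] {c : Matrix m m ℂ} (hc : c * c = c) :
    ∃ r : ℕ, AlgEquivalent c (1 : Matrix (Fin r) (Fin r) ℂ) := by
  classical
  let f : (m → ℂ) →ₗ[ℂ] (m → ℂ) := Matrix.toLin' c
  have hf : f ∘ₗ f = f := by rw [← Matrix.toLin'_mul, hc]
  let e := (Module.finBasis ℂ (LinearMap.range f)).equivFun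
  refine ⟨Module.finrank ℂ (LinearMap.range f),
    LinearMap.toMatrix' ((LinearMap.range f).subtype ∘ₗ e.symm.toLinearMap),
    LinearMap.toMatrix' (e.toLinearMap ∘ₗ f.rangeRestrict), ?_, ?_⟩
  · rw [← LinearMap.toMatrix'_comp]
    have : ((LinearMap.range f).subtype ∘ₗ e.symm.toLinearMap) ∘ₗ
        (e.toLinearMap ∘ₗ f.rangeRestrict) = f := by
      ext; simp
    rw [this, LinearMap.toMatrix'_toLin']
  · rw [← LinearMap.toMatrix'_comp]
    have : (e.toLinearMap ∘ₗ f.rangeRestrict) ∘ₗ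
        ((LinearMap.range f).subtype ∘ₗ e.symm.toLinearMap) = LinearMap.id := by
      refine LinearMap.ext fun x => ?_
      have h1 : f.rangeRestrict (e.symm x : m → ℂ) = e.symm x := by
        obtain ⟨y, hy⟩ := (e.symm x).2
        refine Subtype.ext ?_
        change f (e.symm x : m → ℂ) = e.symm x
        rw [← hy]
        exact DFunLike.congr_fun hf y
      simp only [LinearMap.comp_apply, Submodule.subtype_apply, LinearEquiv.coe_coe, h1,
        LinearEquiv.apply_symm_apply, LinearMap.id_apply]
    rw [this, LinearMap.toMatrix'_id]

end KZeroLemmas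

/-! ### Injectivity of `K₀(I) → K₀(A)` -/

section Exactness

variable {A : Type u} [Ring A] [Algebra ℂ A] {I : Ideal A} [I.IsTwoSided]

theorem map_sharpIncl_map_mk {m n : Type} (M : Matrix m n (Sharp I)) :
    (M.map (sharpIncl I)).map (Ideal.Quotient.mk I) =
      (M.map (sharpFst I)).map (algebraMap ℂ (A ⧸ I)) := by
  ext i j
  simp only [Matrix.map_apply, sharpIncl_apply, map_add]
  have h : Ideal.Quotient.mk I ((M i j).snd : A) = 0 := Ideal.Quotient.eq_zero_iff_mem.2 (M i j).snd.2
  rw [h, add_zero]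
  rfl

theorem map_algebraMap_sharpIncl {m n : Type} (M : Matrix m n ℂ) :
    (M.map (algebraMap ℂ (Sharp I))).map (sharpIncl I) = M.map (algebraMap ℂ A) := by
  ext i j
  simp [sharpIncl_apply, Unitization.algebraMap_eq_inl]

/-- If invertible matrices over `A / I` lift to invertible matrices over `A`, then an idempotent
over `I^♯` which is equivalent over `A` to its scalar part `a b` (with `b a = 1`) is so over `I^♯`:
if `P = R T` and `T R = 1` over `A`, then `b R` is invertible modulo `I`, and correcting `R` and `T`
by a lift of `b R` makes them scalar modulo `I`. -/
theorem algEquivalent_scalar_of_lift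
    (hl : ∀ (r : ℕ) (u : GLn (Fin r) (A ⧸ I)), ∃ v : GLn (Fin r) A,
      GLn.map (Ideal.Quotient.mk I) v = u)
    {m : Type} [Fintype m] {P : Matrix m m (Sharp I)} (hP : P * P = P)
    (h : AlgEquivalent (P.map (sharpIncl I)) ((P.map (sharpFst I)).map (algebraMap ℂ A))) :
    AlgEquivalent P ((P.map (sharpFst I)).map (algebraMap ℂ (Sharp I))) := by
  set c := P.map (sharpFst I) with hc
  have hcc : c * c = c := idem_map _ hP
  obtain ⟨r, hr⟩ := exists_algEquivalent_one hcc
  have h1 := fun {B : Type u} [Ring B] (f : ℂ →+* B) => AlgEquivalent.map f hr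
  simp only [Matrix.map_one _ (map_zero _) (map_one _)] at h1
  obtain ⟨R, T, hRT, hTR⟩ := AlgEquivalent.trans (idem_map _ hP) (mul_one _) h
    (h1 (algebraMap ℂ A))
  obtain ⟨a, b, hab, hba⟩ := hr
  let π := Ideal.Quotient.mk I
  have eab : a.map (algebraMap ℂ (A ⧸ I)) * b.map (algebraMap ℂ (A ⧸ I)) = R.map π * T.map π := by
    rw [← Matrix.map_mul, ← hab, ← Matrix.map_mul, ← hRT, map_sharpIncl_map_mk]
  have eba : b.map (algebraMap ℂ (A ⧸ I)) * a.map (algebraMap ℂ (A ⧸ I)) = 1 := by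
    rw [← Matrix.map_mul, ← hba, Matrix.map_one _ (map_zero _) (map_one _)]
  have eTR : T.map π * R.map π = 1 := by
    rw [← Matrix.map_mul, ← hTR, Matrix.map_one _ (map_zero _) (map_one _)]
  set a' := a.map (algebraMap ℂ (A ⧸ I))
  set b' := b.map (algebraMap ℂ (A ⧸ I))
  let u : GLn (Fin r) (A ⧸ I) := ⟨b' * R.map π, T.map π * a', by
      calc _ = b' * (R.map π * T.map π) * a' := by simp only [Matrix.mul_assoc]
        _ = (b' * a') * (b' * a') := by rw [← eab]; simp only [Matrix.mul_assoc]
        _ = 1 := by rw [eba, mul_one], by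
      calc _ = T.map π * (a' * b') * R.map π := by simp only [Matrix.mul_assoc]
        _ = (T.map π * R.map π) * (T.map π * R.map π) := by rw [eab]; simp only [Matrix.mul_assoc]
        _ = 1 := by rw [eTR, mul_one]⟩
  obtain ⟨v, hv⟩ := hl r u
  have hv1 : v.val.map π = b' * R.map π := congrArg Units.val hv
  have hv2 : (v⁻¹).val.map π = T.map π * a' := congrArg (fun x => (x⁻¹).val) hv
  have eR : (R * (v⁻¹).val).map π = a' := by
    rw [Matrix.map_mul, hv2, ← Matrix.mul_assoc, ← eab, Matrix.mul_assoc, eba, Matrix.mul_one]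
  have eT : (v.val * T).map π = b' := by
    rw [Matrix.map_mul, hv1, Matrix.mul_assoc, ← eab, ← Matrix.mul_assoc, eba, Matrix.one_mul]
  have hone : (1 : Matrix (Fin r) (Fin r) (Sharp I)) =
      sharpMat (1 : Matrix (Fin r) (Fin r) ℂ) (1 : Matrix (Fin r) (Fin r) A) (by
        rw [Matrix.map_one _ (map_zero _) (map_one _), Matrix.map_one _ (map_zero _) (map_one _)]) := by
    refine sharp_ext ?_ ?_
    · rw [sharpMat_fst, Matrix.map_one _ (map_zero _) (map_one _)]
    · rw [sharpMat_incl, Matrix.map_one _ (map_zero _) (map_one _)]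
  have hP' : P = sharpMat c (P.map (sharpIncl I)) (map_sharpIncl_map_mk P) :=
    sharp_ext sharpMat_fst.symm sharpMat_incl.symm
  refine AlgEquivalent.trans hP (idem_map _ hcc) (Q := (1 : Matrix (Fin r) (Fin r) (Sharp I)))
    ⟨sharpMat a (R * (v⁻¹).val) eR, sharpMat b (v.val * T) eT, ?_, ?_⟩
    (h1 (algebraMap ℂ (Sharp I))).symm
  · rw [sharpMat_mul hab.symm (e'' := P.map (sharpIncl I)) (h'' := map_sharpIncl_map_mk P)]
    · exact hP'
    · calc _ = R * ((v⁻¹).val * v.val) * T := by simp only [Matrix.mul_assoc]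
        _ = _ := by rw [Units.inv_mul, Matrix.mul_one, hRT]
  · rw [hone]
    refine (sharpMat_mul hba.symm ?_).symm
    calc _ = v.val * (T * R) * (v⁻¹).val := by simp only [Matrix.mul_assoc]
      _ = _ := by rw [← hTR, Matrix.mul_one, Units.mul_inv]

/-- If invertible matrices over `A / I` lift, then `K₀(I) → K₀(A)` is injective: an element of the
kernel is given by an idempotent which, after adding an identity block, is equivalent over `A` to
its scalar part. -/
theorem kZeroNonunital_map_injective_of_lift
    (hl : ∀ (r : ℕ) (u : GLn (Fin r) (A ⧸ I)), ∃ v : GLn (Fin r) A,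
      GLn.map (Ideal.Quotient.mk I) v = u) :
    Function.Injective (KZeroNonunital.map (idealIncl I)) := by
  rw [injective_iff_map_eq_zero]
  rintro ⟨_, n, P, hP, rfl⟩ h
  change KZero.map (sharpIncl I) (_ - _) = 0 at h
  rw [map_sub, KZero.map_mk, KZero.map_mk, sub_eq_zero, KZero.mk_eq_iff] at h
  obtain ⟨k, hk⟩ := h
  refine Subtype.ext (sub_eq_zero.2 (KZero.mk_eq_iff.2 ⟨k, ?_⟩))
  have hs : P.map (scalarMap (idealAlg I)) =
      (P.map (sharpFst I)).map (algebraMap ℂ (Sharp I)) := rfl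
  have key := algEquivalent_scalar_of_lift hl
    (P := fromBlocks P 0 0 (1 : Matrix (Fin k) (Fin k) (Sharp I))) (idem_blocks hP (by simp))
  simp only [map_fromBlocks_one] at key
  rw [hs]
  refine key ?_
  rw [hs, map_algebraMap_sharpIncl] at hk
  exact hk

end Exactness

/-! ### Vanishing of the index map -/

section ExactSequence

variable {A : Type u} [NormedRing A] [NormedAlgebra ℂ A] [CompleteSpace A] {I : Ideal A}
  [I.IsTwoSided]

/-- The index map is followed by zero: over `A`, the lift `w` conjugates one of the two idempotents
in the definition of the index into the other. -/
theorem kZeroNonunital_map_indexMap (x : KOne (A ⧸ I)) :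
    KZeroNonunital.map (idealIncl I) (indexMap I x) = 0 := by
  induction x using KOne.ind with
  | h n U =>
  obtain ⟨w, h⟩ := exists_isIndexLift U
  rw [indexMap_mk h]
  change KZero.map (sharpIncl I) (KZero.mk (indexIdem h) (indexIdem_idem h) -
    KZero.mk (corner (Fin n) (Sharp I)) corner_idem) = 0
  rw [map_sub, KZero.map_mk, KZero.map_mk, sub_eq_zero]
  refine KZero.mk_eq_of ?_
  rw [indexIdem, sharpMat_incl, corner_map]
  refine ⟨w.val * corner (Fin n) A, corner (Fin n) A * (w⁻¹).val, ?_, ?_⟩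
  · rw [← Matrix.mul_assoc, Matrix.mul_assoc w.val (corner (Fin n) A) (corner (Fin n) A),
      corner_idem]
  · rw [Matrix.mul_assoc, ← Matrix.mul_assoc _ w.val, Units.inv_mul, Matrix.one_mul, corner_idem]

theorem map_reindex_block_one {R : Type u} {S : Type v} [Ring R] [Ring S] (f : R →+* S)
    {m n k : Type} [Fintype m] [DecidableEq m] [Fintype n] [DecidableEq n] [Fintype k]
    [DecidableEq k] (e : m ⊕ k ≃ n) (U : GLn m R) :
    GLn.map f (GLn.reindex e (GLn.block U 1)) = GLn.reindex e (GLn.block (GLn.map f U) 1) := by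
  ext1
  rw [GLn.map_val, GLn.reindex_val, ← Matrix.submatrix_map, GLn.block_val, Units.val_one,
    map_fromBlocks_one]
  rfl

/-- If the index of `u` vanishes then `u ⊕ 1` lifts to an invertible matrix. Write the lift of
`u ⊕ u⁻¹` as `w`. An equivalence over `I^♯` between `w p w⁻¹ ⊕ 1` and an identity matrix is given by
matrices `R`, `T`, which may be taken with the scalar parts of the obvious equivalence between
`p ⊕ 1` and that identity matrix; then `T (w ⊕ 1)`, restricted to the range of `p ⊕ 1`, is
invertible and is congruent to `u ⊕ 1`. -/
theorem exists_lift_of_indexMap_eq_zero {m : Type} [Fintype m] [DecidableEq m]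
    (u : GLn m (A ⧸ I)) (hu : indexMap I (KOne.mk u) = 0) :
    ∃ (k : ℕ) (v : GLn (m ⊕ Fin k) A), GLn.map (Ideal.Quotient.mk I) v = GLn.block u 1 := by
  obtain ⟨w, h⟩ := exists_isIndexLift u
  rw [indexMap_mk h] at hu
  have hu' : KZero.mk (indexIdem h) (indexIdem_idem h) -
    KZero.mk (corner m (Sharp I)) corner_idem = 0 := congrArg Subtype.val hu
  rw [sub_eq_zero, KZero.mk_eq_iff] at hu'
  obtain ⟨k, hk⟩ := hu'
  -- `a b = p ⊕ 1` and `b a = 1`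
  let a : Matrix ((m ⊕ m) ⊕ Fin k) (m ⊕ Fin k) ℂ := fromBlocks (fromRows 1 0) 0 0 1
  let b : Matrix (m ⊕ Fin k) ((m ⊕ m) ⊕ Fin k) ℂ := fromBlocks (fromCols 1 0) 0 0 1
  have hab : a * b = fromBlocks (corner m ℂ) 0 0 1 := by
    ext ((i | i) | i) ((j | j) | j) <;> simp [a, b, fromBlocks_multiply, corner]
  have hba : b * a = 1 := by
    simp [a, b, fromBlocks_multiply, fromCols_mul_fromRows]
  have amap : ∀ {B : Type u} [Ring B] (f : ℂ →+* B), a.map f = fromBlocks (fromRows 1 0) 0 0 1 := by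
    intro B _ f
    ext ((i | i) | i) (j | j) <;> simp [a, Matrix.one_apply, apply_ite f]
  have bmap : ∀ {B : Type u} [Ring B] (f : ℂ →+* B), b.map f = fromBlocks (fromCols 1 0) 0 0 1 := by
    intro B _ f
    ext (i | i) ((j | j) | j) <;> simp [b, Matrix.one_apply, apply_ite f]
  have habmap : ∀ {B : Type u} [Ring B] (f : ℂ →+* B),
      a.map f * b.map f = fromBlocks (corner m B) 0 0 1 := by
    intro B _ f
    rw [← Matrix.map_mul, hab, map_fromBlocks_one, corner_map]
  have hbamap : ∀ {B : Type u} [Ring B] (f : ℂ →+* B), b.map f * a.map f = 1 := by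
    intro B _ f
    rw [← Matrix.map_mul, hba, Matrix.map_one _ (map_zero _) (map_one _)]
  obtain ⟨R, T, hRT, hTR⟩ := AlgEquivalent.trans
    (S := (1 : Matrix (m ⊕ Fin k) (m ⊕ Fin k) (Sharp I)))
    (idem_blocks (indexIdem_idem h) (mul_one _)) (mul_one _) hk
    ⟨a.map (algebraMap ℂ (Sharp I)), b.map (algebraMap ℂ (Sharp I)), (habmap _).symm,
      (hbamap _).symm⟩
  -- make the scalar parts of `R` and `T` equal to `a` and `b`
  set cR := R.map (sharpFst I) with hcR
  set cT := T.map (sharpFst I) with hcT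
  have cRT : cR * cT = a * b := by
    rw [hcR, hcT, ← map_fst_mul, ← hRT, map_fromBlocks_one, indexIdem, sharpMat_fst, hab]
  have cTR : cT * cR = 1 := by
    rw [hcR, hcT, ← map_fst_mul, ← hTR, Matrix.map_one _ (map_zero _) (map_one _)]
  let al : ℂ →+* Sharp I := algebraMap ℂ (Sharp I)
  let T' := (b * cR).map al * T
  let R' := R * (cT * a).map al
  have alfst : ∀ {p q : Type} (M : Matrix p q ℂ), (M.map al).map (sharpFst I) = M := by
    intro p q M
    ext i j
    simp [al, sharpFst, Unitization.algebraMap_eq_inl]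
  have fstT' : T'.map (sharpFst I) = b := by
    rw [map_fst_mul, alfst, ← hcT, Matrix.mul_assoc, cRT, ← Matrix.mul_assoc, hba, Matrix.one_mul]
  have TR' : T' * R' = 1 := by
    calc T' * R' = (b * cR).map al * (T * R) * (cT * a).map al := by
          simp only [T', R', Matrix.mul_assoc]
      _ = (b * (cR * cT) * a).map al := by
          rw [← hTR, Matrix.mul_one, ← Matrix.map_mul]; simp only [Matrix.mul_assoc]
      _ = ((b * a) * (b * a)).map al := by rw [cRT]; simp only [Matrix.mul_assoc]
      _ = 1 := by rw [hba, Matrix.one_mul, Matrix.map_one _ (map_zero _) (map_one _)]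
  have RT' : R' * T' = R * T := by
    calc R' * T' = R * ((cT * a).map al * (b * cR).map al) * T := by
          simp only [T', R', Matrix.mul_assoc]
      _ = R * ((cT * (a * b) * cR).map al) * T := by
          rw [← Matrix.map_mul]; simp only [Matrix.mul_assoc]
      _ = R * (((cT * cR) * (cT * cR)).map al) * T := by rw [← cRT]; simp only [Matrix.mul_assoc]
      _ = R * T := by
          rw [cTR, Matrix.one_mul, Matrix.map_one _ (map_zero _) (map_one _), Matrix.mul_one]
  let W : GLn ((m ⊕ m) ⊕ Fin k) A := GLn.block w 1
  let aA := a.map (algebraMap ℂ A)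
  let bA := b.map (algebraMap ℂ A)
  have hW : (R'.map (sharpIncl I)) * (T'.map (sharpIncl I)) = W.val * (aA * bA) * (W⁻¹).val := by
    have hWi : (W⁻¹).val = fromBlocks (w⁻¹).val 0 0 1 := rfl
    rw [← Matrix.map_mul, RT', ← hRT, map_fromBlocks_one, indexIdem, sharpMat_incl, habmap, hWi,
      GLn.block_val]
    simp [fromBlocks_multiply]
  have hTRA : (T'.map (sharpIncl I)) * (R'.map (sharpIncl I)) = 1 := by
    rw [← Matrix.map_mul, TR', Matrix.map_one _ (map_zero _) (map_one _)]
  refine ⟨k, ⟨T'.map (sharpIncl I) * W.val * aA, bA * (W⁻¹).val * R'.map (sharpIncl I), ?_, ?_⟩, ?_⟩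
  · calc _ = T'.map (sharpIncl I) * (W.val * (aA * bA) * (W⁻¹).val) * R'.map (sharpIncl I) := by
          simp only [Matrix.mul_assoc]
      _ = (T'.map (sharpIncl I) * R'.map (sharpIncl I)) *
          (T'.map (sharpIncl I) * R'.map (sharpIncl I)) := by
          rw [← hW]; simp only [Matrix.mul_assoc]
      _ = 1 := by rw [hTRA, Matrix.one_mul]
  · calc _ = bA * (W⁻¹).val * (R'.map (sharpIncl I) * T'.map (sharpIncl I)) * W.val * aA := by
          simp only [Matrix.mul_assoc]
      _ = bA * ((W⁻¹).val * W.val) * (aA * bA) * ((W⁻¹).val * W.val) * aA := by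
          rw [hW]; simp only [Matrix.mul_assoc]
      _ = (bA * aA) * (bA * aA) := by
          rw [Units.inv_mul, Matrix.mul_one, Matrix.mul_one]; simp only [Matrix.mul_assoc]
      _ = 1 := by rw [hbamap, Matrix.one_mul]
  · ext1
    have e1 : (T'.map (sharpIncl I)).map (Ideal.Quotient.mk I) = b.map (algebraMap ℂ (A ⧸ I)) := by
      rw [map_sharpIncl_map_mk, fstT']
    have e2 : aA.map (Ideal.Quotient.mk I) = a.map (algebraMap ℂ (A ⧸ I)) := rfl
    have e3 : W.val.map (Ideal.Quotient.mk I) =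
        fromBlocks (fromBlocks u.val 0 0 (u⁻¹).val) 0 0 1 := by
      rw [GLn.block_val, Units.val_one, map_fromBlocks_one, h.val_map]
    rw [GLn.map_val, Matrix.map_mul, Matrix.map_mul, e1, e2, e3, amap, bmap, GLn.block_val]
    ext (i | i) (j | j) <;>
      simp [fromBlocks_multiply, fromCols_mul_fromBlocks, fromCols_mul_fromRows]

end ExactSequence

/-! ### Lifting invertible matrices along paths -/

section Lifting

variable {A : Type u} [NormedRing A] [NormedAlgebra ℂ A] [CompleteSpace A] {I : Ideal A}
  [I.IsTwoSided]

/-- An invertible matrix over `A / I` which is connected to `1` lifts to an invertible matrix over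
`A` which is connected to `1`: the image of the component of `1` is an open, hence closed,
subgroup. -/
theorem exists_joined_lift_of_joined {m : Type} [Fintype m] [DecidableEq m] {U : GLn m (A ⧸ I)}
    (h : Joined 1 U) : ∃ w : GLn m A, Joined 1 w ∧ GLn.map (Ideal.Quotient.mk I) w = U := by
  let N : Subgroup (GLn m A) :=
    { carrier := pathComponent 1
      one_mem' := Joined.refl _
      mul_mem' := fun {a b} ha hb => by
        have := Joined.mul ha hb
        rwa [one_mul] at this
      inv_mem' := fun {a} ha => by
        have := Joined.inv ha
        rwa [inv_one] at this }
  let H : Subgroup (GLn m (A ⧸ I)) := N.map (GLn.map (Ideal.Quotient.mk I))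
  have hopen : IsOpen (Units.val '' (N : Set (GLn m A))) := by
    let _ : NormedRing (Matrix m m A) := Matrix.linftyOpNormedRing
    let _ : NormedAlgebra ℂ (Matrix m m A) := Matrix.linftyOpNormedAlgebra
    have : CompleteSpace (Matrix m m A) := inferInstanceAs (CompleteSpace (m → m → A))
    exact @isOpen_val_image_pathComponent (Matrix m m A) _ _ this 1
  have hq : IsOpenQuotientMap (Ideal.Quotient.mk I) := Submodule.isOpenQuotientMap_mkQ I
  have hmap : IsOpenMap (fun M : Matrix m m A => M.map (Ideal.Quotient.mk I)) := by
    have h1 : IsOpenMap (Pi.map fun _ : m => (Ideal.Quotient.mk I : A → A ⧸ I)) :=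
      IsOpenMap.piMap (fun _ => hq.isOpenMap) (by simp)
    exact IsOpenMap.piMap (fun _ : m => h1) (by simp)
  have hH : IsOpen (H : Set (GLn m (A ⧸ I))) := by
    have : (H : Set (GLn m (A ⧸ I))) = Units.val ⁻¹'
        ((fun M : Matrix m m A => M.map (Ideal.Quotient.mk I)) ''
          (Units.val '' (N : Set (GLn m A)))) := by
      ext V
      constructor
      · rintro ⟨w, hw, rfl⟩
        exact ⟨w.val, ⟨w, hw, rfl⟩, rfl⟩
      · rintro ⟨_, ⟨w, hw, rfl⟩, hwV⟩
        exact ⟨w, hw, Units.ext hwV⟩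
    rw [this]
    exact (hmap _ hopen).preimage Units.continuous_val
  have hclopen : IsClopen (H : Set (GLn m (A ⧸ I))) := ⟨H.isClosed_of_isOpen hH, hH⟩
  obtain ⟨γ⟩ := h
  obtain ⟨w, hw, e⟩ := (isPreconnected_range γ.continuous).subset_isClopen hclopen
    ⟨1, ⟨0, γ.source⟩, H.one_mem⟩ ⟨1, γ.target⟩
  exact ⟨w, hw, e⟩

/-- If `K₁(A) → K₁(A / I)` is surjective, every invertible matrix over `A / I` lifts after adding an
identity block. -/
theorem exists_lift_of_kOne_map_surjective
    (hs : Function.Surjective (KOne.map (Ideal.Quotient.mk I) (continuous_quotientMk I)))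
    {m : Type} [Fintype m] [DecidableEq m] (u : GLn m (A ⧸ I)) :
    ∃ (a k : ℕ) (e : m ⊕ Fin a ≃ Fin k) (w : GLn (Fin k) A),
      GLn.map (Ideal.Quotient.mk I) w = GLn.reindex e (GLn.block u 1) := by
  obtain ⟨y, hy⟩ := hs (KOne.mk u)
  induction y using KOne.ind with
  | h n W =>
  rw [KOne.map_mk, KOne.mk_eq_iff] at hy
  obtain ⟨k, V, ⟨b, e', h'⟩, ⟨a, e, h⟩⟩ := hy
  rw [← map_reindex_block_one] at h'
  set W' := GLn.reindex e' (GLn.block W 1)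
  have hj := (Joined.refl (GLn.map (Ideal.Quotient.mk I) W')⁻¹).mul (h'.symm.trans h)
  rw [inv_mul_cancel] at hj
  obtain ⟨w, -, hw⟩ := exists_joined_lift_of_joined hj
  exact ⟨a, k, e, W' * w, by rw [map_mul, hw, mul_inv_cancel_left]⟩

/-- Injectivity of `K₁(A) → K₁(A / I)` when `K₁(I)` vanishes in the strong sense that each
invertible matrix congruent to `1` modulo `I` is connected to `1`. -/
theorem kOne_map_injective
    (hI : ∀ (k : ℕ) (w : GLn (Fin k) A), GLn.map (Ideal.Quotient.mk I) w = 1 → Joined 1 w) :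
    Function.Injective (KOne.map (Ideal.Quotient.mk I) (continuous_quotientMk I)) := by
  rw [injective_iff_map_eq_zero]
  intro x hx
  induction x using KOne.ind with
  | h n U =>
  rw [KOne.map_mk, ← KOne.mk_one (Fin 0), KOne.mk_eq_iff] at hx
  obtain ⟨k, V, ⟨a, e, h⟩, ⟨b, e', h'⟩⟩ := hx
  rw [GLn.block_one, map_one] at h'
  rw [← map_reindex_block_one] at h
  obtain ⟨w, hw, hwU⟩ := exists_joined_lift_of_joined (h'.symm.trans h)
  have hj := (hI k (GLn.reindex e (GLn.block U 1) * w⁻¹) (by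
    rw [map_mul, map_inv, hwU, mul_inv_cancel])).mul hw
  rw [one_mul, inv_mul_cancel_right] at hj
  rw [← KOne.mk_one (Fin k), KOne.mk_eq_iff]
  exact .of_isExtension ⟨a, e, hj⟩

end Lifting

/-! ### Matrices of operators -/

section MatrixOperators

variable {X : Type u} [NormedAddCommGroup X] [NormedSpace ℂ X] {ι : Type} [Fintype ι]
  [DecidableEq ι]

/-- The identification of `M_n(ℬ(X))` with `ℬ(X^n)`. -/
noncomputable def matOp : Matrix ι ι (X →L[ℂ] X) ≃+* ((ι → X) →L[ℂ] (ι → X)) where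
  toFun M := ContinuousLinearMap.pi fun i => ∑ j, M i j ∘L ContinuousLinearMap.proj j
  invFun T := Matrix.of fun i j =>
    ContinuousLinearMap.proj i ∘L T ∘L ContinuousLinearMap.single ℂ (fun _ : ι => X) j
  left_inv M := by
    ext i j x
    simp only [Matrix.of_apply, ContinuousLinearMap.comp_apply, ContinuousLinearMap.proj_apply,
      ContinuousLinearMap.pi_apply, ContinuousLinearMap.single_apply, _root_.sum_apply]
    rw [Finset.sum_eq_single j]
    · simp
    · intro k _ hk
      simp [hk]
    · simp
  right_inv T := by
    ext x i
    simp only [Matrix.of_apply, ContinuousLinearMap.comp_apply, ContinuousLinearMap.proj_apply,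
      ContinuousLinearMap.pi_apply, ContinuousLinearMap.single_apply, _root_.sum_apply]
    rw [← Finset.sum_apply, ← map_sum, Finset.univ_sum_single]
  map_add' M N := by
    ext x i
    simp [Finset.sum_add_distrib]
  map_mul' M N := by
    ext x i
    simp only [Matrix.mul_apply, ContinuousLinearMap.comp_apply, ContinuousLinearMap.proj_apply,
      ContinuousLinearMap.pi_apply, _root_.sum_apply, map_sum, ContinuousLinearMap.mul_def]
    rw [Finset.sum_comm]

theorem matOp_symm_apply (T : (ι → X) →L[ℂ] (ι → X)) (i j : ι) :
    matOp.symm T i j =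
      ContinuousLinearMap.proj i ∘L T ∘L ContinuousLinearMap.single ℂ (fun _ : ι => X) j := rfl

theorem matOp_eq_sum (M : Matrix ι ι (X →L[ℂ] X)) :
    matOp M = ∑ i, ∑ j, ContinuousLinearMap.single ℂ (fun _ : ι => X) i ∘L M i j ∘L
      ContinuousLinearMap.proj j := by
  ext x i
  simp [matOp, Finset.sum_apply, Pi.single_apply]

theorem continuous_matOp_symm :
    Continuous (matOp.symm : ((ι → X) →L[ℂ] (ι → X)) → Matrix ι ι (X →L[ℂ] X)) := by
  refine continuous_matrix fun i j => ?_
  simp only [matOp_symm_apply]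
  fun_prop

instance infiniteDimensional_pi [InfiniteDimensional X] [Nonempty ι] :
    InfiniteDimensional (ι → X) where
  not_finiteDimensional h := by
    obtain ⟨i⟩ := ‹Nonempty ι›
    exact InfiniteDimensional.not_finiteDimensional (X := X)
      (Module.Finite.of_surjective (LinearMap.proj i : (ι → X) →ₗ[ℂ] X)
        (LinearMap.proj_surjective i))

end MatrixOperators

/-! ### Congruence modulo an operator ideal -/

section IdealMembership

variable {J : OperatorIdeal.{u}} {X : Type u} [NormedAddCommGroup X] [NormedSpace ℂ X]
  [CompleteSpace X] [InfiniteDimensional X]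

/-- A non-zero operator ideal contains all rank-one operators, hence all operators of finite
rank. -/
theorem OperatorIdeal.IsNonzero.mem_of_isFiniteRank (hJ : J.IsNonzero) {F : X →L[ℂ] X}
    (hF : IsFiniteRank F) : F ∈ J.at X := by
  obtain ⟨S, hS, hS0⟩ := (Submodule.ne_bot_iff _).1 (hJ X X)
  obtain ⟨x, hx⟩ : ∃ x, S x ≠ 0 := by
    by_contra! h
    exact hS0 (ContinuousLinearMap.ext h)
  obtain ⟨g, hg⟩ := SeparatingDual.exists_eq_one (R := ℂ) hx
  have rankOne : ∀ (f : X →L[ℂ] ℂ) (y : X), f.smulRight y ∈ J.ops X X := by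
    intro f y
    have := J.comp_mem (f.smulRight x) S (g.smulRight y) hS
    convert this using 1
    ext z
    simp [hg]
  have := hF.finiteDimensional_range
  let b := Module.finBasis ℂ F.range
  let F' : X →L[ℂ] F.range := F.codRestrict F.range fun x => ⟨x, rfl⟩
  have key : F = ∑ i, (LinearMap.toContinuousLinearMap (b.coord i) ∘L F').smulRight (b i : X) := by
    ext z
    have := congrArg Subtype.val (b.sum_repr (F' z))
    simp only [Submodule.coe_sum, Submodule.coe_smul] at this
    rw [_root_.sum_apply]
    exact this.symm
  rw [key]
  exact (J.ops X X).sum_mem fun i _ => rankOne _ _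

theorem map_mk_eq_iff {ι : Type} {M N : Matrix ι ι (X →L[ℂ] X)} :
    M.map (Ideal.Quotient.mk (J.at X)) = N.map (Ideal.Quotient.mk (J.at X)) ↔
      ∀ i j, (M - N) i j ∈ J.at X := by
  rw [← Matrix.ext_iff]
  exact forall_congr' fun i => forall_congr' fun j => Ideal.Quotient.eq

variable {ι : Type} [Fintype ι] [DecidableEq ι]

theorem isStrictlySingular_matOp (hJ : J.IsContainedInStrictlySingular)
    {M : Matrix ι ι (X →L[ℂ] X)} (hM : ∀ i j, M i j ∈ J.at X) : IsStrictlySingular (matOp M) := by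
  rcases isEmpty_or_nonempty ι with h | h
  · intro E _
    infer_instance
  · refine hJ _ _ _ ?_
    rw [matOp_eq_sum]
    exact Submodule.sum_mem _ fun i _ => Submodule.sum_mem _ fun j _ => J.comp_mem _ _ _ (hM i j)

theorem map_mk_eq_of_isFiniteRank (hJ : J.IsNonzero) {M N : Matrix ι ι (X →L[ℂ] X)}
    (h : IsFiniteRank (matOp M - matOp N)) :
    M.map (Ideal.Quotient.mk (J.at X)) = N.map (Ideal.Quotient.mk (J.at X)) := by
  refine map_mk_eq_iff.2 fun i j => hJ.mem_of_isFiniteRank ?_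
  rw [← map_sub] at h
  rw [← matOp.symm_apply_apply (M - N), matOp_symm_apply]
  exact (h.comp_right _).comp_left _

/-- A matrix congruent modulo `𝒥` to an invertible matrix `w` is a Weyl operator, being the product
of `w` and a strictly singular perturbation of the identity. -/
theorem isWeyl_matOp_of_map_mk_eq (hJ : J.IsContainedInStrictlySingular)
    {M : Matrix ι ι (X →L[ℂ] X)} {w : GLn ι (X →L[ℂ] X)}
    (h : M.map (Ideal.Quotient.mk (J.at X)) = w.val.map (Ideal.Quotient.mk (J.at X))) :
    IsWeyl (matOp M) := by
  have hS := map_mk_eq_iff.1 h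
  have hS' : ∀ i j, ((w⁻¹).val * (M - w.val)) i j ∈ J.at X := fun i j => by
    rw [Matrix.mul_apply]
    exact Ideal.sum_mem _ fun k _ => Ideal.mul_mem_left _ _ (hS k j)
  have hW := (isStrictlySingular_matOp hJ hS').isWeyl_one_add
  have := hW.units_mul (Units.mapEquiv matOp.toMulEquiv w)
  have e : M = w.val * (1 + (w⁻¹).val * (M - w.val)) := by
    rw [mul_add, ← mul_assoc, Units.mul_inv]; simp
  rw [e, map_mul, map_add, map_one]
  exact this

/-- An invertible matrix congruent to `1` modulo `𝒥` is connected to `1`; this is the vanishing of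
`K₁(𝒥(X))`. -/
theorem joined_one_of_map_mk_eq_one (hJ : J.IsContainedInStrictlySingular)
    {w : GLn ι (X →L[ℂ] X)} (h : GLn.map (Ideal.Quotient.mk (J.at X)) w = 1) : Joined 1 w := by
  have hS := map_mk_eq_iff (M := w.val) (N := 1).1 (by
    rw [Matrix.map_one _ (map_zero _) (map_one _)]
    exact congrArg Units.val h)
  let U : ((ι → X) →L[ℂ] (ι → X))ˣ := Units.mapEquiv matOp.toMulEquiv w
  have hj : Joined 1 U := joined_one_of_forall_isWeyl fun z => by
    have e : (U : (ι → X) →L[ℂ] (ι → X)) - 1 = matOp (w.val - 1) := by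
      rw [map_sub, map_one]; rfl
    rw [e]
    exact (isStrictlySingular_matOp hJ hS).isWeyl_one_add_smul z
  have := hj.map (Continuous.units_map
    (matOp (X := X) (ι := ι)).symm.toMulEquiv.toMonoidHom continuous_matOp_symm)
  rw [map_one] at this
  convert this using 1
  ext1
  exact (matOp.symm_apply_apply w.val).symm

end IdealMembership

/-! ### Isomorphisms with proper subspaces of finite codimension -/

section FredholmLifting

variable {E : Type u} [NormedAddCommGroup E] [NormedSpace ℂ E]

theorem isFredholm_of_left_right {T L R : E →L[ℂ] E} (hL : IsFiniteRank (L * T - 1))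
    (hR : IsFiniteRank (T * R - 1)) : T.IsFredholm := by
  refine ContinuousLinearMap.isFredholm_iff_exists_isQuasiInverse.2
    ⟨L, isQuasiInverse_iff.2 ⟨hL, ?_⟩⟩
  -- modulo operators of finite rank, `L` and `R` agree
  have e : T * L - 1 = T * (L * T - 1) * R - (T * L - 1) * (T * R - 1) := by noncomm_ring
  change IsFiniteRank (T * L - 1)
  rw [e]
  exact ((hL.mul_left T).mul_right R).sub (hR.mul_left _)

/-- If both products of `T` and `T'` are Weyl, then `T` is Fredholm. -/
theorem isFredholm_of_isWeyl_mul {T T' : E →L[ℂ] E} (h : IsWeyl (T * T')) (h' : IsWeyl (T' * T)) :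
    T.IsFredholm := by
  obtain ⟨G, hG⟩ := h
  obtain ⟨H, hH⟩ := h'
  refine isFredholm_of_left_right (L := (H⁻¹ : (E →L[ℂ] E)ˣ) * T')
    (R := T' * (G⁻¹ : (E →L[ℂ] E)ˣ)) ?_ ?_
  · have e : ((H⁻¹ : (E →L[ℂ] E)ˣ) : E →L[ℂ] E) * T' * T - 1 =
        -((H⁻¹ : (E →L[ℂ] E)ˣ) * ((H : E →L[ℂ] E) - T' * T)) := by
      rw [mul_sub, Units.inv_mul, neg_sub, mul_assoc]
    rw [e]
    exact (hH.mul_left _).neg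
  · have e : T * (T' * ((G⁻¹ : (E →L[ℂ] E)ˣ) : E →L[ℂ] E)) - 1 =
        -(((G : E →L[ℂ] E) - T * T') * (G⁻¹ : (E →L[ℂ] E)ˣ)) := by
      rw [sub_mul, Units.mul_inv, neg_sub, mul_assoc]
    rw [e]
    exact (hG.mul_right _).neg

/-- A proper closed subspace of finite codimension isomorphic to the whole space gives a
non-invertible left-invertible operator which is invertible modulo operators of finite rank. -/
theorem exists_left_invertible_of_equiv {W : Submodule ℂ E} (hW : IsClosed (W : Set E))
    [FiniteDimensional ℂ (E ⧸ W)] (φ : E ≃L[ℂ] W) :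
    ∃ V L : E →L[ℂ] E, L * V = 1 ∧ IsFiniteRank (V * L - 1) ∧ (V * L = 1 → W = ⊤) := by
  obtain ⟨p, hp⟩ := Submodule.ClosedComplemented.of_finiteDimensional_quotient hW
  refine ⟨W.subtypeL ∘L (φ : E →L[ℂ] W), (φ.symm : W →L[ℂ] E) ∘L p, ?_, ?_, ?_⟩
  · ext x
    simp [ContinuousLinearMap.mul_def, hp]
  · refine LinearMap.ker_coFG_iff_hasFiniteRange.1
      (Submodule.CoFG.of_le (S := W) (fun x hx => ?_) ‹_›)
    have := congrArg Subtype.val (hp ⟨x, hx⟩)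
    simpa [ContinuousLinearMap.mul_def, sub_eq_zero] using this
  · intro h
    rw [eq_top_iff]
    intro x _
    have hx := DFunLike.congr_fun h x
    have : ((p x : W) : E) = x := by simpa [ContinuousLinearMap.mul_def] using hx
    rw [← this]
    exact (p x).2

variable [CompleteSpace E]

theorem isWeyl_iff_fredholmIndex_eq_zero {T : E →L[ℂ] E} (hT : T.IsFredholm) :
    IsWeyl T ↔ fredholmIndex T = 0 := by
  rw [isWeyl_iff_finrank_eq hT, fredholmIndex, sub_eq_zero, Nat.cast_inj]

/-- The range of a left-invertible operator which is invertible modulo operators of finite rank is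
closed of finite codimension, and isomorphic to the whole space. -/
theorem mul_eq_one_of_forall_isEmpty_equiv
    (hd : ∀ W : Submodule ℂ E, IsClosed (W : Set E) → W ≠ ⊤ → FiniteDimensional ℂ (E ⧸ W) →
      IsEmpty (E ≃L[ℂ] W))
    {V L : E →L[ℂ] E} (h1 : L * V = 1) (h2 : IsFiniteRank (V * L - 1)) : V * L = 1 := by
  by_contra hne
  have hLV : ∀ x, L (V x) = x := fun x => DFunLike.congr_fun h1 x
  have hker : V.range = (V * L - 1).ker := by
    ext y
    constructor
    · rintro ⟨x, rfl⟩
      change V (L (V x)) - V x = 0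
      rw [hLV, sub_self]
    · intro hy
      exact ⟨L y, sub_eq_zero.1 hy⟩
  have hcl : IsClosed (V.range : Set E) := by
    rw [hker]; exact ContinuousLinearMap.isClosed_ker _
  have hfin : FiniteDimensional ℂ (E ⧸ V.range) := by
    rw [hker]; exact LinearMap.ker_coFG_iff_hasFiniteRange.2 h2
  have hinj : Function.Injective V := Function.LeftInverse.injective hLV
  refine (hd V.range hcl (fun htop => hne ?_) hfin).false (V.equivRange hinj hcl)
  ext y
  have hy : y ∈ V.range := by rw [htop]; trivial
  obtain ⟨x, rfl⟩ := hy
  change V (L (V x)) = V x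
  rw [hLV]

/-- If `E` is isomorphic to none of its proper closed subspaces of finite codimension, then all
Fredholm operators on `E` have index zero. -/
theorem fredholmIndex_eq_zero_of_forall_isEmpty_equiv
    (hd : ∀ W : Submodule ℂ E, IsClosed (W : Set E) → W ≠ ⊤ → FiniteDimensional ℂ (E ⧸ W) →
      IsEmpty (E ≃L[ℂ] W))
    {T : E →L[ℂ] E} (hT : T.IsFredholm) : fredholmIndex T = 0 := by
  obtain ⟨pkg⟩ := hT.nonempty_fredholmPackage
  rw [fredholmIndex, sub_eq_zero, Nat.cast_inj, finrank_ker_of_package pkg,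
    finrank_coker_of_package pkg]
  rcases le_total (Module.finrank ℂ pkg.decDom.X₀) (Module.finrank ℂ pkg.decCodom.X₀) with h | h
  · obtain ⟨V, L, h1, -, h3, h4⟩ := exists_left_invertible_of_package pkg h
    exact h4.1 (mul_eq_one_of_forall_isEmpty_equiv hd h1 h3)
  · obtain ⟨V, L, h1, -, h3, h4⟩ := exists_left_invertible_of_package (packageSymm pkg) h
    exact (h4.1 (mul_eq_one_of_forall_isEmpty_equiv hd h1 h3)).symm

end FredholmLifting

/-! ### Lifting invertible matrices over `ℬ(X) / 𝒥(X)` -/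

section LiftingOperators

variable {J : OperatorIdeal.{u}} {X : Type u} [NormedAddCommGroup X] [NormedSpace ℂ X]
  [CompleteSpace X] [InfiniteDimensional X]

/-- If Fredholm operators on `X^r` have index zero, each invertible `r × r` matrix over
`ℬ(X) / 𝒥(X)` lifts to an invertible matrix over `ℬ(X)`. -/
theorem exists_lift_of_fredholmIndex_eq_zero (hnonzero : J.IsNonzero)
    (hsing : J.IsContainedInStrictlySingular) {ι : Type} [Fintype ι] [DecidableEq ι]
    (he : ∀ T : (ι → X) →L[ℂ] (ι → X), T.IsFredholm → fredholmIndex T = 0)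
    (u : GLn ι ((X →L[ℂ] X) ⧸ J.at X)) :
    ∃ v : GLn ι (X →L[ℂ] X), GLn.map (Ideal.Quotient.mk (J.at X)) v = u := by
  have lift : ∀ M : Matrix ι ι ((X →L[ℂ] X) ⧸ J.at X),
      ∃ N : Matrix ι ι (X →L[ℂ] X), N.map (Ideal.Quotient.mk (J.at X)) = M := by
    intro M
    choose f hf using fun i j => Ideal.Quotient.mk_surjective (M i j)
    exact ⟨Matrix.of f, by ext i j; exact hf i j⟩
  obtain ⟨M, hM⟩ := lift u.val
  obtain ⟨N, hN⟩ := lift (u⁻¹).val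
  have h1 : IsWeyl (matOp M * matOp N) := by
    rw [← map_mul]
    refine isWeyl_matOp_of_map_mk_eq hsing (w := 1) ?_
    rw [Matrix.map_mul, hM, hN, Units.mul_inv, Units.val_one,
      Matrix.map_one _ (map_zero _) (map_one _)]
  have h2 : IsWeyl (matOp N * matOp M) := by
    rw [← map_mul]
    refine isWeyl_matOp_of_map_mk_eq hsing (w := 1) ?_
    rw [Matrix.map_mul, hM, hN, Units.inv_mul, Units.val_one,
      Matrix.map_one _ (map_zero _) (map_one _)]
  have hF := isFredholm_of_isWeyl_mul h1 h2
  obtain ⟨G, hG⟩ := (isWeyl_iff_fredholmIndex_eq_zero hF).2 (he _ hF)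
  refine ⟨Units.mapEquiv (matOp (X := X) (ι := ι)).symm.toMulEquiv G, ?_⟩
  ext1
  rw [GLn.map_val, ← hM]
  refine map_mk_eq_of_isFiniteRank hnonzero ?_
  have e : matOp (Units.mapEquiv (matOp (X := X) (ι := ι)).symm.toMulEquiv G).val = G :=
    matOp.apply_symm_apply _
  rwa [e]

theorem isUnit_of_isUnit_reindex_fromBlocks {R : Type u} [Ring R] {m k n : Type} [Fintype m]
    [DecidableEq m] [Fintype k] [DecidableEq k] [Fintype n] [DecidableEq n] (e : m ⊕ k ≃ n)
    {M : Matrix m m R} (h : IsUnit ((fromBlocks M 0 0 (1 : Matrix k k R)).submatrix e.symm e.symm)) :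
    ∃ N, M * N = 1 := by
  obtain ⟨U, hU⟩ := h
  let N := U⁻¹.val.submatrix e e
  have hN : fromBlocks M 0 0 (1 : Matrix k k R) * N = 1 := by
    have : fromBlocks M 0 0 (1 : Matrix k k R) = U.val.submatrix e e := by
      rw [hU]; simp
    rw [this, Matrix.submatrix_mul_equiv, Units.mul_inv, Matrix.submatrix_one_equiv]
  refine ⟨N.toBlocks₁₁, ?_⟩
  rw [← fromBlocks_toBlocks N, fromBlocks_multiply, ← fromBlocks_one, fromBlocks_inj] at hN
  simpa using hN.1

/-- If `K₁(π)` is surjective, a left-invertible operator on `X^ι` which is invertible modulo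
operators of finite rank is invertible: its class modulo `𝒥` lifts after adding an identity block,
so the enlarged operator is Weyl and left invertible. -/
theorem mul_eq_one_of_kOneProj_surjective (hnonzero : J.IsNonzero)
    (hsing : J.IsContainedInStrictlySingular) (hc : Function.Surjective (J.kOneProj X))
    {ι : Type} [Fintype ι] [DecidableEq ι] {V L : (ι → X) →L[ℂ] (ι → X)} (h1 : L * V = 1)
    (h2 : IsFiniteRank (V * L - 1)) : V * L = 1 := by
  let M := matOp.symm V
  let N := matOp.symm L
  have hNM : N * M = 1 := by
    rw [← map_mul, h1, map_one]
  have hMN : (M * N).map (Ideal.Quotient.mk (J.at X)) = 1 := by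
    rw [← Matrix.map_one (Ideal.Quotient.mk (J.at X)) (map_zero _) (map_one _)]
    refine map_mk_eq_of_isFiniteRank hnonzero ?_
    rw [map_mul, map_one]
    simpa [M, N] using h2
  let u : GLn ι ((X →L[ℂ] X) ⧸ J.at X) :=
    ⟨M.map (Ideal.Quotient.mk (J.at X)), N.map (Ideal.Quotient.mk (J.at X)),
      by rw [← Matrix.map_mul, hMN],
      by rw [← Matrix.map_mul, hNM, Matrix.map_one _ (map_zero _) (map_one _)]⟩
  obtain ⟨a, k, e, w, hw⟩ := exists_lift_of_kOne_map_surjective hc u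
  let big : Matrix ι ι (X →L[ℂ] X) → Matrix (Fin k) (Fin k) (X →L[ℂ] X) := fun Q =>
    (fromBlocks Q 0 0 (1 : Matrix (Fin a) (Fin a) (X →L[ℂ] X))).submatrix e.symm e.symm
  have hW : IsWeyl (matOp (big M)) := by
    refine isWeyl_matOp_of_map_mk_eq hsing (w := w) ?_
    have := congrArg Units.val hw
    rw [GLn.map_val, GLn.reindex_val, GLn.block_val, Units.val_one] at this
    rw [this, ← Matrix.submatrix_map, map_fromBlocks_one]
  have hleft : matOp (big N) * matOp (big M) = 1 := by
    rw [← map_mul, Matrix.submatrix_mul_equiv, fromBlocks_multiply]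
    simp [hNM]
  have hu := hW.isUnit_of_mul_eq_one hleft
  have hu' : IsUnit (big M) := by
    have := hu.map (matOp (X := X) (ι := Fin k)).symm
    rwa [RingEquiv.symm_apply_apply] at this
  obtain ⟨R, hR⟩ := isUnit_of_isUnit_reindex_fromBlocks e hu'
  have hRN : N = R := left_inv_eq_right_inv hNM hR
  rw [← hRN] at hR
  have := congrArg matOp hR
  simpa [M, N] using this

end LiftingOperators

end BanachK


theorem proposition4p2 (X : Type u) [NormedAddCommGroup X] [NormedSpace ℂ X] [CompleteSpace X]
    [BanachK.InfiniteDimensional X] (J : BanachK.OperatorIdeal.{u}) (hclosed : J.IsClosed)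
    (hnonzero : J.IsNonzero) (hsing : J.IsContainedInStrictlySingular) :
    [ -- (a) `K₀(ι)` is injective
      Function.Injective (J.kZeroIncl X),
      -- (b) the index map is zero
      J.delta X = 0,
      -- (c) `K₁(π)` is surjective
      Function.Surjective (J.kOneProj X),
      -- (c, continued) `K₁(π)` is an isomorphism
      Function.Bijective (J.kOneProj X),
      -- (d) no `X^m` is linearly homeomorphic to a proper closed subspace of finite codimension
      ∀ (m : ℕ) (W : Submodule ℂ (Fin m → X)), 1 ≤ m → IsClosed (W : Set (Fin m → X)) → W ≠ ⊤ →
        FiniteDimensional ℂ ((Fin m → X) ⧸ W) → IsEmpty ((Fin m → X) ≃L[ℂ] W),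
      -- (e) every Fredholm operator on every `X^m` has index zero
      ∀ (m : ℕ) (T : (Fin m → X) →L[ℂ] (Fin m → X)), 1 ≤ m → T.IsFredholm →
        BanachK.fredholmIndex T = 0 ].TFAE ∧
    (BanachK.IsStablyFinite (X →L[ℂ] X) →
      Function.Injective (J.kZeroIncl X) ∧
      J.delta X = 0 ∧
      Function.Bijective (J.kOneProj X) ∧
      (∀ (m : ℕ) (W : Submodule ℂ (Fin m → X)), 1 ≤ m → IsClosed (W : Set (Fin m → X)) → W ≠ ⊤ →
        FiniteDimensional ℂ ((Fin m → X) ⧸ W) → IsEmpty ((Fin m → X) ≃L[ℂ] W)) ∧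
      (∀ (m : ℕ) (T : (Fin m → X) →L[ℂ] (Fin m → X)), 1 ≤ m → T.IsFredholm →
        BanachK.fredholmIndex T = 0)) := by
  have tfae : [ Function.Injective (J.kZeroIncl X),
      J.delta X = 0,
      Function.Surjective (J.kOneProj X),
      Function.Bijective (J.kOneProj X),
      ∀ (m : ℕ) (W : Submodule ℂ (Fin m → X)), 1 ≤ m → IsClosed (W : Set (Fin m → X)) → W ≠ ⊤ →
        FiniteDimensional ℂ ((Fin m → X) ⧸ W) → IsEmpty ((Fin m → X) ≃L[ℂ] W),
      ∀ (m : ℕ) (T : (Fin m → X) →L[ℂ] (Fin m → X)), 1 ≤ m → T.IsFredholm →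
        BanachK.fredholmIndex T = 0 ].TFAE := by
    tfae_have 1 → 2 := by
      intro ha
      ext x
      refine congrArg Subtype.val (ha ?_ : J.delta X x = 0)
      rw [map_zero]
      exact BanachK.kZeroNonunital_map_indexMap x
    tfae_have 2 → 3 := by
      intro hb x
      induction x using BanachK.KOne.ind with
      | h n u =>
      obtain ⟨k, v, hv⟩ :=
        BanachK.exists_lift_of_indexMap_eq_zero u (DFunLike.congr_fun hb (BanachK.KOne.mk u))
      refine ⟨BanachK.KOne.mk v, ?_⟩
      rw [BanachK.OperatorIdeal.kOneProj, BanachK.KOne.map_mk, hv, BanachK.KOne.mk_eq_iff]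
      exact (BanachK.StablyJoined.of_isExtension (BanachK.IsExtension.block_one u)).symm
    tfae_have 3 → 4 := fun hc =>
      ⟨BanachK.kOne_map_injective fun _ _ h => BanachK.joined_one_of_map_mk_eq_one hsing h, hc⟩
    tfae_have 4 → 3 := fun h => h.2
    tfae_have 3 → 5 := by
      intro hc m W _ hW hne hfin
      refine ⟨fun φ => ?_⟩
      obtain ⟨V, L, h1, h2, h3⟩ := BanachK.exists_left_invertible_of_equiv hW φ
      exact hne (h3 (BanachK.mul_eq_one_of_kOneProj_surjective hnonzero hsing hc h1 h2))
    tfae_have 5 → 6 := fun hd m T hm hT =>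
      BanachK.fredholmIndex_eq_zero_of_forall_isEmpty_equiv (fun W => hd m W hm) hT
    tfae_have 6 → 1 := by
      intro he
      refine BanachK.kZeroNonunital_map_injective_of_lift fun r u => ?_
      rcases Nat.eq_zero_or_pos r with rfl | hr
      · exact ⟨1, Subsingleton.elim _ _⟩
      · exact BanachK.exists_lift_of_fredholmIndex_eq_zero hnonzero hsing
          (fun T => he r T hr) u
    tfae_finish
  refine ⟨tfae, fun hfin => ?_⟩
  have hd : ∀ (m : ℕ) (W : Submodule ℂ (Fin m → X)), 1 ≤ m → IsClosed (W : Set (Fin m → X)) →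
      W ≠ ⊤ → FiniteDimensional ℂ ((Fin m → X) ⧸ W) → IsEmpty ((Fin m → X) ≃L[ℂ] W) := by
    intro m W _ hW hne _
    refine ⟨fun φ => ?_⟩
    obtain ⟨V, L, h1, -, h3⟩ := BanachK.exists_left_invertible_of_equiv hW φ
    -- the idempotent `V L` is equivalent to `L V = 1` and lies below it
    let M := BanachK.matOp.symm V
    let N := BanachK.matOp.symm L
    have hNM : N * M = 1 := by rw [← map_mul, h1, map_one]
    have hMN : M * N = 1 := hfin m (M * N) 1
      (by rw [mul_assoc, ← mul_assoc N, hNM, one_mul]) (one_mul 1) ⟨M, N, rfl, hNM.symm⟩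
      (mul_one _) (one_mul _)
    refine hne (h3 ?_)
    have := congrArg BanachK.matOp hMN
    simpa [M, N] using this
  exact ⟨(tfae.out 4 0).1 hd, (tfae.out 4 1).1 hd, (tfae.out 4 3).1 hd, hd, (tfae.out 4 5).1 hd⟩
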